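/- Let $b_1,b_2,c,\beta_1,\beta_2,C^*>0$ be constants, $b=\sqrt{b_1^2+b_2^2}$, $\boldsymbol\beta=(b_1,b_2)^T/b$, $\boldsymbol\eta=(-b_2,b_1)^T/b$, write $v_\zeta=\boldsymbol\zeta^T\nabla v$ for a unit vector $\boldsymbol\zeta$, and let $\Omega=(0,1)^2$. Let $N\ge 2$ be an even integer, $0<\varepsilon\le N^{-1}$, and suppose that $\lambda_x:=\frac52\frac{\varepsilon}{\beta_1}\ln N\le\frac12$, $\lambda_y:=\frac52\frac{\varepsilon}{\beta_2}\ln N\le\frac12$ and $c\,C^*N^{-1}\le\frac12$. Put $\Omega_s=[0,1-\lambda_x]\times[0,1-\lambda_y]$, $\Omega_x=[1-\lambda_x,1]\times[0,1-\lambda_y]$, $\Omega_y=[0,1-\lambda_x]\times[1-\lambda_y,1]$, $\Omega_{xy}=[1-\lambda_x,1]\times[1-\lambda_y,1]$. The Shishkin mesh has the nodes $(x_i,y_j)$, $0\le i,j\le N$, with $x_i=2i(1-\lambda_x)/N$ for $i\le N/2$, $x_i=1-2(N-i)\lambda_x/N$ for $i>N/2$, and $y_j$ defined in the same way with $\lambda_y$;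 each rectangle $[x_i,x_{i+1}]\times[y_j,y_{j+1}]$ is divided into two triangles by the diagonal from $(x_i,y_{j+1})$ to $(x_{i+1},y_j)$. Let $V^N$ be the space of continuous functions on $\bar\Omega$ that vanish on $\partial\Omega$ and are affine on each mesh triangle. Let $\delta=C^*N^{-1}$ on $\Omega_s$ and $\delta=0$ elsewhere; let $\hat\varepsilon$ be constant on $\Omega_s$ (with value $\hat\varepsilon_s$) and constant on $\Omega\setminus\Omega_s$, with $\varepsilon\le\hat\varepsilon\le N^{-1}$. Put $\delta_M=\max\delta=C^*N^{-1}$ and $\hat\varepsilon_M=\max\hat\varepsilon$. With $(\cdot,\cdot)$ and $\|\cdot\|$ the inner product and norm of $L^2(\Omega)$, let $$a_{MSD}(u,v)=\varepsilon(u_\beta,v_\beta)+(\hat\varepsilon u_\eta,v_\eta)+(bu_\beta+cu,v)+(bu_\beta+cu,\delta b v_\beta),$$ $$\|v\|_{MSD}^2=\varepsilon\|v_\beta\|^2+\|\hat\varepsilon^{1/2}v_\eta\|^2+c\|v\|^2+\|\delta^{1/2}bv_\beta\|^2 .$$ For a mesh node $\boldsymbol x^*\in\Omega$, the discrete Green function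 $G\in V^N$ is defined by $a_{MSD}(v,G)=v(\boldsymbol x^*)$ for all $v\in V^N$. For $\sigma_\beta,\sigma_\eta>0$ let $g(r)=2/(1+e^r)$, $$\omega(\boldsymbol x)=g\Big(\tfrac{(\boldsymbol x-\boldsymbol x^*)\cdot\boldsymbol\beta}{\sigma_\beta}\Big)\,g\Big(\tfrac{(\boldsymbol x-\boldsymbol x^*)\cdot\boldsymbol\eta}{\sigma_\eta}\Big)\,g\Big(-\tfrac{(\boldsymbol x-\boldsymbol x^*)\cdot\boldsymbol\eta}{\sigma_\eta}\Big),$$ $$|||G|||_\omega^2=\varepsilon\|\omega^{-1/2}G_\beta\|^2+\|\hat\varepsilon^{1/2}\omega^{-1/2}G_\eta\|^2+\tfrac b2\|((\omega^{-1})_\beta)^{1/2}G\|^2+c\|\omega^{-1/2}G\|^2+b^2\|\delta^{1/2}\omega^{-1/2}G_\beta\|^2 .$$ **Theorem.** There are constants $k_0>1$ and $C>0$, depending only on $b_1,b_2,c,\beta_1,\beta_2,C^*$, such that the following holds for all $k\ge k_0$, for all $N,\varepsilon,\hat\varepsilon$ as above, and for all $\sigma_\beta,\sigma_\eta$ that satisfy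 1. $\sigma_\beta\ge k(\varepsilon+\delta_M)$ and $\sigma_\eta\ge k\hat\varepsilon_M^{1/2}$; 2. $\sigma_\beta\ge kN^{-1}$, $\sigma_\eta\ge kN^{-3/4}$, and $\sigma_\eta\ge kN^{-1/2}$ if $\hat\varepsilon_s\le N^{-2}$, $\sigma_\eta\ge k\hat\varepsilon_s^{-1/2}N^{-3/2}$ if $\hat\varepsilon_s\ge N^{-2}$; 3. $\sigma_\beta\ge kN^{-1}\ln N$, $\sigma_\eta\ge kN^{-1}\ln N$ and $\sigma_\eta\ge k\varepsilon^{1/4}N^{-1/2}\ln^{1/2}N$. For every mesh node $\boldsymbol x^*\in\Omega\setminus\Omega_{xy}$, the discrete Green function $G$ satisfies $$\|G\|_{MSD}\le\sqrt8\,|||G|||_\omega ,$$ and $$\sqrt8\,|||G|||_\omega\le CN\sigma_\beta^{1/2}\ \text{ if }\boldsymbol x^*\in\Omega_s,\qquad \sqrt8\,|||G|||_\omega\le CN^{1/2}\ln^{1/2}N\ \text{ if }\boldsymbol x^*\in\Omega_x\cup\Omega_y .$$ -/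

import Mathlib

open MeasureTheory Set

noncomputable section

namespace ShishkinSDFEM

/-- The fixed data: the constant convection vector `(b₁, b₂)`, the constant reaction coefficient `c`,
the positive constants `β₁`, `β₂` in the mesh transition points, and the constant `Cstar` of the
stabilization parameter.  All other constants may depend on these numbers only. -/
structure Coeff where
  b₁ : ℝ
  b₂ : ℝ
  c : ℝ
  β₁ : ℝ
  β₂ : ℝ
  Cstar : ℝ
  b₁_pos : 0 < b₁
  b₂_pos : 0 < b₂
  c_pos : 0 < c
  β₁_pos : 0 < β₁
  β₂_pos : 0 < β₂
  Cstar_pos : 0 < Cstar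

/-- The varying data: the mesh parameter `N`, the diffusion parameter `ε`, and the two constant
values `εs` on `Ω_s` and `εf` on `Ω ∖ Ω_s` of the crosswind diffusion. -/
structure Discr where
  N : ℕ
  ε : ℝ
  εs : ℝ
  εf : ℝ

variable (P : Coeff) (D : Discr)

/-- The transition parameter `min {1/2, ρ (ε / β) ln N}` with `ρ = 2.5`. -/
def transition (β ε : ℝ) (N : ℕ) : ℝ :=
  min (1 / 2) (5 / 2 * (ε / β) * Real.log N)

def lamX : ℝ := transition P.β₁ D.ε D.N

def lamY : ℝ := transition P.β₂ D.ε D.N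

/-- The standing assumptions on the varying data.  The last clause is the usual bound on the
streamline diffusion parameter that makes the bilinear form coercive. -/
structure Admissible : Prop where
  even : Even D.N
  pos : 0 < D.N
  ε_pos : 0 < D.ε
  ε_le : D.ε ≤ 1 / D.N
  layer_x : 5 / 2 * (D.ε / P.β₁) * Real.log D.N ≤ 1 / 2
  layer_y : 5 / 2 * (D.ε / P.β₂) * Real.log D.N ≤ 1 / 2
  εs_ge : D.ε ≤ D.εs
  εs_le : D.εs ≤ 1 / D.N
  εf_ge : D.ε ≤ D.εf
  εf_le : D.εf ≤ 1 / D.N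
  stab : P.c * (P.Cstar / D.N) ≤ 1 / 2

/-- The `i`-th point, `0 ≤ i ≤ N`, of the one-dimensional Shishkin mesh (`N` even). -/
def meshPoint (lam : ℝ) (N i : ℕ) : ℝ :=
  if 2 * i ≤ N then 2 * (i : ℝ) * (1 - lam) / N else 1 - 2 * ((N : ℝ) - i) * lam / N

def meshX (i : ℕ) : ℝ := meshPoint (lamX P D) D.N i

def meshY (j : ℕ) : ℝ := meshPoint (lamY P D) D.N j

/-- The open unit square. -/
def Omega : Set (ℝ × ℝ) := Ioo 0 1 ×ˢ Ioo 0 1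

def OmegaS : Set (ℝ × ℝ) := Icc 0 (1 - lamX P D) ×ˢ Icc 0 (1 - lamY P D)

def OmegaX : Set (ℝ × ℝ) := Icc (1 - lamX P D) 1 ×ˢ Icc 0 (1 - lamY P D)

def OmegaY : Set (ℝ × ℝ) := Icc 0 (1 - lamX P D) ×ˢ Icc (1 - lamY P D) 1

def OmegaXY : Set (ℝ × ℝ) := Icc (1 - lamX P D) 1 ×ˢ Icc (1 - lamY P D) 1

/-- The lower left triangle of the mesh rectangle with indices `i`, `j`. -/
def tri1 (i j : ℕ) : Set (ℝ × ℝ) :=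
  convexHull ℝ {(meshX P D i, meshY P D j), (meshX P D (i + 1), meshY P D j),
    (meshX P D i, meshY P D (j + 1))}

/-- The upper right triangle of the mesh rectangle with indices `i`, `j`. -/
def tri2 (i j : ℕ) : Set (ℝ × ℝ) :=
  convexHull ℝ {(meshX P D i, meshY P D (j + 1)), (meshX P D (i + 1), meshY P D j),
    (meshX P D (i + 1), meshY P D (j + 1))}

/-- `v` is a polynomial of degree at most one on `K`. -/
def IsP1On (v : ℝ × ℝ → ℝ) (K : Set (ℝ × ℝ)) : Prop :=
  ∃ a₀ a₁ a₂ : ℝ, ∀ p ∈ K, v p = a₀ + a₁ * p.1 + a₂ * p.2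

/-- The linear finite element space on the Shishkin triangulation.  Only the values on the closed
unit square matter. -/
def feSpace : Set (ℝ × ℝ → ℝ) :=
  {v | ContinuousOn v (closure Omega) ∧ (∀ p ∈ frontier Omega, v p = 0) ∧
    ∀ i < D.N, ∀ j < D.N, IsP1On v (tri1 P D i j) ∧ IsP1On v (tri2 P D i j)}

/-- The Euclidean length of the convection vector. -/
def bNorm : ℝ := Real.sqrt (P.b₁ ^ 2 + P.b₂ ^ 2)

/-- The unit vector in streamline direction. -/
def dirBeta : ℝ × ℝ := (P.b₁ / bNorm P, P.b₂ / bNorm P)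

/-- The unit vector in crosswind direction. -/
def dirEta : ℝ × ℝ := (-P.b₂ / bNorm P, P.b₁ / bNorm P)

/-- The directional derivative of `v` in direction `ζ`.  For a finite element function it is
the classical derivative in the interior of each mesh triangle, hence almost everywhere. -/
def dd (ζ : ℝ × ℝ) (v : ℝ × ℝ → ℝ) (p : ℝ × ℝ) : ℝ := fderiv ℝ v p ζ

open scoped Classical in
/-- The stabilization parameter; it is constant in the interior of each mesh triangle. -/
def delta (p : ℝ × ℝ) : ℝ := if p ∈ OmegaS P D then P.Cstar / D.N else 0

open scoped Classical in
/-- The crosswind diffusion; it is constant in the interior of each mesh triangle. -/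
def epsHat (p : ℝ × ℝ) : ℝ := if p ∈ OmegaS P D then D.εs else D.εf

/-- The maximum of the stabilization parameter. -/
def deltaMax : ℝ := P.Cstar / D.N

/-- The maximum of the crosswind diffusion. -/
def epsHatMax : ℝ := max D.εs D.εf

/-- The bilinear form of the modified SDFEM.  Sums over mesh triangles `K` of integrals over `K`
with the factor `δ_K` are written as integrals over `Ω` with the function `delta`. -/
def aMSD (u v : ℝ × ℝ → ℝ) : ℝ :=
  (∫ p in Omega, D.ε * (dd (dirBeta P) u p * dd (dirBeta P) v p))
  + (∫ p in Omega, epsHat P D p * (dd (dirEta P) u p * dd (dirEta P) v p))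
  + (∫ p in Omega, (bNorm P * dd (dirBeta P) u p + P.c * u p) * v p)
  + (∫ p in Omega, (bNorm P * dd (dirBeta P) u p + P.c * u p)
      * (delta P D p * (bNorm P * dd (dirBeta P) v p)))

/-- The energy norm of the modified SDFEM. -/
def normMSD (v : ℝ × ℝ → ℝ) : ℝ :=
  Real.sqrt
    ((∫ p in Omega, D.ε * dd (dirBeta P) v p ^ 2)
    + (∫ p in Omega, epsHat P D p * dd (dirEta P) v p ^ 2)
    + (∫ p in Omega, P.c * v p ^ 2)
    + (∫ p in Omega, delta P D p * (bNorm P * dd (dirBeta P) v p) ^ 2))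

/-- `G` is the discrete Green function associated with the point `xs`. -/
def IsDiscreteGreen (xs : ℝ × ℝ) (G : ℝ × ℝ → ℝ) : Prop :=
  G ∈ feSpace P D ∧ ∀ v ∈ feSpace P D, aMSD P D v G = v xs

/-- `xs` is a mesh node in the open unit square. -/
def IsInteriorNode (xs : ℝ × ℝ) : Prop :=
  xs ∈ Omega ∧ ∃ i ≤ D.N, ∃ j ≤ D.N, xs = (meshX P D i, meshY P D j)

def dot (p q : ℝ × ℝ) : ℝ := p.1 * q.1 + p.2 * q.2

def gFun (r : ℝ) : ℝ := 2 / (1 + Real.exp r)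

/-- The weight function with parameters `σβ`, `ση`, centred at `xs`. -/
def weight (σβ ση : ℝ) (xs p : ℝ × ℝ) : ℝ :=
  gFun (dot (p - xs) (dirBeta P) / σβ) * gFun (dot (p - xs) (dirEta P) / ση)
    * gFun (-(dot (p - xs) (dirEta P) / ση))

/-- The weighted energy norm. -/
def normWeighted (σβ ση : ℝ) (xs : ℝ × ℝ) (G : ℝ × ℝ → ℝ) : ℝ :=
  Real.sqrt
    ((∫ p in Omega, D.ε * (Real.sqrt (weight P σβ ση xs p)⁻¹ * dd (dirBeta P) G p) ^ 2)
    + (∫ p in Omega,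
        epsHat P D p * (Real.sqrt (weight P σβ ση xs p)⁻¹ * dd (dirEta P) G p) ^ 2)
    + bNorm P / 2 * (∫ p in Omega,
        (Real.sqrt (dd (dirBeta P) (fun q => (weight P σβ ση xs q)⁻¹) p) * G p) ^ 2)
    + P.c * (∫ p in Omega, (Real.sqrt (weight P σβ ση xs p)⁻¹ * G p) ^ 2)
    + (∫ p in Omega, bNorm P ^ 2 * delta P D p
        * (Real.sqrt (weight P σβ ση xs p)⁻¹ * dd (dirBeta P) G p) ^ 2))

/-- First condition on the weight parameters. -/
def SigmaCond1 (k σβ ση : ℝ) : Prop :=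
  k * (D.ε + deltaMax P D) ≤ σβ ∧ k * Real.sqrt (epsHatMax D) ≤ ση

/-- Second condition on the weight parameters. -/
def SigmaCond2 (k σβ ση : ℝ) : Prop :=
  k * (D.N : ℝ)⁻¹ ≤ σβ ∧ k * (D.N : ℝ) ^ (-(3 / 4) : ℝ) ≤ ση ∧
  (D.εs ≤ (D.N : ℝ) ^ (-2 : ℝ) → k * (D.N : ℝ) ^ (-(1 / 2) : ℝ) ≤ ση) ∧
  ((D.N : ℝ) ^ (-2 : ℝ) ≤ D.εs →
    k * D.εs ^ (-(1 / 2) : ℝ) * (D.N : ℝ) ^ (-(3 / 2) : ℝ) ≤ ση)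

/-- Third condition on the weight parameters. -/
def SigmaCond3 (k σβ ση : ℝ) : Prop :=
  k * (D.N : ℝ)⁻¹ * Real.log D.N ≤ σβ ∧ k * (D.N : ℝ)⁻¹ * Real.log D.N ≤ ση ∧
  k * D.ε ^ (1 / 4 : ℝ) * (D.N : ℝ) ^ (-(1 / 2) : ℝ) * Real.log D.N ^ (1 / 2 : ℝ) ≤ ση

end ShishkinSDFEM

end

/-! Write W = ω⁻¹, V = W_β > 0, and let I be nodal interpolation on the mesh. The heart of the
matter is the bound |||G|||_ω² ≤ 4 G(x*). Since I(WG) is an admissible first argument of the form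
and W(x*) = 1, the definition of G gives a(I(WG), G) = G(x*). With E = WG - I(WG) this reads a(WG,
G) = G(x*) + a(E, G), so it suffices to bound a(WG, G) from below by half of |||G|||_ω² and a(E, G)
from above by a quarter of it.

Lower bound (`edens_le_adens`): subtracting b/2 times the vanishing integral of (WG·G)_β leaves b/2
V G² from the convection. Derivatives that fall on W produce V or at most W/σ_η; multiplied by ε, δ
or the crosswind diffusion these are small by the first condition on the weight parameters.

Interpolation error: G is affine on each triangle, so second derivatives of WG contain only D²W·G
and ∇W·∇G. The triangles have axis-parallel legs, and Rolle's theorem along the legs bounds the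
error by the oscillation of ∇(WG) without any condition on the aspect ratio (`interp_error`,
`WeightData.err_bounds`). The resulting quantity `errT` is compared with the local energy for three
kinds of triangles: two coarse legs, one coarse leg, two short legs. The second and third conditions
supply a small factor κ = 1/k (`integral_resid_le`).

Upper bound (`adens_errE_le`, `integral_edens_le`): in a(E, G) the convective derivative is moved
onto G. On Ω_s the stabilization absorbs G_β at the price N E². Elsewhere only ε is available and
the price is E²/ε; but E vanishes on the outflow boundary and the layers have width O(ε ln N), so a
weighted Poincaré inequality (`poincare`) turns this into ε ln²N |∇E|², which the interpolation
estimate covers.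

Finally G(x*)² ≤ R |||G|||_ω², which with the first bound gives |||G|||_ω² ≤ 16 R. For x* in Ω_s the
term V G² on one triangle gives R of order N² σ_β, because V(x*) = 1/(2σ_β) (`sq_le_coarse`). For x*
in Ω_x or Ω_y, G is summed along a mesh line to the boundary by Cauchy–Schwarz; the aspect ratio ε
ln N of the cells cancels ε, and R is of order N ln N (`sq_le_layer_fst`, `sq_le_layer_snd`). The
comparison with the unweighted norm only uses W ≥ 1/2.

Throughout, a finite element function is replaced by a globally Lipschitz interpolant that vanishes
off the open square, so that Rademacher's theorem and integration by parts on the whole plane apply.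
-/

noncomputable section

namespace ShishkinSDFEM

/-! ### Grids, hat functions and nodal interpolation -/

section

/-- A partition of the unit interval together with a Lipschitz function whose restriction to the
`i`-th cell is the affine map onto `[i, i + 1]`. -/
structure Grid (N : ℕ) where
  pt : ℕ → ℝ
  idx : ℝ → ℝ
  zero : pt 0 = 0
  one : pt N = 1
  lt : ∀ i < N, pt i < pt (i + 1)
  lip : ∃ K, LipschitzWith K idx
  idx_cell : ∀ i < N, ∀ x ∈ Icc (pt i) (pt (i + 1)),
    idx x = i + (x - pt i) / (pt (i + 1) - pt i)
  idx_nonpos : ∀ x ≤ 0, idx x ≤ 0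
  idx_ge : ∀ x, 1 ≤ x → N ≤ idx x

namespace Grid

variable {N : ℕ} (X Y : Grid N)

lemma pt_le_pt {i j : ℕ} (hij : i ≤ j) (hj : j ≤ N) : X.pt i ≤ X.pt j := by
  induction j, hij using Nat.le_induction with
  | base => exact le_rfl
  | succ n hn ih => exact (ih (by omega)).trans (X.lt n (by omega)).le

lemma pt_nonneg {i : ℕ} (hi : i ≤ N) : 0 ≤ X.pt i := X.zero ▸ X.pt_le_pt (Nat.zero_le i) hi

lemma pt_le_one {i : ℕ} (hi : i ≤ N) : X.pt i ≤ 1 := X.one ▸ X.pt_le_pt hi le_rfl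

lemma exists_cell (x : ℝ) (h0 : 0 ≤ x) (h1 : x ≤ 1) (hN : 0 < N) :
    ∃ i < N, x ∈ Icc (X.pt i) (X.pt (i + 1)) := by
  classical
  have hex : ∃ n, x ≤ X.pt (n + 1) :=
    ⟨N - 1, by rw [Nat.sub_add_cancel hN, X.one]; exact h1⟩
  have hle : Nat.find hex ≤ N - 1 :=
    Nat.find_min' hex (by rw [Nat.sub_add_cancel hN, X.one]; exact h1)
  refine ⟨Nat.find hex, by omega, ?_, Nat.find_spec hex⟩
  rcases Nat.eq_zero_or_pos (Nat.find hex) with h | h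
  · rw [h, X.zero]; exact h0
  · have := Nat.find_min hex (Nat.sub_one_lt h.ne')
    rw [Nat.sub_add_cancel h] at this
    exact (not_le.mp this).le

/-- The piecewise affine hat function of the node `(i, j)`. -/
def hat (i j : ℕ) (p : ℝ × ℝ) : ℝ :=
  max 0 (1 - max (max |X.idx p.1 - i| |Y.idx p.2 - j|) |X.idx p.1 - i + (Y.idx p.2 - j)|)

/-- The continuous piecewise affine function with the nodal values of `f`. -/
def interp (f : ℝ × ℝ → ℝ) (p : ℝ × ℝ) : ℝ :=
  ∑ i ∈ Finset.range (N + 1), ∑ j ∈ Finset.range (N + 1), f (X.pt i, Y.pt j) * hat X Y i j p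

end Grid

lemma LipschitzWith.abs_real {α : Type*} [PseudoEMetricSpace α] {f : α → ℝ} {K : NNReal}
    (hf : LipschitzWith K f) : LipschitzWith K (fun x => |f x|) := by
  have := (lipschitzWith_one_norm (E := ℝ)).comp hf
  rwa [one_mul] at this

/-- Being Lipschitz with some constant. -/
def Lip (f : ℝ × ℝ → ℝ) : Prop := ∃ K, LipschitzWith K f

namespace Lip

variable {f g : ℝ × ℝ → ℝ}

lemma add (hf : Lip f) (hg : Lip g) : Lip (fun p => f p + g p) := by
  obtain ⟨K, hK⟩ := hf; obtain ⟨K', hK'⟩ := hg; exact ⟨_, hK.add hK'⟩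

lemma sub (hf : Lip f) (hg : Lip g) : Lip (fun p => f p - g p) := by
  obtain ⟨K, hK⟩ := hf; obtain ⟨K', hK'⟩ := hg; exact ⟨_, hK.sub hK'⟩

lemma max (hf : Lip f) (hg : Lip g) : Lip (fun p => Max.max (f p) (g p)) := by
  obtain ⟨K, hK⟩ := hf; obtain ⟨K', hK'⟩ := hg; exact ⟨_, hK.max hK'⟩

lemma abs (hf : Lip f) : Lip (fun p => |f p|) := by
  obtain ⟨K, hK⟩ := hf; exact ⟨_, LipschitzWith.abs_real hK⟩

lemma const (c : ℝ) : Lip (fun _ => c) := ⟨0, LipschitzWith.const c⟩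

lemma const_mul (c : ℝ) (hf : Lip f) : Lip (fun p => c * f p) := by
  obtain ⟨K, hK⟩ := hf
  exact ⟨_, (lipschitzWith_smul c).comp hK⟩

lemma sum {ι : Type*} (s : Finset ι) {f : ι → ℝ × ℝ → ℝ} (hf : ∀ i ∈ s, Lip (f i)) :
    Lip (fun p => ∑ i ∈ s, f i p) := by
  classical
  induction s using Finset.induction_on with
  | empty => simpa using const 0
  | insert a s ha ih =>
    simp only [Finset.sum_insert ha]
    exact (hf a (by simp)).add (ih fun i hi => hf i (by simp [hi]))

lemma continuous (hf : Lip f) : Continuous f := by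
  obtain ⟨K, hK⟩ := hf; exact hK.continuous

end Lip

namespace Grid

variable {N : ℕ} (X Y : Grid N)

lemma lip_hat (i j : ℕ) : Lip (hat X Y i j) := by
  obtain ⟨K, hK⟩ := X.lip
  obtain ⟨K', hK'⟩ := Y.lip
  have h1 : Lip (fun p : ℝ × ℝ => X.idx p.1 - i) :=
    Lip.sub ⟨_, hK.comp LipschitzWith.prod_fst⟩ (Lip.const _)
  have h2 : Lip (fun p : ℝ × ℝ => Y.idx p.2 - j) :=
    Lip.sub ⟨_, hK'.comp LipschitzWith.prod_snd⟩ (Lip.const _)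
  exact (Lip.const 0).max ((Lip.const 1).sub ((h1.abs.max h2.abs).max (h1.add h2).abs))

lemma lip_interp (f : ℝ × ℝ → ℝ) : Lip (interp X Y f) :=
  Lip.sum _ fun i _ => Lip.sum _ fun j _ => (lip_hat X Y i j).const_mul _

lemma hat_eq_zero_of_fst {i j : ℕ} {p : ℝ × ℝ} (h : 1 ≤ |X.idx p.1 - i|) :
    hat X Y i j p = 0 := by
  refine max_eq_left ?_
  have := (le_max_left |X.idx p.1 - i| |Y.idx p.2 - j|).trans
    (le_max_left _ |X.idx p.1 - i + (Y.idx p.2 - j)|)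
  linarith

lemma hat_eq_zero_of_snd {i j : ℕ} {p : ℝ × ℝ} (h : 1 ≤ |Y.idx p.2 - j|) :
    hat X Y i j p = 0 := by
  refine max_eq_left ?_
  have := (le_max_right |X.idx p.1 - i| |Y.idx p.2 - j|).trans
    (le_max_left _ |X.idx p.1 - i + (Y.idx p.2 - j)|)
  linarith

/-- Vanishing at the nodes on the boundary of the unit square. -/
def BdryZero (f : ℝ × ℝ → ℝ) : Prop :=
  ∀ i ≤ N, ∀ j ≤ N, (i = 0 ∨ i = N ∨ j = 0 ∨ j = N) → f (X.pt i, Y.pt j) = 0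

/-- Outside the open interval the index function stays at or beyond 0 or `N`, at distance at least 1
from every interior index, so interior hats vanish there. The interpolant is thereby a Lipschitz
function on the whole plane with support in the closed square. -/
lemma interp_eq_zero {f : ℝ × ℝ → ℝ} (hf : BdryZero X Y f) {p : ℝ × ℝ} (hp : p ∉ Omega) :
    interp X Y f p = 0 := by
  refine Finset.sum_eq_zero fun i hi => Finset.sum_eq_zero fun j hj => ?_
  rw [Finset.mem_range] at hi hj
  by_cases hb : i = 0 ∨ i = N ∨ j = 0 ∨ j = N
  · rw [hf i (by omega) j (by omega) hb, zero_mul]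
  push Not at hb
  have hi1 : (1 : ℝ) ≤ i := by exact_mod_cast Nat.one_le_iff_ne_zero.mpr hb.1
  have hj1 : (1 : ℝ) ≤ j := by exact_mod_cast Nat.one_le_iff_ne_zero.mpr hb.2.2.1
  have hi2 : (i : ℝ) + 1 ≤ N := by exact_mod_cast (show i + 1 ≤ N by omega)
  have hj2 : (j : ℝ) + 1 ≤ N := by exact_mod_cast (show j + 1 ≤ N by omega)
  have hp' : p.1 ≤ 0 ∨ 1 ≤ p.1 ∨ p.2 ≤ 0 ∨ 1 ≤ p.2 := by
    by_contra hc
    push Not at hc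
    exact hp ⟨⟨hc.1, hc.2.1⟩, ⟨hc.2.2.1, hc.2.2.2⟩⟩
  have key : hat X Y i j p = 0 := by
    rcases hp' with h | h | h | h
    · exact hat_eq_zero_of_fst X Y (le_abs.mpr (Or.inr (by linarith [X.idx_nonpos _ h])))
    · exact hat_eq_zero_of_fst X Y (le_abs.mpr (Or.inl (by linarith [X.idx_ge _ h])))
    · exact hat_eq_zero_of_snd X Y (le_abs.mpr (Or.inr (by linarith [Y.idx_nonpos _ h])))
    · exact hat_eq_zero_of_snd X Y (le_abs.mpr (Or.inl (by linarith [Y.idx_ge _ h])))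
  rw [key, mul_zero]

/-- The values of the reference hat function. -/
def refHat (s t : ℝ) : ℝ := max 0 (1 - max (max |s| |t|) |s + t|)

lemma refHat_far {a : ℤ} (h0 : a ≠ 0) (h1 : a ≠ -1) {s t : ℝ} (hs : 0 ≤ s) (hs1 : s ≤ 1) :
    refHat (a + s) t = 0 := by
  refine max_eq_left ?_
  have h : 1 ≤ |(a : ℝ) + s| := by
    rcases lt_or_gt_of_ne h0 with h | h
    · have : (a : ℝ) ≤ -2 := by exact_mod_cast (show a ≤ -2 by omega)
      exact le_abs.mpr (Or.inr (by linarith))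
    · have : (1 : ℝ) ≤ a := by exact_mod_cast h
      exact le_abs.mpr (Or.inl (by linarith))
  have := (le_max_left |(a : ℝ) + s| |t|).trans (le_max_left _ |(a : ℝ) + s + t|)
  linarith

lemma refHat_comm (s t : ℝ) : refHat s t = refHat t s := by
  unfold refHat; rw [max_comm |s|, add_comm s]

/-- The integers are the offset of a cell from the node of the hat. The hexagonal support of the hat
meets the interior of a lower triangle for three offsets only, namely when the node is a vertex, and
there the hat is the barycentric coordinate of that vertex. -/
lemma refHat_lower (a b : ℤ) {s t : ℝ} (hs : 0 ≤ s) (ht : 0 ≤ t) (hst : s + t ≤ 1) :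
    refHat (a + s) (b + t) = (if a = 0 ∧ b = 0 then 1 - s - t else 0)
      + (if a = -1 ∧ b = 0 then s else 0) + (if a = 0 ∧ b = -1 then t else 0) := by
  by_cases ha : a ≠ 0 ∧ a ≠ -1
  · rw [refHat_far ha.1 ha.2 hs (by linarith)]; simp [ha.1, ha.2]
  by_cases hb : b ≠ 0 ∧ b ≠ -1
  · rw [refHat_comm, refHat_far hb.1 hb.2 ht (by linarith)]; simp [hb.1, hb.2]
  have ha' : a = 0 ∨ a = -1 := by omega
  have hb' : b = 0 ∨ b = -1 := by omega
  unfold refHat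
  rcases ha' with rfl | rfl <;> rcases hb' with rfl | rfl <;> simp <;>
    [rw [abs_of_nonneg hs, abs_of_nonneg ht, abs_of_nonneg (add_nonneg hs ht)];
     rw [abs_of_nonneg hs, abs_of_nonpos (show -1 + t ≤ 0 by linarith),
       abs_of_nonpos (show s + (-1 + t) ≤ 0 by linarith)];
     rw [abs_of_nonneg ht, abs_of_nonpos (show -1 + s ≤ 0 by linarith),
       abs_of_nonpos (show -1 + s + t ≤ 0 by linarith)];
     rw [abs_of_nonpos (show -1 + s ≤ 0 by linarith),
       abs_of_nonpos (show -1 + t ≤ 0 by linarith),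
       abs_of_nonpos (show -1 + s + (-1 + t) ≤ 0 by linarith)]] <;>
  grind

lemma refHat_neg (s t : ℝ) : refHat (-s) (-t) = refHat s t := by
  unfold refHat
  rw [abs_neg, abs_neg, show -s + -t = -(s + t) by ring, abs_neg]

/-- The hat is even, and the point reflection exchanges lower and upper triangles, taking the offset
`a` to `-1 - a` and the coordinate `s` to `1 - s`. -/
lemma refHat_upper (a b : ℤ) {s t : ℝ} (hs : s ≤ 1) (ht : t ≤ 1) (hst : 1 ≤ s + t) :
    refHat (a + s) (b + t) = (if a = -1 ∧ b = -1 then s + t - 1 else 0)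
      + (if a = 0 ∧ b = -1 then 1 - s else 0) + (if a = -1 ∧ b = 0 then 1 - t else 0) := by
  have := refHat_lower (-1 - a) (-1 - b) (s := 1 - s) (t := 1 - t) (by linarith) (by linarith)
    (by linarith)
  rw [← refHat_neg]
  have e1 : -((a : ℝ) + s) = ((-1 - a : ℤ) : ℝ) + (1 - s) := by push_cast; ring
  have e2 : -((b : ℝ) + t) = ((-1 - b : ℤ) : ℝ) + (1 - t) := by push_cast; ring
  rw [e1, e2, this]
  have i1 : (-1 - a = 0) ↔ a = -1 := by omega
  have i2 : (-1 - b = 0) ↔ b = -1 := by omega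
  have i3 : (-1 - a = -1) ↔ a = 0 := by omega
  have i4 : (-1 - b = -1) ↔ b = 0 := by omega
  simp only [i1, i2, i3, i4]
  congr 2
  congr 1
  ring

/-- The affine coordinate on the `i`-th cell. -/
def cc (i : ℕ) (x : ℝ) : ℝ := (x - X.pt i) / (X.pt (i + 1) - X.pt i)

lemma hat_eq_refHat {k l : ℕ} (hk : k < N) (hl : l < N) (i j : ℕ) {p : ℝ × ℝ}
    (h1 : p.1 ∈ Icc (X.pt k) (X.pt (k + 1))) (h2 : p.2 ∈ Icc (Y.pt l) (Y.pt (l + 1))) :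
    hat X Y i j p = refHat (((k - i : ℤ) : ℝ) + X.cc k p.1) (((l - j : ℤ) : ℝ) + Y.cc l p.2) := by
  unfold hat refHat
  rw [X.idx_cell k hk _ h1, Y.idx_cell l hl _ h2]
  have e1 : (k : ℝ) + (p.1 - X.pt k) / (X.pt (k + 1) - X.pt k) - i
      = ((k - i : ℤ) : ℝ) + X.cc k p.1 := by unfold cc; push_cast; ring
  have e2 : (l : ℝ) + (p.2 - Y.pt l) / (Y.pt (l + 1) - Y.pt l) - j
      = ((l - j : ℤ) : ℝ) + Y.cc l p.2 := by unfold cc; push_cast; ring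
  rw [e1, e2]

lemma cc_nonneg_iff {i : ℕ} (hi : i < N) {x : ℝ} : 0 ≤ X.cc i x ↔ X.pt i ≤ x := by
  have := X.lt i hi
  unfold cc
  rw [le_div_iff₀ (by linarith), zero_mul, sub_nonneg]

lemma cc_le_one_iff {i : ℕ} (hi : i < N) {x : ℝ} : X.cc i x ≤ 1 ↔ x ≤ X.pt (i + 1) := by
  have := X.lt i hi
  unfold cc
  rw [div_le_iff₀ (by linarith), one_mul, sub_le_sub_iff_right]

lemma sum_ite_node {k l : ℕ} (hk : k ≤ N) (hl : l ≤ N) (f : ℝ × ℝ → ℝ) (c : ℝ) :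
    ∑ i ∈ Finset.range (N + 1), ∑ j ∈ Finset.range (N + 1),
      f (X.pt i, Y.pt j) * (if i = k ∧ j = l then c else 0) = c * f (X.pt k, Y.pt l) := by
  rw [Finset.sum_eq_single k, Finset.sum_eq_single l]
  · simp [mul_comm]
  · intro j _ hj; simp [hj]
  · intro h; exact absurd (Finset.mem_range.mpr (by omega)) h
  · intro i _ hi; simp [hi]
  · intro h; exact absurd (Finset.mem_range.mpr (by omega)) h

lemma interp_lower (f : ℝ × ℝ → ℝ) {k l : ℕ} (hk : k < N) (hl : l < N) {p : ℝ × ℝ}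
    (hs : 0 ≤ X.cc k p.1) (ht : 0 ≤ Y.cc l p.2) (hst : X.cc k p.1 + Y.cc l p.2 ≤ 1) :
    interp X Y f p = (1 - X.cc k p.1 - Y.cc l p.2) * f (X.pt k, Y.pt l)
      + X.cc k p.1 * f (X.pt (k + 1), Y.pt l) + Y.cc l p.2 * f (X.pt k, Y.pt (l + 1)) := by
  have h1 : p.1 ∈ Icc (X.pt k) (X.pt (k + 1)) :=
    ⟨(X.cc_nonneg_iff hk).mp hs, (X.cc_le_one_iff hk).mp (by linarith)⟩
  have h2 : p.2 ∈ Icc (Y.pt l) (Y.pt (l + 1)) :=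
    ⟨(Y.cc_nonneg_iff hl).mp ht, (Y.cc_le_one_iff hl).mp (by linarith)⟩
  unfold interp
  have : ∀ i j : ℕ, f (X.pt i, Y.pt j) * hat X Y i j p =
      f (X.pt i, Y.pt j) * (if i = k ∧ j = l then 1 - X.cc k p.1 - Y.cc l p.2 else 0)
      + f (X.pt i, Y.pt j) * (if i = k + 1 ∧ j = l then X.cc k p.1 else 0)
      + f (X.pt i, Y.pt j) * (if i = k ∧ j = l + 1 then Y.cc l p.2 else 0) := by
    intro i j
    rw [hat_eq_refHat X Y hk hl i j h1 h2, refHat_lower _ _ hs ht hst, ← mul_add, ← mul_add]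
    have i1 : ((k : ℤ) - i = 0) ↔ i = k := by omega
    have i2 : ((l : ℤ) - j = 0) ↔ j = l := by omega
    have i3 : ((k : ℤ) - i = -1) ↔ i = k + 1 := by omega
    have i4 : ((l : ℤ) - j = -1) ↔ j = l + 1 := by omega
    simp only [i1, i2, i3, i4]
  simp only [this, Finset.sum_add_distrib]
  rw [sum_ite_node X Y hk.le hl.le, sum_ite_node X Y hk hl.le, sum_ite_node X Y hk.le hl]

lemma interp_upper (f : ℝ × ℝ → ℝ) {k l : ℕ} (hk : k < N) (hl : l < N) {p : ℝ × ℝ}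
    (hs : X.cc k p.1 ≤ 1) (ht : Y.cc l p.2 ≤ 1) (hst : 1 ≤ X.cc k p.1 + Y.cc l p.2) :
    interp X Y f p = (X.cc k p.1 + Y.cc l p.2 - 1) * f (X.pt (k + 1), Y.pt (l + 1))
      + (1 - X.cc k p.1) * f (X.pt k, Y.pt (l + 1))
      + (1 - Y.cc l p.2) * f (X.pt (k + 1), Y.pt l) := by
  have h1 : p.1 ∈ Icc (X.pt k) (X.pt (k + 1)) :=
    ⟨(X.cc_nonneg_iff hk).mp (by linarith), (X.cc_le_one_iff hk).mp hs⟩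
  have h2 : p.2 ∈ Icc (Y.pt l) (Y.pt (l + 1)) :=
    ⟨(Y.cc_nonneg_iff hl).mp (by linarith), (Y.cc_le_one_iff hl).mp ht⟩
  unfold interp
  have : ∀ i j : ℕ, f (X.pt i, Y.pt j) * hat X Y i j p =
      f (X.pt i, Y.pt j) * (if i = k + 1 ∧ j = l + 1 then X.cc k p.1 + Y.cc l p.2 - 1 else 0)
      + f (X.pt i, Y.pt j) * (if i = k ∧ j = l + 1 then 1 - X.cc k p.1 else 0)
      + f (X.pt i, Y.pt j) * (if i = k + 1 ∧ j = l then 1 - Y.cc l p.2 else 0) := by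
    intro i j
    rw [hat_eq_refHat X Y hk hl i j h1 h2, refHat_upper _ _ hs ht hst, ← mul_add, ← mul_add]
    have i1 : ((k : ℤ) - i = 0) ↔ i = k := by omega
    have i2 : ((l : ℤ) - j = 0) ↔ j = l := by omega
    have i3 : ((k : ℤ) - i = -1) ↔ i = k + 1 := by omega
    have i4 : ((l : ℤ) - j = -1) ↔ j = l + 1 := by omega
    simp only [i1, i2, i3, i4]
  simp only [this, Finset.sum_add_distrib]
  rw [sum_ite_node X Y hk hl, sum_ite_node X Y hk.le hl, sum_ite_node X Y hk hl.le]

end Grid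

end

/-! ### The one-dimensional Shishkin mesh and the mesh triangles in affine coordinates -/

section

section Mesh

variable {lam : ℝ} {N : ℕ}

lemma meshPoint_of_le {i : ℕ} (h : 2 * i ≤ N) : meshPoint lam N i = 2 * i * (1 - lam) / N := by
  simp [meshPoint, h]

lemma meshPoint_of_ge (hN : 0 < N) {i : ℕ} (h : N ≤ 2 * i) :
    meshPoint lam N i = 1 - 2 * (N - i) * lam / N := by
  rcases h.eq_or_lt with h | h
  · have h2 : (N : ℝ) = 2 * i := by exact_mod_cast h
    have : (i : ℝ) ≠ 0 := by
      have : i ≠ 0 := by omega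
      exact_mod_cast this
    rw [meshPoint_of_le h.ge, h2]
    field_simp
    ring
  · simp [meshPoint, h]

lemma meshPoint_succ_sub_of_lt {i : ℕ} (h : 2 * (i + 1) ≤ N) :
    meshPoint lam N (i + 1) - meshPoint lam N i = 2 * (1 - lam) / N := by
  rw [meshPoint_of_le h, meshPoint_of_le (by omega)]
  push_cast
  ring

lemma meshPoint_succ_sub_of_ge (hN : 0 < N) {i : ℕ} (h : N ≤ 2 * i) :
    meshPoint lam N (i + 1) - meshPoint lam N i = 2 * lam / N := by
  rw [meshPoint_of_ge hN h, meshPoint_of_ge hN (by omega)]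
  push_cast
  ring

lemma lt_or_ge_of_even (he : Even N) (i : ℕ) : 2 * (i + 1) ≤ N ∨ N ≤ 2 * i := by
  obtain ⟨m, rfl⟩ := he; omega

/-- The inverse of the piecewise affine mesh generating function. -/
def meshIdx (lam : ℝ) (N : ℕ) (x : ℝ) : ℝ :=
  max (N * x / (2 * (1 - lam))) (N - N * (1 - x) / (2 * lam))

/-- As `lam ≤ 1 / 2`, the sign is that of `1 - lam - x`: the inverse mesh map is convex, steeper in
the fine part, and therefore the maximum of its two affine branches. -/
lemma meshIdx_aux (h0 : 0 < lam) (h1 : lam ≤ 1 / 2) (x : ℝ) :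
    N * x / (2 * (1 - lam)) - (N - N * (1 - x) / (2 * lam))
      = N * (1 - lam - x) * (1 - 2 * lam) / (2 * lam * (1 - lam)) := by
  have : 1 - lam ≠ 0 := by linarith
  field_simp
  ring

lemma meshIdx_of_le (h0 : 0 < lam) (h1 : lam ≤ 1 / 2) {x : ℝ} (hx : x ≤ 1 - lam) :
    meshIdx lam N x = N * x / (2 * (1 - lam)) := by
  refine max_eq_left (sub_nonneg.mp ?_)
  rw [meshIdx_aux h0 h1]
  exact div_nonneg (mul_nonneg (mul_nonneg (Nat.cast_nonneg _) (by linarith)) (by linarith))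
    (mul_nonneg (by linarith) (by linarith))

lemma meshIdx_of_ge (h0 : 0 < lam) (h1 : lam ≤ 1 / 2) {x : ℝ} (hx : 1 - lam ≤ x) :
    meshIdx lam N x = N - N * (1 - x) / (2 * lam) := by
  refine max_eq_right (sub_nonpos.mp ?_)
  rw [meshIdx_aux h0 h1]
  exact div_nonpos_of_nonpos_of_nonneg
    (mul_nonpos_of_nonpos_of_nonneg
      (mul_nonpos_of_nonneg_of_nonpos (Nat.cast_nonneg _) (by linarith)) (by linarith))
    (mul_nonneg (by linarith) (by linarith))

lemma meshPoint_le_of_le (hN : 0 < N) (h1 : lam ≤ 1 / 2) {i : ℕ} (h : 2 * i ≤ N) :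
    meshPoint lam N i ≤ 1 - lam := by
  have hN' : (0 : ℝ) < N := by exact_mod_cast hN
  have : (2 : ℝ) * i ≤ N := by exact_mod_cast h
  rw [meshPoint_of_le h, div_le_iff₀ hN']
  nlinarith

lemma le_meshPoint_of_ge (hN : 0 < N) (h0 : 0 < lam) {i : ℕ} (h : N ≤ 2 * i) :
    1 - lam ≤ meshPoint lam N i := by
  have hN' : (0 : ℝ) < N := by exact_mod_cast hN
  have : (N : ℝ) ≤ 2 * i := by exact_mod_cast h
  rw [meshPoint_of_ge hN h, sub_le_sub_iff_left, div_le_iff₀ hN']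
  nlinarith

lemma meshPoint_lt (he : Even N) (hN : 0 < N) (h0 : 0 < lam) (h1 : lam ≤ 1 / 2) (i : ℕ) :
    meshPoint lam N i < meshPoint lam N (i + 1) := by
  have hN' : (0 : ℝ) < N := by exact_mod_cast hN
  rw [← sub_pos]
  rcases lt_or_ge_of_even he i with h | h
  · rw [meshPoint_succ_sub_of_lt h]
    exact div_pos (by linarith) hN'
  · rw [meshPoint_succ_sub_of_ge hN h]
    exact div_pos (by linarith) hN'

lemma lipschitz_mul_sub (a b : ℝ) : ∃ K, LipschitzWith K (fun x : ℝ => a * x + b) :=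
  ⟨_, ((lipschitzWith_smul a).comp LipschitzWith.id).add (LipschitzWith.const b)⟩

/-- The one-dimensional Shishkin mesh. -/
def meshGrid (he : Even N) (hN : 0 < N) (h0 : 0 < lam) (h1 : lam ≤ 1 / 2) : Grid N where
  pt := meshPoint lam N
  idx := meshIdx lam N
  zero := by rw [meshPoint_of_le (by omega)]; simp
  one := by rw [meshPoint_of_ge hN (by omega)]; simp
  lt i _ := meshPoint_lt he hN h0 h1 i
  lip := by
    obtain ⟨K, hK⟩ := lipschitz_mul_sub (N / (2 * (1 - lam))) 0
    obtain ⟨K', hK'⟩ := lipschitz_mul_sub (N / (2 * lam)) (N - N / (2 * lam))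
    refine ⟨max K K', ?_⟩
    convert hK.max hK' using 1
    ext x
    unfold meshIdx
    congr 1 <;> ring
  idx_cell i hi x hx := by
    have hN' : (N : ℝ) ≠ 0 := by exact_mod_cast hN.ne'
    have hl : 1 - lam ≠ 0 := by linarith
    rcases lt_or_ge_of_even he i with h | h
    · rw [meshIdx_of_le h0 h1 (hx.2.trans (meshPoint_le_of_le hN h1 h)),
        meshPoint_succ_sub_of_lt h, meshPoint_of_le (by omega)]
      field_simp
      ring
    · rw [meshIdx_of_ge h0 h1 ((le_meshPoint_of_ge hN h0 h).trans hx.1),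
        meshPoint_succ_sub_of_ge hN h, meshPoint_of_ge hN h]
      field_simp
      ring
  idx_nonpos x hx := by
    rw [meshIdx_of_le h0 h1 (by linarith)]
    exact div_nonpos_of_nonpos_of_nonneg
      (mul_nonpos_of_nonneg_of_nonpos (Nat.cast_nonneg _) hx) (by linarith)
  idx_ge x hx := by
    rw [meshIdx_of_ge h0 h1 (by linarith)]
    have : N * (1 - x) / (2 * lam) ≤ 0 := div_nonpos_of_nonpos_of_nonneg
      (mul_nonpos_of_nonneg_of_nonpos (Nat.cast_nonneg _) (by linarith)) (by linarith)
    linarith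

end Mesh

variable {P : Coeff} {D : Discr}

namespace Admissible

variable (hD : Admissible P D)
include hD

lemma two_le : 2 ≤ D.N := by
  obtain ⟨m, hm⟩ := hD.even
  have := hD.pos
  omega

lemma two_le_cast : (2 : ℝ) ≤ D.N := by exact_mod_cast hD.two_le

lemma cast_pos : (0 : ℝ) < D.N := by linarith [hD.two_le_cast]

lemma log_ge : 1 / 2 ≤ Real.log D.N := by
  have := Real.log_le_log (by norm_num) hD.two_le_cast
  have := Real.log_two_gt_d9
  linarith

lemma lamX_eq : lamX P D = 5 / 2 * (D.ε / P.β₁) * Real.log D.N := min_eq_right hD.layer_x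

lemma lamY_eq : lamY P D = 5 / 2 * (D.ε / P.β₂) * Real.log D.N := min_eq_right hD.layer_y

lemma lamX_pos : 0 < lamX P D := by
  rw [hD.lamX_eq]
  have := hD.log_ge
  have := hD.ε_pos
  have := P.β₁_pos
  positivity

lemma lamY_pos : 0 < lamY P D := by
  rw [hD.lamY_eq]
  have := hD.log_ge
  have := hD.ε_pos
  have := P.β₂_pos
  positivity

lemma lamX_le : lamX P D ≤ 1 / 2 := hD.lamX_eq.trans_le hD.layer_x

lemma lamY_le : lamY P D ≤ 1 / 2 := hD.lamY_eq.trans_le hD.layer_y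

end Admissible

/-- The grid in the first coordinate. -/
def gridX (hD : Admissible P D) : Grid D.N := meshGrid hD.even hD.pos hD.lamX_pos hD.lamX_le

/-- The grid in the second coordinate. -/
def gridY (hD : Admissible P D) : Grid D.N := meshGrid hD.even hD.pos hD.lamY_pos hD.lamY_le

lemma closure_Omega : closure Omega = Icc 0 1 ×ˢ Icc 0 1 := by
  rw [Omega, closure_prod_eq, closure_Ioo zero_ne_one]

lemma isOpen_Omega : IsOpen Omega := isOpen_Ioo.prod isOpen_Ioo

lemma frontier_Omega : frontier Omega = (Icc 0 1 ×ˢ Icc 0 1) \ Omega := by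
  rw [frontier, closure_Omega, isOpen_Omega.interior_eq]

/-- The interpolant on the Shishkin mesh. -/
def fem (hD : Admissible P D) (f : ℝ × ℝ → ℝ) : ℝ × ℝ → ℝ := (gridX hD).interp (gridY hD) f

lemma convex_lower {N : ℕ} (X Y : Grid N) (k l : ℕ) : Convex ℝ
    {p : ℝ × ℝ | 0 ≤ X.cc k p.1 ∧ 0 ≤ Y.cc l p.2 ∧ X.cc k p.1 + Y.cc l p.2 ≤ 1} := by
  rintro p ⟨h1, h2, h3⟩ q ⟨h1', h2', h3'⟩ a b ha hb hab
  have e1 : X.cc k (a • p + b • q).1 = a * X.cc k p.1 + b * X.cc k q.1 := by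
    simp only [Grid.cc, Prod.fst_add, Prod.smul_fst, smul_eq_mul, ← mul_div_assoc, ← add_div]
    congr 1
    linear_combination X.pt k * hab
  have e2 : Y.cc l (a • p + b • q).2 = a * Y.cc l p.2 + b * Y.cc l q.2 := by
    simp only [Grid.cc, Prod.snd_add, Prod.smul_snd, smul_eq_mul, ← mul_div_assoc, ← add_div]
    congr 1
    linear_combination Y.pt l * hab
  simp only [mem_ofPred_eq, e1, e2]
  refine ⟨by positivity, by positivity, ?_⟩
  nlinarith

lemma convex_upper {N : ℕ} (X Y : Grid N) (k l : ℕ) : Convex ℝ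
    {p : ℝ × ℝ | X.cc k p.1 ≤ 1 ∧ Y.cc l p.2 ≤ 1 ∧ 1 ≤ X.cc k p.1 + Y.cc l p.2} := by
  rintro p ⟨h1, h2, h3⟩ q ⟨h1', h2', h3'⟩ a b ha hb hab
  have e1 : X.cc k (a • p + b • q).1 = a * X.cc k p.1 + b * X.cc k q.1 := by
    simp only [Grid.cc, Prod.fst_add, Prod.smul_fst, smul_eq_mul, ← mul_div_assoc, ← add_div]
    congr 1
    linear_combination X.pt k * hab
  have e2 : Y.cc l (a • p + b • q).2 = a * Y.cc l p.2 + b * Y.cc l q.2 := by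
    simp only [Grid.cc, Prod.snd_add, Prod.smul_snd, smul_eq_mul, ← mul_div_assoc, ← add_div]
    congr 1
    linear_combination Y.pt l * hab
  simp only [mem_ofPred_eq, e1, e2]
  refine ⟨by nlinarith, by nlinarith, ?_⟩
  nlinarith

namespace Grid
variable {N : ℕ} (X : Grid N)

lemma cc_left (i : ℕ) : X.cc i (X.pt i) = 0 := by simp [cc]

lemma cc_right {i : ℕ} (hi : i < N) : X.cc i (X.pt (i + 1)) = 1 :=
  div_self (sub_pos.mpr (X.lt i hi)).ne'

lemma pt_add_cc {i : ℕ} (hi : i < N) (x : ℝ) :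
    x = (1 - X.cc i x) * X.pt i + X.cc i x * X.pt (i + 1) := by
  have := (sub_pos.mpr (X.lt i hi)).ne'
  unfold cc
  field_simp
  ring

end Grid

lemma tri1_eq (hD : Admissible P D) {k l : ℕ} (hk : k < D.N) (hl : l < D.N) :
    tri1 P D k l = {p : ℝ × ℝ | 0 ≤ (gridX hD).cc k p.1 ∧ 0 ≤ (gridY hD).cc l p.2 ∧
      (gridX hD).cc k p.1 + (gridY hD).cc l p.2 ≤ 1} := by
  apply Subset.antisymm
  · refine convexHull_min ?_ (convex_lower _ _ k l)
    have a1 := (gridX hD).cc_left k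
    have a2 := (gridX hD).cc_right hk
    have b1 := (gridY hD).cc_left l
    have b2 := (gridY hD).cc_right hl
    change (gridX hD).cc k (meshX P D k) = 0 at a1
    change (gridX hD).cc k (meshX P D (k + 1)) = 1 at a2
    change (gridY hD).cc l (meshY P D l) = 0 at b1
    change (gridY hD).cc l (meshY P D (l + 1)) = 1 at b2
    rintro p (rfl | rfl | rfl) <;> simp [a1, a2, b1, b2]
  · rintro p ⟨h1, h2, h3⟩
    have e1 := (gridX hD).pt_add_cc hk p.1
    have e2 := (gridY hD).pt_add_cc hl p.2
    set s := (gridX hD).cc k p.1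
    set t := (gridY hD).cc l p.2
    change p.1 = (1 - s) * meshX P D k + s * meshX P D (k + 1) at e1
    change p.2 = (1 - t) * meshY P D l + t * meshY P D (l + 1) at e2
    rw [tri1, convexHull_insert (by simp), mem_convexJoin]
    rw [convexHull_pair]
    -- The point is projected from the right-angled corner onto the hypotenuse. This divides by `s +
    -- t`, so the corner itself is treated apart.
    rcases eq_or_lt_of_le (add_nonneg h1 h2) with h0 | h0
    · have hs : s = 0 := by linarith
      have ht : t = 0 := by linarith
      refine ⟨_, rfl, _, left_mem_segment _ _ _, ?_⟩
      have : p = (meshX P D k, meshY P D l) := by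
        ext <;> simp [e1, e2, hs, ht]
      rw [this]; exact left_mem_segment _ _ _
    · refine ⟨_, rfl, (s / (s + t)) • (meshX P D (k + 1), meshY P D l)
        + (t / (s + t)) • (meshX P D k, meshY P D (l + 1)),
        ⟨_, _, by positivity, by positivity, by field_simp, rfl⟩,
        ⟨1 - (s + t), s + t, by linarith, by linarith, by ring, ?_⟩⟩
      ext
      · simp only [e1, Prod.fst_add, Prod.smul_fst, smul_eq_mul]
        field_simp
        ring
      · simp only [e2, Prod.snd_add, Prod.smul_snd, smul_eq_mul]
        field_simp
        ring

lemma tri2_eq (hD : Admissible P D) {k l : ℕ} (hk : k < D.N) (hl : l < D.N) :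
    tri2 P D k l = {p : ℝ × ℝ | (gridX hD).cc k p.1 ≤ 1 ∧ (gridY hD).cc l p.2 ≤ 1 ∧
      1 ≤ (gridX hD).cc k p.1 + (gridY hD).cc l p.2} := by
  apply Subset.antisymm
  · refine convexHull_min ?_ (convex_upper _ _ k l)
    have a1 := (gridX hD).cc_left k
    have a2 := (gridX hD).cc_right hk
    have b1 := (gridY hD).cc_left l
    have b2 := (gridY hD).cc_right hl
    change (gridX hD).cc k (meshX P D k) = 0 at a1
    change (gridX hD).cc k (meshX P D (k + 1)) = 1 at a2
    change (gridY hD).cc l (meshY P D l) = 0 at b1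
    change (gridY hD).cc l (meshY P D (l + 1)) = 1 at b2
    rintro p (rfl | rfl | rfl) <;> simp [a1, a2, b1, b2]
  · rintro p ⟨h1, h2, h3⟩
    have e1 := (gridX hD).pt_add_cc hk p.1
    have e2 := (gridY hD).pt_add_cc hl p.2
    set s := (gridX hD).cc k p.1
    set t := (gridY hD).cc l p.2
    change p.1 = (1 - s) * meshX P D k + s * meshX P D (k + 1) at e1
    change p.2 = (1 - t) * meshY P D l + t * meshY P D (l + 1) at e2
    rw [tri2, convexHull_insert (by simp), mem_convexJoin]
    rw [convexHull_pair]
    -- Here the centre of projection is the upper left vertex, the only point of the triangle with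
    -- `s = 0`.
    rcases eq_or_lt_of_le (show 0 ≤ s by linarith) with h0 | hs
    · have ht : t = 1 := by linarith
      refine ⟨_, rfl, _, left_mem_segment _ _ _, ?_⟩
      have : p = (meshX P D k, meshY P D (l + 1)) := by
        ext <;> simp [e1, e2, ← h0, ht]
      rw [this]; exact left_mem_segment _ _ _
    · have hs' : s ≠ 0 := hs.ne'
      refine ⟨_, rfl, ((1 - t) / s) • (meshX P D (k + 1), meshY P D l)
        + ((s + t - 1) / s) • (meshX P D (k + 1), meshY P D (l + 1)),
        ⟨_, _, div_nonneg (by linarith) hs.le, div_nonneg (by linarith) hs.le,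
          by field_simp; ring, rfl⟩,
        ⟨1 - s, s, by linarith, by linarith, by ring, ?_⟩⟩
      ext
      · simp only [e1, Prod.fst_add, Prod.smul_fst, smul_eq_mul]
        field_simp
        ring
      · simp only [e2, Prod.snd_add, Prod.smul_snd, smul_eq_mul]
        field_simp
        ring

end

/-! ### The finite element space and the decomposition of the square into open triangles -/

section

variable {P : Coeff} {D : Discr}

section FiniteElements

variable (hD : Admissible P D)

lemma node_mem_frontier {i j : ℕ} (hi : i ≤ D.N) (hj : j ≤ D.N)
    (h : i = 0 ∨ i = D.N ∨ j = 0 ∨ j = D.N) :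
    ((gridX hD).pt i, (gridY hD).pt j) ∈ frontier Omega := by
  rw [frontier_Omega]
  refine ⟨⟨⟨(gridX hD).pt_nonneg hi, (gridX hD).pt_le_one hi⟩,
    ⟨(gridY hD).pt_nonneg hj, (gridY hD).pt_le_one hj⟩⟩, ?_⟩
  rintro ⟨⟨h1, h2⟩, ⟨h3, h4⟩⟩
  simp only at h1 h2 h3 h4
  rcases h with rfl | rfl | rfl | rfl
  · exact absurd (gridX hD).zero h1.ne'
  · exact absurd (gridX hD).one h2.ne
  · exact absurd (gridY hD).zero h3.ne'
  · exact absurd (gridY hD).one h4.ne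

lemma bdryZero_of_frontier {v : ℝ × ℝ → ℝ} (hv : ∀ p ∈ frontier Omega, v p = 0) :
    (gridX hD).BdryZero (gridY hD) v :=
  fun _ hi _ hj h => hv _ (node_mem_frontier hD hi hj h)

lemma isP1On_of_eq {K : Set (ℝ × ℝ)} {v : ℝ × ℝ → ℝ} (X Y : Grid D.N) (k l : ℕ) (A B C : ℝ)
    (h : ∀ p ∈ K, v p = A + B * X.cc k p.1 + C * Y.cc l p.2) : IsP1On v K := by
  refine ⟨A - B * X.pt k / (X.pt (k + 1) - X.pt k) - C * Y.pt l / (Y.pt (l + 1) - Y.pt l),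
    B / (X.pt (k + 1) - X.pt k), C / (Y.pt (l + 1) - Y.pt l), fun p hp => ?_⟩
  rw [h p hp]
  unfold Grid.cc
  ring

lemma fem_mem_feSpace {f : ℝ × ℝ → ℝ} (hf : (gridX hD).BdryZero (gridY hD) f) :
    fem hD f ∈ feSpace P D := by
  refine ⟨((gridX hD).lip_interp _ f).continuous.continuousOn, fun p hp => ?_,
    fun k hk l hl => ⟨?_, ?_⟩⟩
  · rw [frontier_Omega] at hp
    exact Grid.interp_eq_zero _ _ hf hp.2
  · rw [tri1_eq hD hk hl]
    set F := fun i j => f ((gridX hD).pt i, (gridY hD).pt j) with hF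
    refine isP1On_of_eq (gridX hD) (gridY hD) k l (F k l) (F (k + 1) l - F k l)
      (F k (l + 1) - F k l) ?_
    rintro p ⟨h1, h2, h3⟩
    rw [fem, Grid.interp_lower _ _ f hk hl h1 h2 h3, hF]
    ring
  · rw [tri2_eq hD hk hl]
    set F := fun i j => f ((gridX hD).pt i, (gridY hD).pt j) with hF
    refine isP1On_of_eq (gridX hD) (gridY hD) k l
      (F k (l + 1) + F (k + 1) l - F (k + 1) (l + 1)) (F (k + 1) (l + 1) - F k (l + 1))
      (F (k + 1) (l + 1) - F (k + 1) l) ?_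
    rintro p ⟨h1, h2, h3⟩
    rw [fem, Grid.interp_upper _ _ f hk hl h1 h2 h3, hF]
    ring

/-- An affine function on a triangle is determined by its vertex values. Members of the space are
uncontrolled off the closed square; this permits replacing them by a Lipschitz function on the
plane. -/
lemma eq_fem_of_mem {v : ℝ × ℝ → ℝ} (hv : v ∈ feSpace P D) {p : ℝ × ℝ}
    (hp : p ∈ closure Omega) : v p = fem hD v p := by
  rw [closure_Omega] at hp
  obtain ⟨k, hk, hxk⟩ := (gridX hD).exists_cell p.1 hp.1.1 hp.1.2 hD.pos
  obtain ⟨l, hl, hyl⟩ := (gridY hD).exists_cell p.2 hp.2.1 hp.2.2 hD.pos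
  have hs0 := ((gridX hD).cc_nonneg_iff hk).mpr hxk.1
  have hs1 := ((gridX hD).cc_le_one_iff hk).mpr hxk.2
  have ht0 := ((gridY hD).cc_nonneg_iff hl).mpr hyl.1
  have ht1 := ((gridY hD).cc_le_one_iff hl).mpr hyl.2
  have ex := (gridX hD).pt_add_cc hk p.1
  have ey := (gridY hD).pt_add_cc hl p.2
  have cl := (gridX hD).cc_left k
  have cr := (gridX hD).cc_right hk
  have dl := (gridY hD).cc_left l
  have dr := (gridY hD).cc_right hl
  obtain ⟨⟨a, b, c, h1⟩, ⟨a', b', c', h2⟩⟩ := hv.2.2 k hk l hl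
  rw [tri1_eq hD hk hl] at h1
  rw [tri2_eq hD hk hl] at h2
  rcases le_total ((gridX hD).cc k p.1 + (gridY hD).cc l p.2) 1 with h | h
  · rw [fem, Grid.interp_lower _ _ v hk hl hs0 ht0 h, h1 p ⟨hs0, ht0, h⟩, h1 _ (by simp [cl, dl]),
      h1 _ (by simp [cr, dl]), h1 _ (by simp [cl, dr])]
    linear_combination b * ex + c * ey
  · rw [fem, Grid.interp_upper _ _ v hk hl hs1 ht1 h, h2 p ⟨hs1, ht1, h⟩, h2 _ (by simp [cr, dr]),
      h2 _ (by simp [cl, dr]), h2 _ (by simp [cr, dl])]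
    linear_combination b' * ex + c' * ey

lemma bdryZero_fem_mul {v w : ℝ × ℝ → ℝ} (hv : (gridX hD).BdryZero (gridY hD) v) :
    (gridX hD).BdryZero (gridY hD) (fun p => w p * fem hD v p) := by
  intro i hi j hj h
  have := (fem_mem_feSpace hD hv).2.1 _ (node_mem_frontier hD hi hj h)
  simp only [this, mul_zero]

end FiniteElements

section Pieces

/-- The open right triangle with the right angle at `a` and the signed legs `d₁`, `d₂`. -/
def rtri (a d : ℝ × ℝ) : Set (ℝ × ℝ) :=
  {p | 0 < (p.1 - a.1) / d.1 ∧ 0 < (p.2 - a.2) / d.2 ∧ (p.1 - a.1) / d.1 + (p.2 - a.2) / d.2 < 1}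

/-- The closed right triangle with the right angle at `a` and the signed legs `d₁`, `d₂`. -/
def crtri (a d : ℝ × ℝ) : Set (ℝ × ℝ) :=
  {p | 0 ≤ (p.1 - a.1) / d.1 ∧ 0 ≤ (p.2 - a.2) / d.2 ∧ (p.1 - a.1) / d.1 + (p.2 - a.2) / d.2 ≤ 1}

lemma rtri_subset_crtri (a d : ℝ × ℝ) : rtri a d ⊆ crtri a d :=
  fun _ h => ⟨h.1.le, h.2.1.le, h.2.2.le⟩

lemma isOpen_rtri (a d : ℝ × ℝ) : IsOpen (rtri a d) := by
  have h1 : Continuous fun p : ℝ × ℝ => (p.1 - a.1) / d.1 := by fun_prop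
  have h2 : Continuous fun p : ℝ × ℝ => (p.2 - a.2) / d.2 := by fun_prop
  exact (isOpen_lt continuous_const h1).inter
    ((isOpen_lt continuous_const h2).inter (isOpen_lt (h1.add h2) continuous_const))

variable {N : ℕ} (X Y : Grid N)

namespace Grid

/-- The right-angled corner of a mesh triangle. -/
def anchor (τ : ℕ × ℕ × Bool) : ℝ × ℝ :=
  if τ.2.2 then (X.pt (τ.1 + 1), Y.pt (τ.2.1 + 1)) else (X.pt τ.1, Y.pt τ.2.1)

/-- The signed legs of a mesh triangle. -/
def legs (τ : ℕ × ℕ × Bool) : ℝ × ℝ :=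
  if τ.2.2 then (X.pt τ.1 - X.pt (τ.1 + 1), Y.pt τ.2.1 - Y.pt (τ.2.1 + 1))
  else (X.pt (τ.1 + 1) - X.pt τ.1, Y.pt (τ.2.1 + 1) - Y.pt τ.2.1)

/-- The open mesh triangles. -/
def piece (τ : ℕ × ℕ × Bool) : Set (ℝ × ℝ) := rtri (anchor X Y τ) (legs X Y τ)

/-- The index set of the mesh triangles. -/
def pieces (N : ℕ) : Finset (ℕ × ℕ × Bool) := Finset.range N ×ˢ Finset.range N ×ˢ Finset.univ

lemma mem_pieces {τ : ℕ × ℕ × Bool} : τ ∈ pieces N ↔ τ.1 < N ∧ τ.2.1 < N := by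
  simp [pieces]

lemma mem_piece_false {k l : ℕ} {p : ℝ × ℝ} : p ∈ piece X Y (k, l, false) ↔
    0 < X.cc k p.1 ∧ 0 < Y.cc l p.2 ∧ X.cc k p.1 + Y.cc l p.2 < 1 := by
  simp [piece, rtri, anchor, legs, cc]

lemma cc_rev {i : ℕ} (hi : i < N) (x : ℝ) :
    (x - X.pt (i + 1)) / (X.pt i - X.pt (i + 1)) = 1 - X.cc i x := by
  have h1 := (sub_pos.mpr (X.lt i hi)).ne'
  have h2 := (sub_neg.mpr (X.lt i hi)).ne
  unfold cc
  field_simp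
  ring

lemma mem_piece_true {k l : ℕ} (hk : k < N) (hl : l < N) {p : ℝ × ℝ} :
    p ∈ piece X Y (k, l, true) ↔
    X.cc k p.1 < 1 ∧ Y.cc l p.2 < 1 ∧ 1 < X.cc k p.1 + Y.cc l p.2 := by
  simp only [piece, rtri, anchor, legs, ite_true, mem_ofPred_eq, X.cc_rev hk, Y.cc_rev hl]
  constructor <;> rintro ⟨h1, h2, h3⟩ <;> exact ⟨by linarith, by linarith, by linarith⟩

lemma legs_fst_ne {τ : ℕ × ℕ × Bool} (hτ : τ ∈ pieces N) : (legs X Y τ).1 ≠ 0 := by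
  have := X.lt τ.1 (mem_pieces.mp hτ).1
  unfold legs; split_ifs
  exacts [(sub_neg.mpr this).ne, (sub_pos.mpr this).ne']

lemma legs_snd_ne {τ : ℕ × ℕ × Bool} (hτ : τ ∈ pieces N) : (legs X Y τ).2 ≠ 0 := by
  have := Y.lt τ.2.1 (mem_pieces.mp hτ).2
  unfold legs; split_ifs
  exacts [(sub_neg.mpr this).ne, (sub_pos.mpr this).ne']

/-- On a closed mesh triangle the interpolant is given by barycentric interpolation. -/
lemma interp_crtri (f : ℝ × ℝ → ℝ) {τ : ℕ × ℕ × Bool} (hτ : τ ∈ pieces N) {p : ℝ × ℝ}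
    (hp : p ∈ crtri (anchor X Y τ) (legs X Y τ)) :
    interp X Y f p = f (anchor X Y τ)
      + (p.1 - (anchor X Y τ).1) / (legs X Y τ).1 *
        (f (anchor X Y τ + ((legs X Y τ).1, 0)) - f (anchor X Y τ))
      + (p.2 - (anchor X Y τ).2) / (legs X Y τ).2 *
        (f (anchor X Y τ + (0, (legs X Y τ).2)) - f (anchor X Y τ)) := by
  obtain ⟨k, l, s⟩ := τ
  obtain ⟨hk, hl⟩ := mem_pieces.mp hτ
  simp only at hk hl
  cases s
  · simp only [crtri, anchor, legs, Bool.false_eq_true, ite_false, mem_ofPred_eq] at hp ⊢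
    rw [interp_lower X Y f hk hl hp.1 hp.2.1 hp.2.2]
    simp only [cc, Prod.mk_add_mk, add_zero, add_sub_cancel]
    ring
  · simp only [crtri, anchor, legs, ite_true, mem_ofPred_eq, X.cc_rev hk, Y.cc_rev hl] at hp ⊢
    rw [interp_upper X Y f hk hl (by linarith) (by linarith) (by linarith)]
    simp only [Prod.mk_add_mk, add_zero, add_sub_cancel]
    ring

lemma cc_strict {τ : ℕ × ℕ × Bool} (hτ : τ ∈ pieces N) {p : ℝ × ℝ} (hp : p ∈ piece X Y τ) :
    (0 < X.cc τ.1 p.1 ∧ X.cc τ.1 p.1 < 1) ∧ (0 < Y.cc τ.2.1 p.2 ∧ Y.cc τ.2.1 p.2 < 1) := by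
  obtain ⟨k, l, s⟩ := τ
  obtain ⟨hk, hl⟩ := mem_pieces.mp hτ
  simp only at hk hl ⊢
  cases s
  · rw [mem_piece_false] at hp
    exact ⟨⟨by linarith, by linarith⟩, by linarith, by linarith⟩
  · rw [mem_piece_true X Y hk hl] at hp
    exact ⟨⟨by linarith, by linarith⟩, by linarith, by linarith⟩

lemma cc_pos_iff {i : ℕ} (hi : i < N) {x : ℝ} : 0 < X.cc i x ↔ X.pt i < x := by
  have := X.lt i hi
  unfold cc
  rw [lt_div_iff₀ (by linarith), zero_mul, sub_pos]

lemma cc_lt_one_iff {i : ℕ} (hi : i < N) {x : ℝ} : X.cc i x < 1 ↔ x < X.pt (i + 1) := by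
  have := X.lt i hi
  unfold cc
  rw [div_lt_iff₀ (by linarith), one_mul, sub_lt_sub_iff_right]

lemma piece_subset {τ : ℕ × ℕ × Bool} (hτ : τ ∈ pieces N) {p : ℝ × ℝ} (hp : p ∈ piece X Y τ) :
    p.1 ∈ Ioo (X.pt τ.1) (X.pt (τ.1 + 1)) ∧ p.2 ∈ Ioo (Y.pt τ.2.1) (Y.pt (τ.2.1 + 1)) := by
  obtain ⟨hk, hl⟩ := mem_pieces.mp hτ
  have h := cc_strict X Y hτ hp
  exact ⟨⟨(X.cc_pos_iff hk).mp h.1.1, (X.cc_lt_one_iff hk).mp h.1.2⟩,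
      ⟨(Y.cc_pos_iff hl).mp h.2.1, (Y.cc_lt_one_iff hl).mp h.2.2⟩⟩

lemma piece_subset_Omega {τ : ℕ × ℕ × Bool} (hτ : τ ∈ pieces N) : piece X Y τ ⊆ Omega := by
  intro p hp
  obtain ⟨hk, hl⟩ := mem_pieces.mp hτ
  have h := piece_subset X Y hτ hp
  exact ⟨⟨(X.pt_nonneg hk.le).trans_lt h.1.1, h.1.2.trans_le (X.pt_le_one hk)⟩,
    ⟨(Y.pt_nonneg hl.le).trans_lt h.2.1, h.2.2.trans_le (Y.pt_le_one hl)⟩⟩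

lemma eq_of_mem_Ioo {i j : ℕ} (hi : i < N) (hj : j < N) {x : ℝ}
    (h : x ∈ Ioo (X.pt i) (X.pt (i + 1))) (h' : x ∈ Ioo (X.pt j) (X.pt (j + 1))) : i = j := by
  rcases lt_trichotomy i j with hij | hij | hij
  · exact absurd (h.2.trans_le (X.pt_le_pt (show i + 1 ≤ j by omega) hj.le)) (not_lt.mpr h'.1.le)
  · exact hij
  · exact absurd (h'.2.trans_le (X.pt_le_pt (show j + 1 ≤ i by omega) hi.le)) (not_lt.mpr h.1.le)

lemma pairwiseDisjoint_pieces :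
    (pieces N : Set (ℕ × ℕ × Bool)).Pairwise (Function.onFun Disjoint (piece X Y)) := by
  intro τ hτ τ' hτ' hne
  rw [Function.onFun, Set.disjoint_left]
  intro p hp hp'
  apply hne
  obtain ⟨hk, hl⟩ := mem_pieces.mp hτ
  obtain ⟨hk', hl'⟩ := mem_pieces.mp hτ'
  have h := piece_subset X Y hτ hp
  have h' := piece_subset X Y hτ' hp'
  have e1 := X.eq_of_mem_Ioo hk hk' h.1 h'.1
  have e2 := Y.eq_of_mem_Ioo hl hl' h.2 h'.2
  obtain ⟨k, l, s⟩ := τ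
  obtain ⟨k', l', s'⟩ := τ'
  simp only at e1 e2 hk hl
  subst e1 e2
  cases s <;> cases s' <;> simp only [mem_piece_false, mem_piece_true X Y hk hl] at hp hp' ⊢ <;>
    linarith

end Grid

lemma volume_hyperplane {ℓ : ℝ × ℝ →ₗ[ℝ] ℝ} (hℓ : ℓ ≠ 0) (c : ℝ) :
    volume {p | ℓ p = c} = 0 := by
  rcases Set.eq_empty_or_nonempty {p | ℓ p = c} with h | ⟨q, hq⟩
  · rw [h, measure_empty]
  · have : {p | ℓ p = c} = (fun p => p + -q) ⁻¹' (LinearMap.ker ℓ : Set (ℝ × ℝ)) := by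
      ext p
      have hq' : ℓ q = c := hq
      simp [hq', add_neg_eq_zero]
    rw [this, measure_preimage_add_right]
    exact Measure.addHaar_submodule _ _ (by rwa [Ne, LinearMap.ker_eq_top])

lemma volume_line {a b : ℝ} (h : a ≠ 0 ∨ b ≠ 0) (c : ℝ) :
    volume {p : ℝ × ℝ | a * p.1 + b * p.2 = c} = 0 := by
  have hℓ : (a • LinearMap.fst ℝ ℝ ℝ + b • LinearMap.snd ℝ ℝ ℝ) ≠ 0 := by
    intro h0
    have h1 := LinearMap.congr_fun h0 (1, 0)
    have h2 := LinearMap.congr_fun h0 (0, 1)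
    simp at h1 h2
    tauto
  have := volume_hyperplane hℓ c
  simpa using this

namespace Grid

lemma pieces_ae_cover (hN : 0 < N) : (⋃ τ ∈ pieces N, piece X Y τ) =ᵐ[volume] Omega := by
  apply Filter.EventuallyLE.antisymm
  · have h : (⋃ τ ∈ pieces N, piece X Y τ) ⊆ Omega :=
      iUnion₂_subset fun τ hτ => piece_subset_Omega X Y hτ
    exact LE.le.eventuallyLE h
  -- The points missed by the open triangles lie on finitely many lines: grid lines and the lines
  -- carrying the cell diagonals. Both grids have `N` cells, so one index `k` serves the vertical
  -- and the horizontal lines.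
  have hnull : volume ((⋃ k ∈ Finset.range N, ({p : ℝ × ℝ | 1 * p.1 + 0 * p.2 = X.pt k} ∪
      {p : ℝ × ℝ | 1 * p.1 + 0 * p.2 = X.pt (k + 1)} ∪
      {p : ℝ × ℝ | 0 * p.1 + 1 * p.2 = Y.pt k} ∪
      {p : ℝ × ℝ | 0 * p.1 + 1 * p.2 = Y.pt (k + 1)}) ∪ ⋃ l ∈ Finset.range N,
      {p : ℝ × ℝ | (X.pt (k + 1) - X.pt k)⁻¹ * p.1 + (Y.pt (l + 1) - Y.pt l)⁻¹ * p.2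
        = 1 + X.pt k / (X.pt (k + 1) - X.pt k) + Y.pt l / (Y.pt (l + 1) - Y.pt l)})) = 0 := by
    refine (measure_biUnion_null_iff (Finset.countable_toSet _)).mpr fun k hk => ?_
    have hk' : k < N := Finset.mem_range.mp hk
    have := X.lt k hk'
    refine measure_union_null (measure_union_null (measure_union_null (measure_union_null
      (volume_line (by simp) _) (volume_line (by simp) _)) (volume_line (by simp) _))
      (volume_line (by simp) _)) ?_
    refine (measure_biUnion_null_iff (Finset.countable_toSet _)).mpr fun l hl => ?_
    exact volume_line (Or.inl (inv_ne_zero (by linarith))) _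
  refine ae_le_set.mpr (measure_mono_null ?_ hnull)
  rintro p ⟨hpO, hp⟩
  obtain ⟨k, hk, hxk⟩ := X.exists_cell p.1 hpO.1.1.le hpO.1.2.le hN
  obtain ⟨l, hl, hyl⟩ := Y.exists_cell p.2 hpO.2.1.le hpO.2.2.le hN
  by_contra hc
  simp only [mem_iUnion, mem_union, mem_ofPred_eq, Finset.mem_range, exists_prop, one_mul,
    zero_mul, add_zero, zero_add, not_exists, not_and, not_or] at hc hp
  obtain ⟨⟨⟨⟨x1, x2⟩, -⟩, -⟩, hdiag⟩ := hc k hk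
  obtain ⟨⟨⟨-, y1⟩, y2⟩, -⟩ := hc l hl
  have hs0 := (X.cc_pos_iff hk).mpr (lt_of_le_of_ne hxk.1 (Ne.symm x1))
  have hs1 := (X.cc_lt_one_iff hk).mpr (lt_of_le_of_ne hxk.2 x2)
  have ht0 := (Y.cc_pos_iff hl).mpr (lt_of_le_of_ne hyl.1 (Ne.symm y1))
  have ht1 := (Y.cc_lt_one_iff hl).mpr (lt_of_le_of_ne hyl.2 y2)
  rcases lt_trichotomy (X.cc k p.1 + Y.cc l p.2) 1 with h | h | h
  · exact hp (k, l, false) (mem_pieces.mpr ⟨hk, hl⟩) ((mem_piece_false X Y).mpr ⟨hs0, ht0, h⟩)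
  · refine hdiag l hl ?_
    unfold cc at h
    rw [← h]
    ring
  · exact hp (k, l, true) (mem_pieces.mpr ⟨hk, hl⟩) ((mem_piece_true X Y hk hl).mpr ⟨hs1, ht1, h⟩)

lemma integral_eq_sum (hN : 0 < N) {f : ℝ × ℝ → ℝ} (hf : IntegrableOn f Omega) :
    ∫ p in Omega, f p = ∑ τ ∈ pieces N, ∫ p in piece X Y τ, f p := by
  rw [← setIntegral_congr_set (pieces_ae_cover X Y hN)]
  exact integral_biUnion_finset _ (fun τ _ => (isOpen_rtri _ _).measurableSet)
    (pairwiseDisjoint_pieces X Y) fun τ hτ => hf.mono_set (piece_subset_Omega X Y hτ)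

end Grid

end Pieces

end

/-! ### Bounded measurable functions, Lipschitz functions and integration by parts -/

section

lemma convex_Omega : Convex ℝ Omega := (convex_Ioo 0 1).prod (convex_Ioo 0 1)

lemma measurableSet_Omega : MeasurableSet Omega := isOpen_Omega.measurableSet

lemma isCompact_closure_Omega : IsCompact (closure Omega) := by
  rw [closure_Omega]; exact isCompact_Icc.prod isCompact_Icc

lemma volume_Omega_lt_top : volume Omega < ⊤ :=
  (measure_mono subset_closure).trans_lt isCompact_closure_Omega.measure_lt_top

/-- Measurable functions that are bounded on the unit square. -/
def BM (f : ℝ × ℝ → ℝ) : Prop := Measurable f ∧ ∃ C, ∀ p ∈ Omega, |f p| ≤ C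

namespace BM

variable {f g : ℝ × ℝ → ℝ}

lemma const (c : ℝ) : BM (fun _ => c) := ⟨measurable_const, |c|, fun _ _ => le_rfl⟩

lemma add (hf : BM f) (hg : BM g) : BM (fun p => f p + g p) := by
  obtain ⟨hm, C, hC⟩ := hf
  obtain ⟨hm', C', hC'⟩ := hg
  exact ⟨hm.add hm', C + C', fun p hp => (abs_add_le _ _).trans (add_le_add (hC p hp) (hC' p hp))⟩

lemma neg (hf : BM f) : BM (fun p => -f p) := by
  obtain ⟨hm, C, hC⟩ := hf
  exact ⟨hm.neg, C, fun p hp => by rw [abs_neg]; exact hC p hp⟩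

lemma sub (hf : BM f) (hg : BM g) : BM (fun p => f p - g p) := by
  simpa only [sub_eq_add_neg] using hf.add hg.neg

lemma mul (hf : BM f) (hg : BM g) : BM (fun p => f p * g p) := by
  obtain ⟨hm, C, hC⟩ := hf
  obtain ⟨hm', C', hC'⟩ := hg
  refine ⟨hm.mul hm', C * C', fun p hp => ?_⟩
  rw [abs_mul]
  exact mul_le_mul (hC p hp) (hC' p hp) (abs_nonneg _) ((abs_nonneg _).trans (hC p hp))

lemma sq (hf : BM f) : BM (fun p => f p ^ 2) := by simpa only [pow_two] using hf.mul hf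

lemma of_continuous (hf : Continuous f) : BM f := by
  obtain ⟨C, hC⟩ := isCompact_closure_Omega.exists_bound_of_continuousOn hf.continuousOn
  exact ⟨hf.measurable, C, fun p hp => hC p (subset_closure hp)⟩

lemma dd_of_lip (ζ : ℝ × ℝ) (hf : Lip f) : BM (dd ζ f) := by
  obtain ⟨K, hK⟩ := hf
  refine ⟨measurable_fderiv_apply_const ℝ f ζ, K * ‖ζ‖, fun p _ => ?_⟩
  exact (ContinuousLinearMap.le_opNorm _ _).trans
    (mul_le_mul_of_nonneg_right (norm_fderiv_le_of_lipschitz ℝ hK) (norm_nonneg _))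

lemma integrableOn (hf : BM f) : IntegrableOn f Omega := by
  obtain ⟨hm, C, hC⟩ := hf
  exact IntegrableOn.of_bound volume_Omega_lt_top hm.aestronglyMeasurable C
    ((ae_restrict_iff' measurableSet_Omega).mpr (Filter.Eventually.of_forall fun p hp => hC p hp))

end BM

lemma Lip.bm {f : ℝ × ℝ → ℝ} (hf : Lip f) : BM f := BM.of_continuous hf.continuous

lemma Lip.ae_differentiableAt {f : ℝ × ℝ → ℝ} (hf : Lip f) :
    ∀ᵐ p : ℝ × ℝ, DifferentiableAt ℝ f p := by
  obtain ⟨K, hK⟩ := hf; exact hK.ae_differentiableAt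

/-- The factor `w` may grow exponentially and is only locally Lipschitz. For a pair of points with
one outside the square, the Lipschitz bound of `f` alone suffices, because `f` vanishes at that
point. -/
lemma Lip.mul_of_eq_zero {w f : ℝ × ℝ → ℝ} (hw : ContDiff ℝ 1 w) (hf : Lip f)
    (h0 : ∀ p ∉ Omega, f p = 0) : Lip (fun p => w p * f p) := by
  obtain ⟨C, hC⟩ := isCompact_closure_Omega.exists_bound_of_continuousOn hw.continuous.continuousOn
  obtain ⟨B, hB⟩ := isCompact_closure_Omega.exists_bound_of_continuousOn hf.continuous.continuousOn
  obtain ⟨K, hK⟩ := hf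
  obtain ⟨L, hL⟩ := LocallyLipschitzOn.exists_lipschitzOnWith_of_compact isCompact_closure_Omega
    (hw.locallyLipschitz.locallyLipschitzOn (s := closure Omega))
  have hne : (1 / 2, 1 / 2) ∈ closure Omega := by
    rw [closure_Omega]; constructor <;> constructor <;> norm_num
  have hC0 : 0 ≤ C := (norm_nonneg _).trans (hC _ hne)
  have hB0 : 0 ≤ B := (norm_nonneg _).trans (hB _ hne)
  have hmix : ∀ p ∈ Omega, ∀ q ∉ Omega, |w p * f p| ≤ C * K * dist p q := by
    intro p hp q hq
    rw [abs_mul, mul_assoc]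
    refine mul_le_mul (hC p (subset_closure hp)) ?_ (abs_nonneg _) hC0
    have := hK.dist_le_mul p q
    rwa [h0 q hq, dist_zero_right] at this
  refine ⟨⟨C * K + B * L, by positivity⟩, LipschitzWith.of_dist_le_mul fun p q => ?_⟩
  have hd : 0 ≤ B * L * dist p q := by positivity
  have hd' : 0 ≤ C * K * dist p q := by positivity
  change |w p * f p - w q * f q| ≤ (C * K + B * L) * dist p q
  rw [add_mul]
  by_cases hp : p ∈ Omega <;> by_cases hq : q ∈ Omega
  · have e : w p * f p - w q * f q = w p * (f p - f q) + f q * (w p - w q) := by ring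
    rw [e]
    refine (abs_add_le _ _).trans (add_le_add ?_ ?_)
    · rw [abs_mul, mul_assoc]
      exact mul_le_mul (hC p (subset_closure hp)) (hK.dist_le_mul p q) (abs_nonneg _) hC0
    · rw [abs_mul, mul_assoc]
      exact mul_le_mul (hB q (subset_closure hq))
        (hL.dist_le_mul p (subset_closure hp) q (subset_closure hq)) (abs_nonneg _) hB0
  · rw [h0 q hq, mul_zero, sub_zero]
    linarith [hmix p hp q hq]
  · rw [h0 p hp, mul_zero, zero_sub, abs_neg]
    have := hmix q hq p hp
    rw [dist_comm] at this
    linarith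
  · rw [h0 p hp, h0 q hq]
    simpa using add_nonneg hd' hd

/-- Off the closed square `g` is locally zero, and the frontier of a convex set is a null set. -/
lemma ae_dd_eq_zero {g : ℝ × ℝ → ℝ} (h0 : ∀ p ∉ Omega, g p = 0) (ζ : ℝ × ℝ) :
    ∀ᵐ p : ℝ × ℝ, p ∉ Omega → dd ζ g p = 0 := by
  have hnull : volume (frontier Omega) = 0 := convex_Omega.addHaar_frontier volume
  filter_upwards [measure_eq_zero_iff_ae_notMem.mp hnull] with p hp hpO
  have hcl : p ∉ closure Omega := fun h => hp ⟨h, by rwa [isOpen_Omega.interior_eq]⟩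
  have : g =ᶠ[nhds p] fun _ => 0 := by
    filter_upwards [isClosed_closure.isOpen_compl.mem_nhds hcl] with q hq
    exact h0 q fun h => hq (subset_closure h)
  rw [dd, this.fderiv_eq]
  simp

/-- Integration by parts. -/
lemma integral_dd_mul {f g : ℝ × ℝ → ℝ} (hf : Lip f) (hg : Lip g) (h0 : ∀ p ∉ Omega, g p = 0)
    (ζ : ℝ × ℝ) : ∫ p in Omega, dd ζ f p * g p = -∫ p in Omega, dd ζ g p * f p := by
  have hf' := hf.ae_differentiableAt
  have hg' := hg.ae_differentiableAt
  obtain ⟨K, hK⟩ := hf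
  obtain ⟨L, hL⟩ := hg
  have hsupp : HasCompactSupport g :=
    HasCompactSupport.intro isCompact_closure_Omega fun p hp => h0 p fun h => hp (subset_closure h)
  -- The formula on the plane needs compact support of one factor only. No boundary term occurs,
  -- since `g` vanishes off the square and its derivative does so almost everywhere.
  have key := hK.integral_lineDeriv_mul_eq (μ := volume) hL hsupp ζ
  rw [setIntegral_eq_integral_of_forall_compl_eq_zero (fun p hp => by rw [h0 p hp, mul_zero]),
    setIntegral_eq_integral_of_ae_compl_eq_zero
      (by filter_upwards [ae_dd_eq_zero h0 ζ] with p hp hpO; rw [hp hpO, zero_mul]),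
    ← integral_neg]
  calc ∫ p, dd ζ f p * g p = ∫ p, lineDeriv ℝ f p ζ * g p := by
        refine integral_congr_ae ?_
        filter_upwards [hf'] with p hp
        rw [hp.lineDeriv_eq_fderiv, dd]
    _ = _ := key
    _ = _ := by
        refine integral_congr_ae ?_
        filter_upwards [hg'] with p hp
        rw [hp.lineDeriv_eq_fderiv, dd, map_neg, neg_mul]

end

/-! ### Streamline and crosswind directions; the reciprocal weight and its local oscillation -/

section

/-- The linear functional `p ↦ dot p q`. -/
def dotL (q : ℝ × ℝ) : ℝ × ℝ →L[ℝ] ℝ :=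
  q.1 • ContinuousLinearMap.fst ℝ ℝ ℝ + q.2 • ContinuousLinearMap.snd ℝ ℝ ℝ

lemma dotL_apply (q p : ℝ × ℝ) : dotL q p = dot p q := by
  simp [dotL, dot, mul_comm]

section Directions

variable (P : Coeff)

lemma bNorm_pos : 0 < bNorm P := Real.sqrt_pos.mpr (by have := P.b₁_pos; positivity)

lemma bNorm_sq : bNorm P ^ 2 = P.b₁ ^ 2 + P.b₂ ^ 2 := Real.sq_sqrt (by positivity)

lemma dirBeta_sq : (dirBeta P).1 ^ 2 + (dirBeta P).2 ^ 2 = 1 := by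
  have := (bNorm_pos P).ne'
  simp only [dirBeta]
  field_simp
  rw [bNorm_sq]

lemma dirEta_fst : (dirEta P).1 = -(dirBeta P).2 := by simp [dirEta, dirBeta, neg_div]

lemma dirEta_snd : (dirEta P).2 = (dirBeta P).1 := rfl

lemma dot_beta_beta : dot (dirBeta P) (dirBeta P) = 1 := by
  rw [dot, ← dirBeta_sq P]; ring

lemma dot_eta_eta : dot (dirEta P) (dirEta P) = 1 := by
  rw [dot, dirEta_fst, dirEta_snd, ← dirBeta_sq P]; ring

lemma dot_beta_eta : dot (dirBeta P) (dirEta P) = 0 := by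
  rw [dot, dirEta_fst, dirEta_snd]; ring

lemma dot_eta_beta : dot (dirEta P) (dirBeta P) = 0 := by
  rw [dot, dirEta_fst, dirEta_snd]; ring

lemma dirBeta_fst_pos : 0 < (dirBeta P).1 := div_pos P.b₁_pos (bNorm_pos P)

lemma dirBeta_snd_pos : 0 < (dirBeta P).2 := div_pos P.b₂_pos (bNorm_pos P)

lemma dirBeta_fst_le : (dirBeta P).1 ≤ 1 := by
  nlinarith [dirBeta_sq P, sq_nonneg (dirBeta P).2, sq_nonneg ((dirBeta P).1 - 1)]

lemma dirBeta_snd_le : (dirBeta P).2 ≤ 1 := by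
  nlinarith [dirBeta_sq P, sq_nonneg (dirBeta P).1, sq_nonneg ((dirBeta P).2 - 1)]

lemma abs_dot_beta_le (p : ℝ × ℝ) : |dot p (dirBeta P)| ≤ |p.1| + |p.2| := by
  refine (abs_add_le _ _).trans (add_le_add ?_ ?_) <;> rw [abs_mul]
  · rw [abs_of_pos (dirBeta_fst_pos P)]
    exact mul_le_of_le_one_right (abs_nonneg _) (dirBeta_fst_le P)
  · rw [abs_of_pos (dirBeta_snd_pos P)]
    exact mul_le_of_le_one_right (abs_nonneg _) (dirBeta_snd_le P)

lemma abs_dot_eta_le (p : ℝ × ℝ) : |dot p (dirEta P)| ≤ |p.1| + |p.2| := by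
  refine (abs_add_le _ _).trans (add_le_add ?_ ?_) <;> rw [abs_mul]
  · rw [dirEta_fst, abs_neg, abs_of_pos (dirBeta_snd_pos P)]
    exact mul_le_of_le_one_right (abs_nonneg _) (dirBeta_snd_le P)
  · rw [dirEta_snd, abs_of_pos (dirBeta_fst_pos P)]
    exact mul_le_of_le_one_right (abs_nonneg _) (dirBeta_fst_le P)

lemma e1_eq : ((1, 0) : ℝ × ℝ) = (dirBeta P).1 • dirBeta P - (dirBeta P).2 • dirEta P := by
  have := dirBeta_sq P
  ext
  · simp only [Prod.fst_sub, Prod.smul_fst, smul_eq_mul, dirEta_fst]; linarith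
  · simp only [Prod.snd_sub, Prod.smul_snd, smul_eq_mul, dirEta_snd]; ring

lemma e2_eq : ((0, 1) : ℝ × ℝ) = (dirBeta P).2 • dirBeta P + (dirBeta P).1 • dirEta P := by
  have := dirBeta_sq P
  ext
  · simp only [Prod.fst_add, Prod.smul_fst, smul_eq_mul, dirEta_fst]; ring
  · simp only [Prod.snd_add, Prod.smul_snd, smul_eq_mul, dirEta_snd]; linarith

end Directions

/-- The parameters of the weight function. -/
structure WeightData (P : Coeff) where
  σβ : ℝ
  ση : ℝ
  xs : ℝ × ℝ
  σβ_pos : 0 < σβ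
  ση_pos : 0 < ση

namespace WeightData

variable {P : Coeff} (w : WeightData P)

/-- The scaled streamline coordinate. -/
def r (p : ℝ × ℝ) : ℝ := dot (p - w.xs) (dirBeta P) / w.σβ

/-- The scaled crosswind coordinate. -/
def s (p : ℝ × ℝ) : ℝ := dot (p - w.xs) (dirEta P) / w.ση

/-- The crosswind factor of the reciprocal weight. -/
def B (p : ℝ × ℝ) : ℝ := (2 + Real.exp (w.s p) + Real.exp (-w.s p)) / 4

/-- The reciprocal of the weight. -/
def W (p : ℝ × ℝ) : ℝ := (1 + Real.exp (w.r p)) / 2 * w.B p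

/-- The streamline derivative of the reciprocal weight. -/
def V (p : ℝ × ℝ) : ℝ := Real.exp (w.r p) / 2 * w.B p / w.σβ

/-- The crosswind derivative of the reciprocal weight. -/
def Z (p : ℝ × ℝ) : ℝ :=
  (1 + Real.exp (w.r p)) / 2 * ((Real.exp (w.s p) - Real.exp (-w.s p)) / 4) / w.ση

lemma W_eq (p : ℝ × ℝ) : (weight P w.σβ w.ση w.xs p)⁻¹ = w.W p := by
  have h1 : Real.exp (w.s p) * Real.exp (-w.s p) = 1 := by rw [← Real.exp_add]; simp
  have h2 := Real.exp_pos (w.r p)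
  have h3 := Real.exp_pos (w.s p)
  have h4 := Real.exp_pos (-w.s p)
  change (2 / (1 + Real.exp (w.r p)) * (2 / (1 + Real.exp (w.s p)))
    * (2 / (1 + Real.exp (-w.s p))))⁻¹ = (1 + Real.exp (w.r p)) / 2
      * ((2 + Real.exp (w.s p) + Real.exp (-w.s p)) / 4)
  field_simp
  linear_combination 4 * h1

lemma one_le_B (p : ℝ × ℝ) : 1 ≤ w.B p := by
  have h1 : Real.exp (w.s p) * Real.exp (-w.s p) = 1 := by rw [← Real.exp_add]; simp
  have h3 := Real.exp_pos (w.s p)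
  have h4 := Real.exp_pos (-w.s p)
  unfold B
  nlinarith [sq_nonneg (Real.exp (w.s p) - Real.exp (-w.s p))]

lemma B_pos (p : ℝ × ℝ) : 0 < w.B p := by linarith [w.one_le_B p]

lemma half_le_W (p : ℝ × ℝ) : 1 / 2 ≤ w.W p := by
  have h1 := w.one_le_B p
  have h2 := Real.exp_pos (w.r p)
  unfold W
  nlinarith

lemma W_pos (p : ℝ × ℝ) : 0 < w.W p := by linarith [w.half_le_W p]

lemma V_pos (p : ℝ × ℝ) : 0 < w.V p := by
  have := w.B_pos p
  have := w.σβ_pos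
  unfold V; positivity

/-- The ratio of the two sides is e^r / (1 + e^r), which decays exponentially upstream. The bound
therefore has no converse, and terms with `V` and terms with `W` are kept apart in all later
estimates. -/
lemma V_le (p : ℝ × ℝ) : w.V p ≤ w.W p / w.σβ := by
  have h1 := w.B_pos p
  have := w.σβ_pos
  unfold V W
  gcongr
  linarith

lemma abs_Z_le (p : ℝ × ℝ) : |w.Z p| ≤ w.W p / w.ση := by
  have h1 := w.B_pos p
  have := w.ση_pos
  have h2 := Real.exp_pos (w.r p)
  have h3 := Real.exp_pos (w.s p)
  have h4 := Real.exp_pos (-w.s p)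
  unfold Z W
  rw [abs_div, abs_mul, abs_of_pos this, abs_of_pos (show 0 < (1 + Real.exp (w.r p)) / 2 by linarith)]
  gcongr
  rw [abs_le]
  unfold B
  constructor <;> linarith

lemma W_xs : w.W w.xs = 1 := by
  simp [W, B, r, s, dot]
  norm_num

lemma hasFDerivAt_r (p : ℝ × ℝ) : HasFDerivAt w.r (w.σβ⁻¹ • dotL (dirBeta P)) p := by
  have h := ((dotL (dirBeta P)).hasFDerivAt (x := p - w.xs)).comp p
    ((hasFDerivAt_id p).sub_const w.xs)
  have h2 := h.const_mul w.σβ⁻¹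
  refine (h2.congr_of_eventuallyEq (Filter.Eventually.of_forall fun q => ?_))
  simp [r, dotL_apply, div_eq_inv_mul]

lemma hasFDerivAt_s (p : ℝ × ℝ) : HasFDerivAt w.s (w.ση⁻¹ • dotL (dirEta P)) p := by
  have h := ((dotL (dirEta P)).hasFDerivAt (x := p - w.xs)).comp p
    ((hasFDerivAt_id p).sub_const w.xs)
  have h2 := h.const_mul w.ση⁻¹
  refine (h2.congr_of_eventuallyEq (Filter.Eventually.of_forall fun q => ?_))
  simp [s, dotL_apply, div_eq_inv_mul]

lemma hasFDerivAt_W (p : ℝ × ℝ) :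
    HasFDerivAt w.W (w.V p • dotL (dirBeta P) + w.Z p • dotL (dirEta P)) p := by
  have h1 := (((w.hasFDerivAt_r p).exp.const_add 1).mul_const (1 / 2))
  have h2 := ((((w.hasFDerivAt_s p).exp.const_add 2).add (w.hasFDerivAt_s p).neg.exp).mul_const
    (1 / 4))
  refine ((h1.mul h2).congr_of_eventuallyEq
    (Filter.Eventually.of_forall fun q => ?_)).congr_fderiv ?_
  · simp [W, B]; ring
  · ext <;> simp [V, Z, B] <;> ring

lemma contDiff_W : ContDiff ℝ 1 w.W := by
  have hr : ContDiff ℝ 1 w.r := by unfold r dot; fun_prop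
  have hs : ContDiff ℝ 1 w.s := by unfold s dot; fun_prop
  unfold W B
  fun_prop

lemma continuous_r : Continuous w.r := by unfold r dot; fun_prop

lemma continuous_s : Continuous w.s := by unfold s dot; fun_prop

lemma continuous_W : Continuous w.W := w.contDiff_W.continuous

lemma continuous_V : Continuous w.V := by
  have := w.continuous_r
  have := w.continuous_s
  unfold V B
  fun_prop

lemma dd_beta_W (p : ℝ × ℝ) : dd (dirBeta P) w.W p = w.V p := by
  rw [dd, (w.hasFDerivAt_W p).fderiv]
  simp [dotL_apply, dot_beta_beta, dot_beta_eta]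

lemma dd_eta_W (p : ℝ × ℝ) : dd (dirEta P) w.W p = w.Z p := by
  rw [dd, (w.hasFDerivAt_W p).fderiv]
  simp [dotL_apply, dot_eta_beta, dot_eta_eta]

section Oscillation

variable {w} {p a : ℝ × ℝ} {h : ℝ}

lemma abs_exp_sub_le {x y δ : ℝ} (hxy : |x - y| ≤ δ) (hδ : δ ≤ 1) :
    |Real.exp x - Real.exp y| ≤ 2 * δ * Real.exp y := by
  have e : Real.exp x - Real.exp y = (Real.exp (x - y) - 1) * Real.exp y := by
    rw [sub_mul, ← Real.exp_add]; simp
  rw [e, abs_mul, abs_of_pos (Real.exp_pos y)]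
  have := Real.abs_exp_sub_one_le (hxy.trans hδ)
  gcongr
  linarith

/-- Closeness of `p` and `a` relative to the weight parameters. -/
structure Near (w : WeightData P) (h : ℝ) (p a : ℝ × ℝ) : Prop where
  beta : |dot (p - a) (dirBeta P)| ≤ h
  eta : |dot (p - a) (dirEta P)| ≤ h
  hβ : h ≤ w.σβ / 8
  hη : h ≤ w.ση / 8

lemma Near.nonneg (H : Near w h p a) : 0 ≤ h := (abs_nonneg _).trans H.beta

lemma Near.r_sub (H : Near w h p a) : |w.r p - w.r a| ≤ h / w.σβ := by
  have e : w.r p - w.r a = dot (p - a) (dirBeta P) / w.σβ := by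
    simp only [r, dot, Prod.fst_sub, Prod.snd_sub]; ring
  rw [e, abs_div, abs_of_pos w.σβ_pos]
  exact div_le_div_of_nonneg_right H.beta w.σβ_pos.le

lemma Near.s_sub (H : Near w h p a) : |w.s p - w.s a| ≤ h / w.ση := by
  have e : w.s p - w.s a = dot (p - a) (dirEta P) / w.ση := by
    simp only [s, dot, Prod.fst_sub, Prod.snd_sub]; ring
  rw [e, abs_div, abs_of_pos w.ση_pos]
  exact div_le_div_of_nonneg_right H.eta w.ση_pos.le

lemma Near.div_beta_le (H : Near w h p a) : h / w.σβ ≤ 1 / 8 := by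
  rw [div_le_iff₀ w.σβ_pos]; linarith [H.hβ]

lemma Near.div_eta_le (H : Near w h p a) : h / w.ση ≤ 1 / 8 := by
  rw [div_le_iff₀ w.ση_pos]; linarith [H.hη]

lemma Near.exp_r (H : Near w h p a) :
    |Real.exp (w.r p) - Real.exp (w.r a)| ≤ 2 * (h / w.σβ) * Real.exp (w.r a) :=
  abs_exp_sub_le H.r_sub (by linarith [H.div_beta_le])

lemma Near.exp_s (H : Near w h p a) :
    |Real.exp (w.s p) - Real.exp (w.s a)| ≤ 2 * (h / w.ση) * Real.exp (w.s a) :=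
  abs_exp_sub_le H.s_sub (by linarith [H.div_eta_le])

lemma Near.exp_neg_s (H : Near w h p a) :
    |Real.exp (-w.s p) - Real.exp (-w.s a)| ≤ 2 * (h / w.ση) * Real.exp (-w.s a) := by
  refine abs_exp_sub_le ?_ (by linarith [H.div_eta_le])
  rw [neg_sub_neg, abs_sub_comm]
  exact H.s_sub

lemma Near.B_sub (H : Near w h p a) : |w.B p - w.B a| ≤ 2 * (h / w.ση) * w.B a := by
  have h1 := abs_le.mp H.exp_s
  have h2 := abs_le.mp H.exp_neg_s
  have := div_nonneg H.nonneg w.ση_pos.le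
  rw [abs_le]
  unfold B
  constructor <;> nlinarith

/-- The crosswind factor of `Z`. -/
def B' (w : WeightData P) (p : ℝ × ℝ) : ℝ := (Real.exp (w.s p) - Real.exp (-w.s p)) / 4

lemma abs_B'_le (p : ℝ × ℝ) : |w.B' p| ≤ w.B p := by
  have h3 := Real.exp_pos (w.s p)
  have h4 := Real.exp_pos (-w.s p)
  rw [abs_le]
  unfold B B'
  constructor <;> linarith

lemma Near.B'_sub (H : Near w h p a) : |w.B' p - w.B' a| ≤ 2 * (h / w.ση) * w.B a := by
  have h1 := abs_le.mp H.exp_s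
  have h2 := abs_le.mp H.exp_neg_s
  have := div_nonneg H.nonneg w.ση_pos.le
  rw [abs_le]
  unfold B B'
  constructor <;> nlinarith

lemma Near.B_le (H : Near w h p a) : w.B p ≤ 2 * w.B a := by
  have h1 := abs_le.mp H.B_sub
  have h2 := mul_le_mul_of_nonneg_right H.div_eta_le (w.B_pos a).le
  linarith [w.B_pos a]

/-- With `h` at most an eighth of either parameter, the streamline and the crosswind factor each
lose at most a quarter, and (3/4)² exceeds 1/2. -/
lemma Near.V_ge (H : Near w h p a) : w.V a / 2 ≤ w.V p := by
  have h1 := (abs_le.mp H.B_sub).1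
  have h2 := mul_le_mul_of_nonneg_right H.div_eta_le (w.B_pos a).le
  have h3 := (abs_le.mp H.exp_r).1
  have h4 := mul_le_mul_of_nonneg_right H.div_beta_le (Real.exp_pos (w.r a)).le
  have h5 : 3 / 4 * w.B a ≤ w.B p := by linarith
  have h6 : 3 / 4 * Real.exp (w.r a) ≤ Real.exp (w.r p) := by linarith
  have h7 := mul_le_mul h6 h5 (by linarith [w.B_pos a]) (Real.exp_pos (w.r p)).le
  unfold V
  rw [div_div, mul_comm w.σβ, ← div_div]
  refine div_le_div_of_nonneg_right ?_ w.σβ_pos.le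
  have := mul_pos (Real.exp_pos (w.r a)) (w.B_pos a)
  linarith

lemma Near.W_ge (H : Near w h p a) : w.W a / 2 ≤ w.W p := by
  have h1 := (abs_le.mp H.B_sub).1
  have h2 := mul_le_mul_of_nonneg_right H.div_eta_le (w.B_pos a).le
  have h3 := (abs_le.mp H.exp_r).1
  have h4 := mul_le_mul_of_nonneg_right H.div_beta_le (Real.exp_pos (w.r a)).le
  have h5 : 3 / 4 * w.B a ≤ w.B p := by linarith
  have h6 : 3 / 4 * (1 + Real.exp (w.r a)) ≤ 1 + Real.exp (w.r p) := by linarith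
  have h7 := mul_le_mul h6 h5 (by linarith [w.B_pos a]) (by linarith [Real.exp_pos (w.r p)])
  unfold W
  have := mul_pos (show 0 < 1 + Real.exp (w.r a) by linarith [Real.exp_pos (w.r a)]) (w.B_pos a)
  linarith

lemma abs_mul_sub_mul_le {x y x' y' d e z : ℝ} (hx : |x - x'| ≤ d) (hy : |y - y'| ≤ e)
    (hz : |y| ≤ z) : |x * y - x' * y'| ≤ d * z + |x'| * e := by
  have : x * y - x' * y' = (x - x') * y + x' * (y - y') := by ring
  rw [this]
  refine (abs_add_le _ _).trans (add_le_add ?_ ?_) <;> rw [abs_mul]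
  · exact mul_le_mul hx hz (abs_nonneg _) ((abs_nonneg _).trans hx)
  · exact mul_le_mul_of_nonneg_left hy (abs_nonneg _)

lemma Near.half_exp (H : Near w h p a) :
    |(1 + Real.exp (w.r p)) / 2 - (1 + Real.exp (w.r a)) / 2| ≤ h / w.σβ * Real.exp (w.r a) := by
  have := abs_le.mp H.exp_r
  rw [abs_le]
  constructor <;> linarith

lemma W_aux (h : ℝ) (a : ℝ × ℝ) :
    h / w.σβ * Real.exp (w.r a) * (2 * w.B a)
      + |(1 + Real.exp (w.r a)) / 2| * (2 * (h / w.ση) * w.B a)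
      = 4 * h * w.V a + 2 * (h / w.ση) * w.W a := by
  rw [abs_of_pos (by linarith [Real.exp_pos (w.r a)])]
  unfold V W
  ring

/-- The two terms come from changing the streamline and the crosswind factor of `W` separately. The
first change is proportional to e^r and hence costs `V`, which is better than `W / σβ`. -/
lemma Near.W_sub (H : Near w h p a) :
    |w.W p - w.W a| ≤ 4 * h * w.V a + 2 * (h / w.ση) * w.W a := by
  rw [← W_aux]
  exact abs_mul_sub_mul_le H.half_exp H.B_sub (by rw [abs_of_pos (w.B_pos p)]; exact H.B_le)

lemma Z_eq (p : ℝ × ℝ) : w.Z p = (1 + Real.exp (w.r p)) / 2 * w.B' p / w.ση := rfl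

lemma Near.Z_sub (H : Near w h p a) :
    |w.Z p - w.Z a| ≤ (4 * h * w.V a + 2 * (h / w.ση) * w.W a) / w.ση := by
  rw [← W_aux, Z_eq, Z_eq, ← sub_div, abs_div, abs_of_pos w.ση_pos]
  refine div_le_div_of_nonneg_right ?_ w.ση_pos.le
  exact abs_mul_sub_mul_le H.half_exp H.B'_sub ((abs_B'_le p).trans H.B_le)

lemma Near.V_sub (H : Near w h p a) :
    |w.V p - w.V a| ≤ (4 * (h / w.σβ) + 2 * (h / w.ση)) * w.V a := by
  have h1 : |Real.exp (w.r p) / 2 - Real.exp (w.r a) / 2| ≤ h / w.σβ * Real.exp (w.r a) := by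
    have := abs_le.mp H.exp_r
    rw [abs_le]
    constructor <;> linarith
  have h2 := abs_mul_sub_mul_le h1 H.B_sub
    (z := 2 * w.B a) (by rw [abs_of_pos (w.B_pos p)]; exact H.B_le)
  unfold V
  rw [← sub_div, abs_div, abs_of_pos w.σβ_pos]
  refine (div_le_div_of_nonneg_right h2 w.σβ_pos.le).trans_eq ?_
  rw [abs_of_pos (by linarith [Real.exp_pos (w.r a)])]
  ring

end Oscillation

end WeightData

end

/-! ### Affine functions and interpolation errors on a right triangle -/

section

/-- The affine function with constant term `c` and gradient `g`. -/
def aff (c : ℝ) (g p : ℝ × ℝ) : ℝ := c + dot p g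

lemma hasFDerivAt_aff (c : ℝ) (g p : ℝ × ℝ) : HasFDerivAt (aff c g) (dotL g) p := by
  have h := ((dotL g).hasFDerivAt (x := p)).const_add c
  refine h.congr_of_eventuallyEq (Filter.Eventually.of_forall fun q => ?_)
  simp [aff, dotL_apply]

lemma continuous_aff (c : ℝ) (g : ℝ × ℝ) : Continuous (aff c g) := by
  unfold aff dot; fun_prop

lemma dot_comm' (p q : ℝ × ℝ) : dot p q = dot q p := by unfold dot; ring

lemma aff_sub (c : ℝ) (g p q : ℝ × ℝ) : aff c g p - aff c g q = dot (p - q) g := by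
  simp only [aff, dot, Prod.fst_sub, Prod.snd_sub]; ring

lemma dot_decomp (P : Coeff) (p g : ℝ × ℝ) : dot p g = dot p (dirBeta P) * dot (dirBeta P) g
    + dot p (dirEta P) * dot (dirEta P) g := by
  have h := dirBeta_sq P
  simp only [dot, dirEta_fst, dirEta_snd]
  linear_combination (-(p.1 * g.1) - p.2 * g.2) * h

section Homothety

/-- If `v` carries the maximal modulus, then on the copy of `U` contracted towards `v` by 1/4 the
function is at least 3/4 - 1/4 = 1/2 of that maximum. The copy has 1/16 of the area, and 16 · 4 =
64. The argument does not see the shape of the triangle. -/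
lemma sq_mul_volume_le {U : Set (ℝ × ℝ)} (hU : MeasurableSet U) (hfin : volume U ≠ ⊤) {c : ℝ}
    {g v : ℝ × ℝ} (hstar : ∀ p ∈ U, AffineMap.homothety v (1 / 4 : ℝ) p ∈ U)
    (hmax : ∀ p ∈ U, |aff c g p| ≤ |aff c g v|) (hint : IntegrableOn (fun p => aff c g p ^ 2) U) :
    aff c g v ^ 2 * volume.real U ≤ 64 * ∫ p in U, aff c g p ^ 2 := by
  set S := AffineMap.homothety v (1 / 4 : ℝ) '' U with hS
  have hSU : S ⊆ U := by rintro _ ⟨p, hp, rfl⟩; exact hstar p hp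
  have hvol : volume.real S = volume.real U / 16 := by
    rw [measureReal_def, hS, Measure.addHaar_image_homothety, ENNReal.toReal_mul, ← measureReal_def]
    simp
    norm_num
    ring
  have hval : ∀ q ∈ S, aff c g v ^ 2 / 4 ≤ aff c g q ^ 2 := by
    rintro _ ⟨p, hp, rfl⟩
    have e : aff c g (AffineMap.homothety v (1 / 4 : ℝ) p)
        = 3 / 4 * aff c g v + 1 / 4 * aff c g p := by
      simp only [AffineMap.homothety_apply, vsub_eq_sub, vadd_eq_add, aff, dot, Prod.fst_add,
        Prod.snd_add, Prod.smul_fst, Prod.smul_snd, smul_eq_mul, Prod.fst_sub, Prod.snd_sub]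
      ring
    have h := hmax p hp
    have h2 : |aff c g v / 2| ≤ |aff c g (AffineMap.homothety v (1 / 4 : ℝ) p)| := by
      rw [e, abs_div, abs_two]
      have := abs_sub_abs_le_abs_sub (3 / 4 * aff c g v) (-(1 / 4 * aff c g p))
      rw [abs_neg, abs_mul, abs_mul, sub_neg_eq_add] at this
      norm_num at this
      norm_num
      linarith
    have := sq_le_sq.mpr h2
    linarith
  have hmeas : MeasurableSet S := by
    have h4 : (1 / 4 : ℝ) ≠ 0 := by norm_num
    have : S = AffineMap.homothety v (4 : ℝ) ⁻¹' U := by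
      ext q
      constructor
      · rintro ⟨p, hp, rfl⟩
        have : AffineMap.homothety v (4 : ℝ) (AffineMap.homothety v (1 / 4 : ℝ) p) = p := by
          rw [← AffineMap.homothety_mul_apply]; norm_num
        rwa [mem_preimage, this]
      · intro hq
        refine ⟨_, hq, ?_⟩
        rw [← AffineMap.homothety_mul_apply]; norm_num
    rw [this]
    exact (AffineMap.homothety_continuous v (4 : ℝ)).measurable hU
  have h1 : ∫ p in S, aff c g p ^ 2 ≤ ∫ p in U, aff c g p ^ 2 :=
    setIntegral_mono_set hint (Filter.Eventually.of_forall fun p => sq_nonneg _)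
      (LE.le.eventuallyLE hSU)
  have h2 : volume.real S * (aff c g v ^ 2 / 4) ≤ ∫ p in S, aff c g p ^ 2 := by
    have := setIntegral_mono_on (μ := volume)
      (integrableOn_const (ne_top_of_le_ne_top hfin (measure_mono hSU)))
      (hint.mono_set hSU) hmeas hval
    rwa [setIntegral_const, smul_eq_mul] at this
  rw [hvol] at h2
  linarith

end Homothety

section RightTriangle

variable {a d : ℝ × ℝ} (hd1 : d.1 ≠ 0) (hd2 : d.2 ≠ 0)

lemma anchor_mem_crtri (a d : ℝ × ℝ) : a ∈ crtri a d := by simp [crtri]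

include hd1 in
lemma fst_mem_crtri : a + (d.1, 0) ∈ crtri a d := by simp [crtri, hd1]

include hd2 in
lemma snd_mem_crtri : a + (0, d.2) ∈ crtri a d := by simp [crtri, hd2]

lemma homothety_mem_rtri {v p : ℝ × ℝ} (hv : v ∈ crtri a d) (hp : p ∈ rtri a d) :
    AffineMap.homothety v (1 / 4 : ℝ) p ∈ rtri a d := by
  obtain ⟨h1, h2, h3⟩ := hv
  obtain ⟨k1, k2, k3⟩ := hp
  have e1 : ((AffineMap.homothety v (1 / 4 : ℝ) p).1 - a.1) / d.1
      = 3 / 4 * ((v.1 - a.1) / d.1) + 1 / 4 * ((p.1 - a.1) / d.1) := by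
    simp only [AffineMap.homothety_apply, vsub_eq_sub, vadd_eq_add, Prod.fst_add, Prod.smul_fst,
      smul_eq_mul, Prod.fst_sub]
    ring
  have e2 : ((AffineMap.homothety v (1 / 4 : ℝ) p).2 - a.2) / d.2
      = 3 / 4 * ((v.2 - a.2) / d.2) + 1 / 4 * ((p.2 - a.2) / d.2) := by
    simp only [AffineMap.homothety_apply, vsub_eq_sub, vadd_eq_add, Prod.snd_add, Prod.smul_snd,
      smul_eq_mul, Prod.snd_sub]
    ring
  refine ⟨?_, ?_, ?_⟩ <;> simp only [e1, e2] <;> linarith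

include hd1 hd2 in
lemma aff_barycentric (c : ℝ) (g p : ℝ × ℝ) : aff c g p =
    (1 - (p.1 - a.1) / d.1 - (p.2 - a.2) / d.2) * aff c g a
      + (p.1 - a.1) / d.1 * aff c g (a + (d.1, 0))
      + (p.2 - a.2) / d.2 * aff c g (a + (0, d.2)) := by
  simp only [aff, dot, Prod.fst_add, Prod.snd_add, add_zero]
  field_simp
  ring

include hd1 hd2 in
lemma abs_aff_le {c m : ℝ} {g p : ℝ × ℝ} (hp : p ∈ crtri a d) (h0 : |aff c g a| ≤ m)
    (h1 : |aff c g (a + (d.1, 0))| ≤ m) (h2 : |aff c g (a + (0, d.2))| ≤ m) :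
    |aff c g p| ≤ m := by
  obtain ⟨k1, k2, k3⟩ := hp
  rw [aff_barycentric (a := a) hd1 hd2 c g p]
  generalize (p.1 - a.1) / d.1 = s at *
  generalize (p.2 - a.2) / d.2 = t at *
  rw [abs_le] at *
  constructor <;> nlinarith

include hd1 hd2 in
/-- The values of an affine function at the vertices are controlled by its mean square. -/
lemma exists_vertex_bound (c : ℝ) (g : ℝ × ℝ) (hfin : volume (rtri a d) ≠ ⊤)
    (hint : IntegrableOn (fun p => aff c g p ^ 2) (rtri a d)) :
    ∃ m, 0 ≤ m ∧ |aff c g a| ≤ m ∧ |aff c g (a + (d.1, 0))| ≤ m ∧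
      |aff c g (a + (0, d.2))| ≤ m ∧
      m ^ 2 * volume.real (rtri a d) ≤ 64 * ∫ p in rtri a d, aff c g p ^ 2 := by
  have key : ∀ v ∈ crtri a d, |aff c g a| ≤ |aff c g v| →
      |aff c g (a + (d.1, 0))| ≤ |aff c g v| → |aff c g (a + (0, d.2))| ≤ |aff c g v| →
      ∃ m, 0 ≤ m ∧ |aff c g a| ≤ m ∧ |aff c g (a + (d.1, 0))| ≤ m ∧
      |aff c g (a + (0, d.2))| ≤ m ∧
      m ^ 2 * volume.real (rtri a d) ≤ 64 * ∫ p in rtri a d, aff c g p ^ 2 := by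
    intro v hv h0 h1 h2
    refine ⟨|aff c g v|, abs_nonneg _, h0, h1, h2, ?_⟩
    rw [sq_abs]
    exact sq_mul_volume_le (isOpen_rtri a d).measurableSet hfin
      (fun p hp => homothety_mem_rtri hv hp)
      (fun p hp => abs_aff_le hd1 hd2 (rtri_subset_crtri a d hp) h0 h1 h2) hint
  rcases le_total |aff c g (a + (d.1, 0))| |aff c g (a + (0, d.2))| with h | h
  · rcases le_total |aff c g a| |aff c g (a + (0, d.2))| with h' | h'
    · exact key _ (snd_mem_crtri hd2) h' h le_rfl
    · exact key _ (anchor_mem_crtri a d) le_rfl (h.trans h') h'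
  · rcases le_total |aff c g a| |aff c g (a + (d.1, 0))| with h' | h'
    · exact key _ (fst_mem_crtri hd1) h' le_rfl h
    · exact key _ (anchor_mem_crtri a d) le_rfl h' (h.trans h')

include hd1 hd2 in
lemma abs_sub_le_of_mem_crtri {p : ℝ × ℝ} (hp : p ∈ crtri a d) :
    |p.1 - a.1| ≤ |d.1| ∧ |p.2 - a.2| ≤ |d.2| := by
  obtain ⟨k1, k2, k3⟩ := hp
  constructor
  · have : p.1 - a.1 = (p.1 - a.1) / d.1 * d.1 := by field_simp
    rw [this, abs_mul, abs_of_nonneg k1]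
    exact mul_le_of_le_one_left (abs_nonneg _) (by linarith)
  · have : p.2 - a.2 = (p.2 - a.2) / d.2 * d.2 := by field_simp
    rw [this, abs_mul, abs_of_nonneg k2]
    exact mul_le_of_le_one_left (abs_nonneg _) (by linarith)

/-- The mean value theorem on a segment; when the end values agree it is Rolle's theorem. -/
lemma exists_deriv_zero_on_segment {F : ℝ × ℝ → ℝ} {F' : ℝ × ℝ → ℝ × ℝ →L[ℝ] ℝ}
    (hF : ∀ p, HasFDerivAt F (F' p) p) (p v : ℝ × ℝ) :
    ∃ t ∈ Ioo (0 : ℝ) 1, F (p + v) - F p = F' (p + t • v) v := by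
  have hline : ∀ t : ℝ, HasDerivAt (fun t : ℝ => F (p + t • v)) (F' (p + t • v) v) t := by
    intro t
    have h1 : HasDerivAt (fun t : ℝ => p + t • v) v t := by
      simpa using ((hasDerivAt_id t).smul_const v).const_add p
    exact (hF _).comp_hasDerivAt t h1
  obtain ⟨t, ht, h⟩ := exists_hasDerivAt_eq_slope (fun t : ℝ => F (p + t • v))
    (fun t => F' (p + t • v) v) zero_lt_one
    (fun t _ => (hline t).continuousAt.continuousWithinAt) (fun t _ => hline t)
  refine ⟨t, ht, ?_⟩
  rw [h]
  simp

include hd1 hd2 in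
/-- Interpolation error on a right triangle in terms of the oscillation of the gradient. -/
lemma interp_error {F : ℝ × ℝ → ℝ} {F' : ℝ × ℝ → ℝ × ℝ →L[ℝ] ℝ}
    (hF : ∀ p, HasFDerivAt F (F' p) p) (h0 : F a = 0) (h1 : F (a + (d.1, 0)) = 0)
    (h2 : F (a + (0, d.2)) = 0) {M : ℝ}
    (hM1 : ∀ p ∈ crtri a d, |F' p (1, 0) - F' a (1, 0)| ≤ M)
    (hM2 : ∀ p ∈ crtri a d, |F' p (0, 1) - F' a (0, 1)| ≤ M) {p : ℝ × ℝ} (hp : p ∈ crtri a d) :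
    |F' p (1, 0)| ≤ 2 * M ∧ |F' p (0, 1)| ≤ 2 * M ∧ |F p| ≤ 2 * M * (|d.1| + |d.2|) := by
  have e1 : ((d.1, 0) : ℝ × ℝ) = d.1 • ((1, 0) : ℝ × ℝ) := by ext <;> simp
  have e2 : ((0, d.2) : ℝ × ℝ) = d.2 • ((0, 1) : ℝ × ℝ) := by ext <;> simp
  -- `F` vanishes at both ends of the leg, so its derivative along the leg has a zero there, and the
  -- oscillation bound carries this to the corner. The legs are parallel to the axes, so neither
  -- angles nor the aspect ratio enter.
  have g1 : |F' a (1, 0)| ≤ M := by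
    obtain ⟨t, ht, h⟩ := exists_deriv_zero_on_segment hF a (d.1, 0)
    have hmem : a + t • ((d.1, 0) : ℝ × ℝ) ∈ crtri a d := by
      simp [crtri, hd1, ht.1.le, ht.2.le]
    have := hM1 _ hmem
    rw [h0, h1, sub_zero, e1, map_smul, smul_eq_mul, eq_comm, mul_eq_zero, or_iff_right hd1, ← e1]
      at h
    rwa [h, zero_sub, abs_neg] at this
  have g2 : |F' a (0, 1)| ≤ M := by
    obtain ⟨t, ht, h⟩ := exists_deriv_zero_on_segment hF a (0, d.2)
    have hmem : a + t • ((0, d.2) : ℝ × ℝ) ∈ crtri a d := by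
      simp [crtri, hd2, ht.1.le, ht.2.le]
    have := hM2 _ hmem
    rw [h0, h2, sub_zero, e2, map_smul, smul_eq_mul, eq_comm, mul_eq_zero, or_iff_right hd2, ← e2]
      at h
    rwa [h, zero_sub, abs_neg] at this
  have b1 : ∀ q ∈ crtri a d, |F' q (1, 0)| ≤ 2 * M := fun q hq => by
    have h := abs_le.mp (hM1 q hq)
    have h' := abs_le.mp g1
    rw [abs_le]; constructor <;> linarith
  have b2 : ∀ q ∈ crtri a d, |F' q (0, 1)| ≤ 2 * M := fun q hq => by
    have h := abs_le.mp (hM2 q hq)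
    have h' := abs_le.mp g2
    rw [abs_le]; constructor <;> linarith
  refine ⟨b1 p hp, b2 p hp, ?_⟩
  -- The value itself follows by integrating the gradient bound from the corner, where `F` is zero.
  obtain ⟨t, ht, h⟩ := exists_deriv_zero_on_segment hF a (p - a)
  have hmem : a + t • (p - a) ∈ crtri a d := by
    obtain ⟨k1, k2, k3⟩ := hp
    have j1 : ((a + t • (p - a)).1 - a.1) / d.1 = t * ((p.1 - a.1) / d.1) := by simp; ring
    have j2 : ((a + t • (p - a)).2 - a.2) / d.2 = t * ((p.2 - a.2) / d.2) := by simp; ring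
    have := ht.1.le
    refine ⟨?_, ?_, ?_⟩ <;> simp only [j1, j2]
    · positivity
    · positivity
    · nlinarith [ht.2]
  have e3 : p - a = (p.1 - a.1) • ((1, 0) : ℝ × ℝ) + (p.2 - a.2) • ((0, 1) : ℝ × ℝ) := by
    ext <;> simp
  rw [add_sub_cancel, h0, sub_zero] at h
  rw [h]
  nth_rw 2 [e3]
  rw [map_add, map_smul, map_smul, smul_eq_mul, smul_eq_mul]
  obtain ⟨l1, l2⟩ := abs_sub_le_of_mem_crtri hd1 hd2 hp
  have hM : 0 ≤ 2 * M := (abs_nonneg _).trans (b1 p hp)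
  refine (abs_add_le _ _).trans ?_
  rw [abs_mul, abs_mul]
  have := mul_le_mul l1 (b1 _ hmem) (abs_nonneg _) (abs_nonneg _)
  have := mul_le_mul l2 (b2 _ hmem) (abs_nonneg _) (abs_nonneg _)
  linarith

end RightTriangle

end

/-! ### The weighted interpolation error on one triangle -/

section

/-- The bound of the scaled squared second derivatives on a mesh triangle. -/
def errT (A B V W m gβ gη : ℝ) : ℝ :=
  (V * A ^ 3 + V * A * B ^ 2 + W * B ^ 4) * m ^ 2 + (V * A + W * B ^ 2) * (gβ ^ 2 + gη ^ 2)

lemma sq_sum_seven_le (x₁ x₂ x₃ x₄ x₅ x₆ x₇ : ℝ) :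
    (x₁ + x₂ + x₃ + x₄ + x₅ + x₆ + x₇) ^ 2
      ≤ 7 * (x₁ ^ 2 + x₂ ^ 2 + x₃ ^ 2 + x₄ ^ 2 + x₅ ^ 2 + x₆ ^ 2 + x₇ ^ 2) := by
  have h := sq_sum_le_card_mul_sum_sq (s := (Finset.univ : Finset (Fin 7)))
    (f := ![x₁, x₂, x₃, x₄, x₅, x₆, x₇])
  simpa [Fin.sum_univ_seven] using h

/-- Here `A` and `B` stand for the reciprocals of σ_β and σ_η. In each square V², one factor is
replaced by its bound `W * A`, so that a factor `W` can be pulled out; it later cancels the weight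
1/W. Cauchy–Schwarz for seven terms gives 700 = 7 · 10². -/
lemma sq_osc_le {A B V W m gβ gη h : ℝ} (hV : 0 ≤ V)
    (hVW : V ≤ W * A) :
    (10 * h * ((V * A + V * B + W * B ^ 2) * m + (V + W * B) * (|gβ| + |gη|))) ^ 2
      ≤ W * (700 * h ^ 2 * errT A B V W m gβ gη) := by
  have h7 := sq_sum_seven_le (V * A * m) (V * B * m) (W * B ^ 2 * m) (V * |gβ|) (V * |gη|)
    (W * B * |gβ|) (W * B * |gη|)
  have hVV : V ^ 2 ≤ V * (W * A) := by rw [pow_two]; exact mul_le_mul_of_nonneg_left hVW hV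
  have k1 := mul_le_mul_of_nonneg_right hVV (show 0 ≤ (A * m) ^ 2 by positivity)
  have k2 := mul_le_mul_of_nonneg_right hVV (show 0 ≤ (B * m) ^ 2 by positivity)
  have k3 := mul_le_mul_of_nonneg_right hVV (show 0 ≤ gβ ^ 2 + gη ^ 2 by positivity)
  have e1 : |gβ| ^ 2 = gβ ^ 2 := sq_abs _
  have e2 : |gη| ^ 2 = gη ^ 2 := sq_abs _
  have hsum : (V * A * m) ^ 2 + (V * B * m) ^ 2 + (W * B ^ 2 * m) ^ 2 + (V * |gβ|) ^ 2
      + (V * |gη|) ^ 2 + (W * B * |gβ|) ^ 2 + (W * B * |gη|) ^ 2 ≤ W * errT A B V W m gβ gη := by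
    simp only [mul_pow, e1, e2]
    unfold errT
    nlinarith [k1, k2, k3]
  have hh : 0 ≤ 100 * h ^ 2 := by positivity
  calc (10 * h * ((V * A + V * B + W * B ^ 2) * m + (V + W * B) * (|gβ| + |gη|))) ^ 2
      = 100 * h ^ 2 * (V * A * m + V * B * m + W * B ^ 2 * m + V * |gβ| + V * |gη|
          + W * B * |gβ| + W * B * |gη|) ^ 2 := by ring
    _ ≤ 100 * h ^ 2 * (7 * (W * errT A B V W m gβ gη)) :=
        mul_le_mul_of_nonneg_left (h7.trans (by linarith)) hh
    _ = _ := by ring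

namespace WeightData

variable {P : Coeff} (w : WeightData P)

/-- The error `W v - I(W v)` on a triangle, and its gradient. -/
def err (c : ℝ) (g : ℝ × ℝ) (c' : ℝ) (g' : ℝ × ℝ) (p : ℝ × ℝ) : ℝ :=
  w.W p * aff c g p - aff c' g' p

/-- The gradient of `err`. -/
def gradErr (c : ℝ) (g g' p : ℝ × ℝ) : ℝ × ℝ →L[ℝ] ℝ :=
  w.W p • dotL g + aff c g p • (w.V p • dotL (dirBeta P) + w.Z p • dotL (dirEta P)) - dotL g'

lemma hasFDerivAt_err (c : ℝ) (g : ℝ × ℝ) (c' : ℝ) (g' p : ℝ × ℝ) :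
    HasFDerivAt (w.err c g c' g') (w.gradErr c g g' p) p :=
  ((w.hasFDerivAt_W p).mul (hasFDerivAt_aff c g p)).sub (hasFDerivAt_aff c' g' p)

variable {w} {a d : ℝ × ℝ} (hd1 : d.1 ≠ 0) (hd2 : d.2 ≠ 0)

include hd1 hd2 in
lemma near_of_mem_crtri {p : ℝ × ℝ} (hp : p ∈ crtri a d) (hβ : |d.1| + |d.2| ≤ w.σβ / 8)
    (hη : |d.1| + |d.2| ≤ w.ση / 8) : Near w (|d.1| + |d.2|) p a := by
  obtain ⟨l1, l2⟩ := abs_sub_le_of_mem_crtri hd1 hd2 hp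
  exact ⟨(abs_dot_beta_le P _).trans (add_le_add l1 l2),
    (abs_dot_eta_le P _).trans (add_le_add l1 l2), hβ, hη⟩

/-- The bound of the oscillation of the gradient of `W v`. -/
def osc (w : WeightData P) (h m : ℝ) (a g : ℝ × ℝ) : ℝ :=
  10 * h * ((w.V a * w.σβ⁻¹ + w.V a * w.ση⁻¹ + w.W a * w.ση⁻¹ ^ 2) * m
    + (w.V a + w.W a * w.ση⁻¹) * (|dot (dirBeta P) g| + |dot (dirEta P) g|))

lemma gradErr_beta (c : ℝ) (g g' p : ℝ × ℝ) : w.gradErr c g g' p (dirBeta P)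
    = w.W p * dot (dirBeta P) g + w.V p * aff c g p - dot (dirBeta P) g' := by
  simp [gradErr, dotL_apply, dot_beta_beta, dot_beta_eta]
  ring

lemma gradErr_eta (c : ℝ) (g g' p : ℝ × ℝ) : w.gradErr c g g' p (dirEta P)
    = w.W p * dot (dirEta P) g + w.Z p * aff c g p - dot (dirEta P) g' := by
  simp [gradErr, dotL_apply, dot_eta_beta, dot_eta_eta]
  ring

/-- The gradient `g'` of the interpolant is constant and drops out. What remains is the oscillation
of the gradient of W times an affine function, to which only derivatives of W and the difference of
the affine values contribute. -/
lemma Near.gradErr_sub {p : ℝ × ℝ} {h m : ℝ} (H : Near w h p a) {c : ℝ} {g : ℝ × ℝ}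
    (hm : |aff c g p| ≤ m) (g' : ℝ × ℝ) :
    |w.gradErr c g g' p (dirBeta P) - w.gradErr c g g' a (dirBeta P)|
      + |w.gradErr c g g' p (dirEta P) - w.gradErr c g g' a (dirEta P)| ≤ osc w h m a g := by
  set gβ := dot (dirBeta P) g with hgβ
  set gη := dot (dirEta P) g with hgη
  have hL : |aff c g p - aff c g a| ≤ h * (|gβ| + |gη|) := by
    rw [aff_sub, dot_decomp P]
    refine (abs_add_le _ _).trans ?_
    rw [abs_mul, abs_mul, mul_add]
    exact add_le_add (mul_le_mul_of_nonneg_right H.beta (abs_nonneg _))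
      (mul_le_mul_of_nonneg_right H.eta (abs_nonneg _))
  have hm0 : 0 ≤ m := (abs_nonneg _).trans hm
  have hh := H.nonneg
  have hV := w.V_pos a
  have hW := w.W_pos a
  have hA := inv_pos.mpr w.σβ_pos
  have hB := inv_pos.mpr w.ση_pos
  have hW1 := H.W_sub
  have e1 := abs_mul_sub_mul_le H.V_sub hL hm
  have e2 := abs_mul_sub_mul_le H.Z_sub hL hm
  have hZ := w.abs_Z_le a
  rw [abs_of_pos hV] at e1
  have e1' : |w.gradErr c g g' p (dirBeta P) - w.gradErr c g g' a (dirBeta P)| ≤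
      (4 * h * w.V a + 2 * (h / w.ση) * w.W a) * |gβ| +
      ((4 * (h / w.σβ) + 2 * (h / w.ση)) * w.V a * m + w.V a * (h * (|gβ| + |gη|))) := by
    rw [gradErr_beta, gradErr_beta]
    have : w.W p * gβ + w.V p * aff c g p - dot (dirBeta P) g'
        - (w.W a * gβ + w.V a * aff c g a - dot (dirBeta P) g')
        = (w.W p - w.W a) * gβ + (w.V p * aff c g p - w.V a * aff c g a) := by ring
    rw [this]
    refine (abs_add_le _ _).trans (add_le_add ?_ e1)
    rw [abs_mul]
    exact mul_le_mul_of_nonneg_right hW1 (abs_nonneg _)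
  have e2' : |w.gradErr c g g' p (dirEta P) - w.gradErr c g g' a (dirEta P)| ≤
      (4 * h * w.V a + 2 * (h / w.ση) * w.W a) * |gη| +
      ((4 * h * w.V a + 2 * (h / w.ση) * w.W a) / w.ση * m
        + w.W a / w.ση * (h * (|gβ| + |gη|))) := by
    rw [gradErr_eta, gradErr_eta]
    have : w.W p * gη + w.Z p * aff c g p - dot (dirEta P) g'
        - (w.W a * gη + w.Z a * aff c g a - dot (dirEta P) g')
        = (w.W p - w.W a) * gη + (w.Z p * aff c g p - w.Z a * aff c g a) := by ring
    rw [this]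
    refine (abs_add_le _ _).trans (add_le_add ?_ (e2.trans (by gcongr)))
    rw [abs_mul]
    exact mul_le_mul_of_nonneg_right hW1 (abs_nonneg _)
  refine (add_le_add e1' e2').trans ?_
  unfold osc
  simp only [div_eq_mul_inv]
  generalize w.σβ⁻¹ = A at *
  generalize w.ση⁻¹ = B at *
  generalize w.V a = V at *
  generalize w.W a = W at *
  have n1 : 0 ≤ |gβ| := abs_nonneg _
  have n2 : 0 ≤ |gη| := abs_nonneg _
  have p1 : 0 ≤ h * V * A * m := by positivity
  have p2 : 0 ≤ h * V * B * m := by positivity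
  have p3 : 0 ≤ h * W * B ^ 2 * m := by positivity
  have p4 : 0 ≤ h * V * |gβ| := by positivity
  have p5 : 0 ≤ h * V * |gη| := by positivity
  have p6 : 0 ≤ h * W * B * |gβ| := by positivity
  have p7 : 0 ≤ h * W * B * |gη| := by positivity
  linarith

/-- Weighted interpolation error estimate on a triangle. -/
lemma err_bounds {c c' m : ℝ} {g g' : ℝ × ℝ} (hd1 : d.1 ≠ 0) (hd2 : d.2 ≠ 0)
    (hβ : |d.1| + |d.2| ≤ w.σβ / 8) (hη : |d.1| + |d.2| ≤ w.ση / 8)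
    (hm0 : |aff c g a| ≤ m) (hm1 : |aff c g (a + (d.1, 0))| ≤ m)
    (hm2 : |aff c g (a + (0, d.2))| ≤ m)
    (h0 : w.err c g c' g' a = 0) (h1 : w.err c g c' g' (a + (d.1, 0)) = 0)
    (h2 : w.err c g c' g' (a + (0, d.2)) = 0) {p : ℝ × ℝ} (hp : p ∈ crtri a d) :
    (w.W p)⁻¹ * (w.gradErr c g g' p (dirBeta P)) ^ 2
      + (w.W p)⁻¹ * (w.gradErr c g g' p (dirEta P)) ^ 2
      ≤ 11200 * (|d.1| + |d.2|) ^ 2 * errT w.σβ⁻¹ w.ση⁻¹ (w.V a) (w.W a) m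
          (dot (dirBeta P) g) (dot (dirEta P) g) ∧
    (w.W p)⁻¹ * (w.err c g c' g' p) ^ 2
      ≤ 5600 * (|d.1| + |d.2|) ^ 4 * errT w.σβ⁻¹ w.ση⁻¹ (w.V a) (w.W a) m
          (dot (dirBeta P) g) (dot (dirEta P) g) := by
  set h := |d.1| + |d.2| with hh
  set T := errT w.σβ⁻¹ w.ση⁻¹ (w.V a) (w.W a) m (dot (dirBeta P) g) (dot (dirEta P) g) with hT
  set M := osc w h m a g with hM
  have hMsq : M ^ 2 ≤ w.W a * (700 * h ^ 2 * T) :=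
    sq_osc_le (w.V_pos a).le (by rw [← div_eq_mul_inv]; exact w.V_le a)
  have hsub : ∀ q ∈ crtri a d, |w.gradErr c g g' q (dirBeta P) - w.gradErr c g g' a (dirBeta P)|
      + |w.gradErr c g g' q (dirEta P) - w.gradErr c g g' a (dirEta P)| ≤ M := fun q hq =>
    (near_of_mem_crtri hd1 hd2 hq hβ hη).gradErr_sub
      (abs_aff_le hd1 hd2 hq hm0 hm1 hm2) g'
  have bβ := dirBeta_fst_pos P
  have bβ' := dirBeta_snd_pos P
  have bl := dirBeta_fst_le P
  have bl' := dirBeta_snd_le P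
  have hx : ∀ q, w.gradErr c g g' q (1, 0) = (dirBeta P).1 * w.gradErr c g g' q (dirBeta P)
      + -(dirBeta P).2 * w.gradErr c g g' q (dirEta P) := by
    intro q
    rw [e1_eq P, map_sub, map_smul, map_smul, smul_eq_mul, smul_eq_mul]
    ring
  have hy : ∀ q, w.gradErr c g g' q (0, 1) = (dirBeta P).2 * w.gradErr c g g' q (dirBeta P)
      + (dirBeta P).1 * w.gradErr c g g' q (dirEta P) := by
    intro q; rw [e2_eq P, map_add, map_smul, map_smul]; rfl
  -- Rolle's argument requires the Cartesian directions, whereas the oscillation is known in the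
  -- streamline and crosswind directions. The coefficients of the rotation are at most 1 in modulus,
  -- so the bound `M` on the sum survives.
  have combo : ∀ {s t x y x' y' : ℝ}, |s| ≤ 1 → |t| ≤ 1 → |x - x'| + |y - y'| ≤ M →
      |s * x + t * y - (s * x' + t * y')| ≤ M := by
    intro s t x y x' y' hs ht hxy
    have e : s * x + t * y - (s * x' + t * y') = s * (x - x') + t * (y - y') := by ring
    rw [e]
    refine (abs_add_le _ _).trans (le_trans ?_ hxy)
    rw [abs_mul, abs_mul]
    exact add_le_add (mul_le_of_le_one_left (abs_nonneg _) hs)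
      (mul_le_of_le_one_left (abs_nonneg _) ht)
  obtain ⟨i1, i2, i3⟩ := interp_error hd1 hd2 (w.hasFDerivAt_err c g c' g') h0 h1 h2 (M := M)
    (fun q hq => by
      rw [hx, hx]
      exact combo (by rwa [abs_of_pos bβ]) (by rwa [abs_neg, abs_of_pos bβ']) (hsub q hq))
    (fun q hq => by
      rw [hy, hy]
      exact combo (by rwa [abs_of_pos bβ']) (by rwa [abs_of_pos bβ]) (hsub q hq)) hp
  have hWp := w.W_pos p
  have hWa := w.W_pos a
  have hW2 : (w.W p)⁻¹ ≤ 2 / w.W a := by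
    have := (near_of_mem_crtri hd1 hd2 hp hβ hη).W_ge
    rw [inv_le_comm₀ hWp (by positivity), inv_div]
    exact this
  -- The weight at `p` is frozen at the corner at the cost of a factor 2, and 5600 = 2 · 2² · 700.
  have sq_bound : ∀ {x y : ℝ}, |x| ≤ 2 * M * y →
      (w.W p)⁻¹ * x ^ 2 ≤ 5600 * h ^ 2 * T * y ^ 2 := by
    intro x y hxy
    have h1 : x ^ 2 ≤ (2 * M * y) ^ 2 := by
      rw [← sq_abs x]; exact pow_le_pow_left₀ (abs_nonneg _) hxy 2
    calc (w.W p)⁻¹ * x ^ 2 ≤ 2 / w.W a * (4 * (w.W a * (700 * h ^ 2 * T)) * y ^ 2) := by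
          refine mul_le_mul hW2 (h1.trans ?_) (sq_nonneg _) (by positivity)
          have := mul_le_mul_of_nonneg_right hMsq (sq_nonneg y)
          nlinarith
      _ = _ := by field_simp; ring
  have j1 := sq_bound (x := w.gradErr c g g' p (1, 0)) (y := 1) (by linarith)
  have j2 := sq_bound (x := w.gradErr c g g' p (0, 1)) (y := 1) (by linarith)
  have j3 := sq_bound i3
  constructor
  -- The Euclidean length of the gradient is invariant under the rotation; adding the two Cartesian
  -- bounds gives 11200.
  · have hid : (w.gradErr c g g' p (dirBeta P)) ^ 2 + (w.gradErr c g g' p (dirEta P)) ^ 2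
        = (w.gradErr c g g' p (1, 0)) ^ 2 + (w.gradErr c g g' p (0, 1)) ^ 2 := by
      rw [hx, hy]
      have := dirBeta_sq P
      linear_combination (-(w.gradErr c g g' p (dirBeta P)) ^ 2
        - (w.gradErr c g g' p (dirEta P)) ^ 2) * this
    rw [← mul_add, hid, mul_add]
    linarith
  · refine j3.trans_eq ?_
    ring

end WeightData

end

/-! ### Algebraic bounds of the scaled error term by the energy, for each kind of triangle -/

section

section Algebra

variable {A B V W m gβ gη n κ e : ℝ}

/-- Higher powers of κ are not needed: a single small factor suffices for absorption, so κ³ is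
weakened to κ here and in the next two lemmas. -/
lemma pow_three_le (hA : 0 ≤ A) (hκ0 : 0 ≤ κ) (hκ : κ ≤ 1) (hn : 0 ≤ n) (h : A ≤ κ * n) :
    A ^ 3 ≤ κ * n ^ 3 := by
  have h3 := pow_le_pow_left₀ hA h 3
  have : κ ^ 3 * n ^ 3 ≤ κ * n ^ 3 :=
    mul_le_mul_of_nonneg_right (pow_le_of_le_one hκ0 hκ (by norm_num)) (by positivity)
  rw [mul_pow] at h3
  linarith

lemma pow_two_le (hA : 0 ≤ A) (hκ0 : 0 ≤ κ) (hκ : κ ≤ 1) (h : A ≤ κ * n) :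
    A ^ 2 ≤ κ * n ^ 2 := by
  have h3 := pow_le_pow_left₀ hA h 2
  have : κ ^ 2 * n ^ 2 ≤ κ * n ^ 2 :=
    mul_le_mul_of_nonneg_right (pow_le_of_le_one hκ0 hκ (by norm_num)) (by positivity)
  rw [mul_pow] at h3
  linarith

lemma mul_sq_le (hB : 0 ≤ B) (hκ0 : 0 ≤ κ) (hκ : κ ≤ 1) (hn : 0 ≤ n)
    (h : A ≤ κ * n) (h' : B ≤ κ * n) : A * B ^ 2 ≤ κ * n ^ 3 := by
  have h2 := pow_le_pow_left₀ hB h' 2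
  have h3 := mul_le_mul h h2 (by positivity) (by positivity)
  have : κ ^ 3 * n ^ 3 ≤ κ * n ^ 3 :=
    mul_le_mul_of_nonneg_right (pow_le_of_le_one hκ0 hκ (by norm_num)) (by positivity)
  calc A * B ^ 2 ≤ κ * n * (κ * n) ^ 2 := h3
    _ = κ ^ 3 * n ^ 3 := by ring
    _ ≤ _ := this

lemma errT_le_of_mean (hV : 0 ≤ V) (hW : 0 ≤ W) {S : ℝ} (h1 : A ^ 3 ≤ κ * S)
    (h2 : A * B ^ 2 ≤ κ * S) (h3 : B ^ 4 ≤ κ * S) :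
    errT A B V W m gβ gη ≤ κ * S * (2 * V * m ^ 2 + W * m ^ 2)
      + (V * A + W * B ^ 2) * (gβ ^ 2 + gη ^ 2) := by
  have j1 := mul_le_mul_of_nonneg_left h1 (show 0 ≤ V * m ^ 2 by positivity)
  have j2 := mul_le_mul_of_nonneg_left h2 (show 0 ≤ V * m ^ 2 by positivity)
  have j3 := mul_le_mul_of_nonneg_left h3 (show 0 ≤ W * m ^ 2 by positivity)
  unfold errT
  linarith

/-- The coarse region. -/
lemma errT_le_coarse (hA0 : 0 ≤ A) (hB0 : 0 ≤ B) (hV : 0 ≤ V) (hW : 0 ≤ W) (hVW : V ≤ W * A)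
    (hκ0 : 0 ≤ κ) (hκ : κ ≤ 1) (hn : 0 < n) (hA : A ≤ κ * n) (hB : B ≤ κ * n)
    (hB4 : B ^ 4 ≤ κ * n ^ 3)
    (he : B ^ 2 ≤ κ * n ∨ B ^ 2 ≤ κ * e * n ^ 3) (he0 : 0 ≤ e) (hg : gη ^ 2 ≤ 16 * n ^ 2 * m ^ 2) :
    errT A B V W m gβ gη ≤ κ * n ^ 3 * (18 * V * m ^ 2 + 17 * W * m ^ 2 + 2 / n * W * gβ ^ 2
      + e * W * gη ^ 2) := by
  have hT := errT_le_of_mean (m := m) (gβ := gβ) (gη := gη) hV hW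
    (pow_three_le hA0 hκ0 hκ hn.le hA) (mul_sq_le hB0 hκ0 hκ hn.le hA hB) hB4
  have hA2 := pow_two_le hA0 hκ0 hκ hA
  have hB2 := pow_two_le hB0 hκ0 hκ hB
  have t1 : V * A ≤ W * (κ * n ^ 2) := by
    calc V * A ≤ W * A * A := mul_le_mul_of_nonneg_right hVW hA0
      _ = W * A ^ 2 := by ring
      _ ≤ _ := mul_le_mul_of_nonneg_left hA2 hW
  have t2 := mul_le_mul_of_nonneg_left hB2 hW
  have t3 : (V * A + W * B ^ 2) * gβ ^ 2 ≤ (W * (κ * n ^ 2) + W * (κ * n ^ 2)) * gβ ^ 2 :=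
    mul_le_mul_of_nonneg_right (add_le_add t1 t2) (sq_nonneg _)
  have t4 : V * A * gη ^ 2 ≤ V * (κ * n) * (16 * n ^ 2 * m ^ 2) :=
    mul_le_mul (mul_le_mul_of_nonneg_left hA hV) hg (sq_nonneg _) (by positivity)
  -- The two regimes of the crosswind diffusion on the coarse region: if it is tiny, the crosswind
  -- derivative is removed by the inverse inequality `hg`; otherwise it is kept and charged to the
  -- crosswind diffusion.
  have t5 : W * B ^ 2 * gη ^ 2 ≤ κ * n ^ 3 * (16 * W * m ^ 2) + κ * n ^ 3 * (e * W * gη ^ 2) := by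
    have p1 : 0 ≤ κ * n ^ 3 * (16 * W * m ^ 2) := by positivity
    have p2 : 0 ≤ κ * n ^ 3 * (e * W * gη ^ 2) := by positivity
    rcases he with he | he
    · have : W * B ^ 2 * gη ^ 2 ≤ W * (κ * n) * (16 * n ^ 2 * m ^ 2) :=
        mul_le_mul (mul_le_mul_of_nonneg_left he hW) hg (sq_nonneg _) (by positivity)
      linarith
    · have : W * B ^ 2 * gη ^ 2 ≤ W * (κ * e * n ^ 3) * gη ^ 2 :=
        mul_le_mul_of_nonneg_right (mul_le_mul_of_nonneg_left he hW) (sq_nonneg _)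
      linarith
  have t6 : κ * n ^ 3 * (2 / n * W * gβ ^ 2) = (W * (κ * n ^ 2) + W * (κ * n ^ 2)) * gβ ^ 2 := by
    field_simp; ring
  linarith

/-- A layer triangle with a leg of length comparable with `1 / n`. -/
lemma errT_le_edge {Γ : ℝ} (hA0 : 0 ≤ A) (hB0 : 0 ≤ B) (hV : 0 ≤ V) (hW : 0 ≤ W)
    (hVW : V ≤ W * A)
    (hκ0 : 0 ≤ κ) (hκ : κ ≤ 1) (hn : 0 < n) (hA : A ≤ κ * n) (hB : B ≤ κ * n)
    (hB4 : B ^ 4 ≤ κ * n ^ 3) (he0 : 0 ≤ e) (hen : e * n ≤ 1) (heB : e * B ^ 2 ≤ κ) (hΓ : 0 ≤ Γ)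
    (hg : gβ ^ 2 ≤ Γ * (gη ^ 2 + n ^ 2 * m ^ 2)) :
    e * errT A B V W m gβ gη ≤ κ * n ^ 2 * ((2 + Γ) * V * m ^ 2 + (1 + Γ) * W * m ^ 2
      + 2 * (1 + Γ) * (e * W * gη ^ 2)) := by
  have hT := errT_le_of_mean (m := m) (gβ := gβ) (gη := gη) hV hW
    (pow_three_le hA0 hκ0 hκ hn.le hA) (mul_sq_le hB0 hκ0 hκ hn.le hA hB) hB4
  have hA2 := pow_two_le hA0 hκ0 hκ hA
  have hB2 := pow_two_le hB0 hκ0 hκ hB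
  have t1 : V * A ≤ W * (κ * n ^ 2) := by
    calc V * A ≤ W * A * A := mul_le_mul_of_nonneg_right hVW hA0
      _ = W * A ^ 2 := by ring
      _ ≤ _ := mul_le_mul_of_nonneg_left hA2 hW
  have t2 := mul_le_mul_of_nonneg_left hB2 hW
  have t3 : (V * A + W * B ^ 2) * gη ^ 2 ≤ (W * (κ * n ^ 2) + W * (κ * n ^ 2)) * gη ^ 2 :=
    mul_le_mul_of_nonneg_right (add_le_add t1 t2) (sq_nonneg _)
  have hX : 0 ≤ V * A + W * B ^ 2 := by positivity
  -- The streamline derivative cannot be charged to the energy, which contains it with the factor ε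
  -- only. One coarse leg allows trading it for the crosswind derivative and the nodal values.
  have t4 : (V * A + W * B ^ 2) * gβ ^ 2
      ≤ (V * A + W * B ^ 2) * (Γ * (gη ^ 2 + n ^ 2 * m ^ 2)) := mul_le_mul_of_nonneg_left hg hX
  have t5 := mul_le_mul_of_nonneg_left t3 (mul_nonneg he0 (show 0 ≤ 1 + Γ by linarith))
  have t6 := mul_le_mul_of_nonneg_left t4 he0
  have t7 := mul_le_mul_of_nonneg_left hT he0
  have t8 : e * n * (κ * n ^ 2 * (2 * V * m ^ 2 + W * m ^ 2))
      ≤ 1 * (κ * n ^ 2 * (2 * V * m ^ 2 + W * m ^ 2)) :=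
    mul_le_mul_of_nonneg_right hen (by positivity)
  have t9 : e * A ≤ κ := by
    calc e * A ≤ e * (κ * n) := mul_le_mul_of_nonneg_left hA he0
      _ = κ * (e * n) := by ring
      _ ≤ κ * 1 := mul_le_mul_of_nonneg_left hen hκ0
      _ = κ := mul_one κ
  have t10 : (e * A) * (V * Γ * n ^ 2 * m ^ 2) ≤ κ * (V * Γ * n ^ 2 * m ^ 2) :=
    mul_le_mul_of_nonneg_right t9 (by positivity)
  have t11 : (e * B ^ 2) * (W * Γ * n ^ 2 * m ^ 2) ≤ κ * (W * Γ * n ^ 2 * m ^ 2) :=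
    mul_le_mul_of_nonneg_right heB (by positivity)
  linarith

/-- A layer triangle with two short legs. -/
lemma errT_le_corner {h Γ ε L : ℝ} (hA0 : 0 ≤ A) (hB0 : 0 ≤ B) (hV : 0 ≤ V) (hW : 0 ≤ W)
    (hVW : V ≤ W * A)
    (hκ0 : 0 ≤ κ) (hκ : κ ≤ 1) (hn : 0 < n) (hA : A ≤ κ * n) (hB : B ≤ κ * n)
    (hB4 : B ^ 4 ≤ κ * n ^ 3) (he0 : 0 ≤ e) (hen : e * n ≤ 1) (he1 : e ≤ 1)
    (hh0 : 0 ≤ h) (hh : h * n ≤ 4)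
    (hhf : h * n ≤ Γ * (ε * L)) (hε0 : 0 ≤ ε) (hε1 : ε ≤ 1) (hLA : L * A ≤ κ * n)
    (hL0 : 0 ≤ L) (hLB : L * B ≤ κ * n) :
    e * h ^ 2 * errT A B V W m gβ gη ≤ κ * (32 * V * m ^ 2 + 16 * W * m ^ 2
      + 2 * Γ ^ 2 * (ε * W * gβ ^ 2 + e * W * gη ^ 2)) := by
  have hT := errT_le_of_mean (m := m) (gβ := gβ) (gη := gη) hV hW
    (pow_three_le hA0 hκ0 hκ hn.le hA) (mul_sq_le hB0 hκ0 hκ hn.le hA hB) hB4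
  have hT' := mul_le_mul_of_nonneg_left hT (show 0 ≤ e * h ^ 2 by positivity)
  have hh2 : (h * n) ^ 2 ≤ 16 := by nlinarith [mul_nonneg hh0 hn.le]
  have hh3 : (h * n) ^ 2 ≤ (Γ * (ε * L)) ^ 2 :=
    pow_le_pow_left₀ (mul_nonneg hh0 hn.le) hhf 2
  have s1 : (e * n) * (h * n) ^ 2 ≤ 1 * 16 := mul_le_mul hen hh2 (by positivity) (by norm_num)
  have s2 := mul_le_mul_of_nonneg_right s1
    (show 0 ≤ κ * (2 * V * m ^ 2 + W * m ^ 2) by positivity)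
  have hA2 := pow_two_le (mul_nonneg hL0 hA0) hκ0 hκ hLA
  have hB2 := pow_two_le (mul_nonneg hL0 hB0) hκ0 hκ hLB
  have t1 : V * A ≤ W * A ^ 2 := by
    calc V * A ≤ W * A * A := mul_le_mul_of_nonneg_right hVW hA0
      _ = _ := by ring
  -- Both legs being short, `h * n` is of order εL. The logarithm is absorbed by the bounds of `L *
  -- A` and `L * B`, and the remaining ε² lets both derivatives be charged to the diffusion.
  have t2 : h ^ 2 * (V * A + W * B ^ 2) ≤ 2 * κ * Γ ^ 2 * ε ^ 2 * W := by
    have : h ^ 2 * n ^ 2 * (V * A + W * B ^ 2) ≤ 2 * κ * Γ ^ 2 * ε ^ 2 * W * n ^ 2 := by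
      calc h ^ 2 * n ^ 2 * (V * A + W * B ^ 2) ≤ h ^ 2 * n ^ 2 * (W * A ^ 2 + W * B ^ 2) := by
            gcongr
        _ = (h * n) ^ 2 * (W * A ^ 2 + W * B ^ 2) := by ring
        _ ≤ (Γ * (ε * L)) ^ 2 * (W * A ^ 2 + W * B ^ 2) := by gcongr
        _ = Γ ^ 2 * ε ^ 2 * W * ((L * A) ^ 2 + (L * B) ^ 2) := by ring
        _ ≤ Γ ^ 2 * ε ^ 2 * W * (κ * n ^ 2 + κ * n ^ 2) := by gcongr
        _ = _ := by ring
    have hn2 : 0 < n ^ 2 := by positivity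
    refine le_of_mul_le_mul_right ?_ hn2
    linarith
  have t3 := mul_le_mul_of_nonneg_right t2 (show 0 ≤ e * (gβ ^ 2 + gη ^ 2) by positivity)
  have w1 : ε ^ 2 ≤ ε := pow_le_of_le_one hε0 hε1 (by norm_num)
  have u1 : e * ε ^ 2 ≤ ε := (mul_le_of_le_one_left (sq_nonneg ε) he1).trans w1
  have u2 : e * ε ^ 2 ≤ e := mul_le_of_le_one_right he0 (w1.trans hε1)
  have v1 := mul_le_mul_of_nonneg_left u1 (show 0 ≤ 2 * κ * Γ ^ 2 * W * gβ ^ 2 by positivity)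
  have v2 := mul_le_mul_of_nonneg_left u2 (show 0 ≤ 2 * κ * Γ ^ 2 * W * gη ^ 2 by positivity)
  linarith

/-- The logarithmic multiple of the gradient term in the layers. -/
lemma errT_le_log {ε L : ℝ} (hA0 : 0 ≤ A) (hB0 : 0 ≤ B) (hV : 0 ≤ V) (hW : 0 ≤ W)
    (hVW : V ≤ W * A)
    (hκ0 : 0 ≤ κ) (hκ : κ ≤ 1) (hn : 0 < n) (hε0 : 0 ≤ ε) (hεn : ε * n ≤ 1)
    (hL : 1 / 2 ≤ L) (hLA : L * A ≤ κ * n) (hLB : L * B ≤ κ * n)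
    (hB4 : ε * L ^ 2 * B ^ 4 ≤ κ * n ^ 2) (heε : ε ≤ e) :
    ε * L ^ 2 * errT A B V W m gβ gη ≤ κ * n ^ 2 * (4 * V * m ^ 2 + W * m ^ 2
      + 2 * (ε * W * gβ ^ 2 + e * W * gη ^ 2)) := by
  have hL0 : 0 ≤ L := by linarith
  have h1 := pow_three_le (mul_nonneg hL0 hA0) hκ0 hκ hn.le hLA
  have h2 := mul_sq_le (mul_nonneg hL0 hB0) hκ0 hκ hn.le hLA hLB
  have hA2 := pow_two_le (mul_nonneg hL0 hA0) hκ0 hκ hLA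
  have hB2 := pow_two_le (mul_nonneg hL0 hB0) hκ0 hκ hLB
  -- The assumptions control cubes with L³; one power of `L` is given away through 1 ≤ 2L, and one
  -- power of `n` is removed by `ε * n ≤ 1`.
  have aux : ∀ {x : ℝ}, 0 ≤ x → L ^ 3 * x ≤ κ * n ^ 3 → ε * L ^ 2 * x ≤ 2 * κ * n ^ 2 := by
    intro x hx hle
    have e1 : L ^ 2 * x ≤ 2 * (L ^ 3 * x) := by
      have : L ^ 2 * x * 1 ≤ L ^ 2 * x * (2 * L) :=
        mul_le_mul_of_nonneg_left (by linarith) (by positivity)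
      linarith
    calc ε * L ^ 2 * x = ε * (L ^ 2 * x) := by ring
      _ ≤ ε * (2 * (κ * n ^ 3)) := mul_le_mul_of_nonneg_left (by linarith) hε0
      _ = ε * n * (2 * κ * n ^ 2) := by ring
      _ ≤ 1 * (2 * κ * n ^ 2) := mul_le_mul_of_nonneg_right hεn (by positivity)
      _ = _ := one_mul _
  have s1 := aux (x := A ^ 3) (by positivity) (by linarith [mul_pow L A 3])
  have s2 := aux (x := A * B ^ 2) (by positivity)
    (by calc L ^ 3 * (A * B ^ 2) = L * A * (L * B) ^ 2 := by ring
          _ ≤ _ := h2)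
  have t1 := mul_le_mul_of_nonneg_left s1 (show 0 ≤ V * m ^ 2 by positivity)
  have t2 := mul_le_mul_of_nonneg_left s2 (show 0 ≤ V * m ^ 2 by positivity)
  have t3 := mul_le_mul_of_nonneg_left hB4 (show 0 ≤ W * m ^ 2 by positivity)
  have u1 : L ^ 2 * (V * A + W * B ^ 2) ≤ 2 * κ * n ^ 2 * W := by
    have : V * A ≤ W * A ^ 2 := by
      calc V * A ≤ W * A * A := mul_le_mul_of_nonneg_right hVW hA0
        _ = _ := by ring
    calc L ^ 2 * (V * A + W * B ^ 2) ≤ L ^ 2 * (W * A ^ 2 + W * B ^ 2) := by gcongr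
      _ = W * ((L * A) ^ 2 + (L * B) ^ 2) := by ring
      _ ≤ W * (κ * n ^ 2 + κ * n ^ 2) := by gcongr
      _ = _ := by ring
  have u2 := mul_le_mul_of_nonneg_right u1 (show 0 ≤ ε * (gβ ^ 2 + gη ^ 2) by positivity)
  have u3 := mul_le_mul_of_nonneg_left heε (show 0 ≤ 2 * κ * n ^ 2 * W * gη ^ 2 by positivity)
  unfold errT
  linarith

end Algebra

end

/-! ### Energy density and interpolation error on a triangle of the mesh -/

section

variable {P : Coeff} {D : Discr}

lemma dd_eq_of_eqOn {U : Set (ℝ × ℝ)} (hU : IsOpen U) {f g : ℝ × ℝ → ℝ} (hfg : EqOn f g U)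
    {p : ℝ × ℝ} (hp : p ∈ U) {g' : ℝ × ℝ →L[ℝ] ℝ} (hg : HasFDerivAt g g' p) (ζ : ℝ × ℝ) :
    dd ζ f p = g' ζ := by
  rw [dd, (hfg.eventuallyEq_of_mem (hU.mem_nhds hp)).fderiv_eq, hg.fderiv]

namespace WeightData

variable (w : WeightData P) (hD : Admissible P D)

/-- The interpolation error of the product of a finite element function and the reciprocal
weight. -/
def errE (f : ℝ × ℝ → ℝ) (p : ℝ × ℝ) : ℝ :=
  w.W p * fem hD f p - fem hD (fun q => w.W q * fem hD f q) p

end WeightData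

namespace Grid

variable {N : ℕ} (X Y : Grid N)

/-- On a mesh triangle the interpolant coincides with an affine function. -/
lemma exists_aff (f : ℝ × ℝ → ℝ) {τ : ℕ × ℕ × Bool} (hτ : τ ∈ pieces N) :
    ∃ c g, ∀ p ∈ crtri (anchor X Y τ) (legs X Y τ), interp X Y f p = aff c g p := by
  set a := anchor X Y τ
  set d := legs X Y τ
  refine ⟨f a - a.1 / d.1 * (f (a + (d.1, 0)) - f a) - a.2 / d.2 * (f (a + (0, d.2)) - f a),
    ((f (a + (d.1, 0)) - f a) / d.1, (f (a + (0, d.2)) - f a) / d.2), fun p hp => ?_⟩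
  rw [interp_crtri X Y f hτ hp]
  simp only [aff, dot]
  ring

lemma interp_anchor (f : ℝ × ℝ → ℝ) {τ : ℕ × ℕ × Bool} (hτ : τ ∈ pieces N) :
    interp X Y f (anchor X Y τ) = f (anchor X Y τ) := by
  rw [interp_crtri X Y f hτ (anchor_mem_crtri _ _)]; simp

lemma interp_fst (f : ℝ × ℝ → ℝ) {τ : ℕ × ℕ × Bool} (hτ : τ ∈ pieces N) :
    interp X Y f (anchor X Y τ + ((legs X Y τ).1, 0))
      = f (anchor X Y τ + ((legs X Y τ).1, 0)) := by
  have h := legs_fst_ne X Y hτ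
  rw [interp_crtri X Y f hτ (fst_mem_crtri h)]; simp [h]

lemma interp_snd (f : ℝ × ℝ → ℝ) {τ : ℕ × ℕ × Bool} (hτ : τ ∈ pieces N) :
    interp X Y f (anchor X Y τ + (0, (legs X Y τ).2))
      = f (anchor X Y τ + (0, (legs X Y τ).2)) := by
  have h := legs_snd_ne X Y hτ
  rw [interp_crtri X Y f hτ (snd_mem_crtri h)]; simp [h]

end Grid

section PieceData

variable (w : WeightData P) (hD : Admissible P D)

/-- The anchor of a triangle of the Shishkin mesh. -/
def anc (τ : ℕ × ℕ × Bool) : ℝ × ℝ := (gridX hD).anchor (gridY hD) τ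

/-- The legs of a triangle of the Shishkin mesh. -/
def leg (τ : ℕ × ℕ × Bool) : ℝ × ℝ := (gridX hD).legs (gridY hD) τ

/-- The open triangles of the Shishkin mesh. -/
def tria (τ : ℕ × ℕ × Bool) : Set (ℝ × ℝ) := rtri (anc hD τ) (leg hD τ)

lemma tria_subset_Omega {τ : ℕ × ℕ × Bool} (hτ : τ ∈ Grid.pieces D.N) : tria hD τ ⊆ Omega :=
  Grid.piece_subset_Omega _ _ hτ

lemma isOpen_tria (τ : ℕ × ℕ × Bool) : IsOpen (tria hD τ) := isOpen_rtri _ _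

lemma volume_tria_ne_top {τ : ℕ × ℕ × Bool} (hτ : τ ∈ Grid.pieces D.N) :
    volume (tria hD τ) ≠ ⊤ :=
  ne_top_of_le_ne_top volume_Omega_lt_top.ne (measure_mono (tria_subset_Omega hD hτ))

lemma integral_eq_sum_tria {f : ℝ × ℝ → ℝ} (hf : BM f) :
    ∫ p in Omega, f p = ∑ τ ∈ Grid.pieces D.N, ∫ p in tria hD τ, f p :=
  Grid.integral_eq_sum _ _ hD.pos hf.integrableOn

/-- The energy density with constant coefficients. -/
def wdens (w : WeightData P) (e₁ e₂ α γ : ℝ) (G : ℝ × ℝ → ℝ) (p : ℝ × ℝ) : ℝ :=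
  e₁ * w.W p * dd (dirBeta P) G p ^ 2 + e₂ * w.W p * dd (dirEta P) G p ^ 2
    + α * w.V p * G p ^ 2 + γ * w.W p * G p ^ 2

lemma bm_wdens (w : WeightData P) (e₁ e₂ α γ : ℝ) {G : ℝ × ℝ → ℝ} (hG : Lip G) :
    BM (wdens w e₁ e₂ α γ G) := by
  have hW := BM.of_continuous w.continuous_W
  have hV := BM.of_continuous w.continuous_V
  have h1 := hG.bm.sq
  have hβ := (BM.dd_of_lip (dirBeta P) hG).sq
  have hη := (BM.dd_of_lip (dirEta P) hG).sq
  exact ((((((BM.const e₁).mul hW).mul hβ).add (((BM.const e₂).mul hW).mul hη)).add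
    (((BM.const α).mul hV).mul h1)).add (((BM.const γ).mul hW).mul h1))

lemma lip_fem (f : ℝ × ℝ → ℝ) : Lip (fem hD f) := Grid.lip_interp _ _ f

/-- The local information on a finite element function and its weighted interpolation error. -/
lemma exists_piece_data (f : ℝ × ℝ → ℝ) {τ : ℕ × ℕ × Bool} (hτ : τ ∈ Grid.pieces D.N)
    (hβ : |(leg hD τ).1| + |(leg hD τ).2| ≤ w.σβ / 8)
    (hη : |(leg hD τ).1| + |(leg hD τ).2| ≤ w.ση / 8) :
    ∃ m g, 0 ≤ m ∧ |fem hD f (anc hD τ)| ≤ m ∧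
      g.1 * (leg hD τ).1 = fem hD f (anc hD τ + ((leg hD τ).1, 0)) - fem hD f (anc hD τ) ∧
      g.2 * (leg hD τ).2 = fem hD f (anc hD τ + (0, (leg hD τ).2)) - fem hD f (anc hD τ) ∧
      |g.1| * |(leg hD τ).1| ≤ 2 * m ∧ |g.2| * |(leg hD τ).2| ≤ 2 * m ∧
      (∀ p ∈ tria hD τ,
        (w.W p)⁻¹ * dd (dirBeta P) (w.errE hD f) p ^ 2
          + (w.W p)⁻¹ * dd (dirEta P) (w.errE hD f) p ^ 2
        ≤ 11200 * (|(leg hD τ).1| + |(leg hD τ).2|) ^ 2 * errT w.σβ⁻¹ w.ση⁻¹ (w.V (anc hD τ))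
            (w.W (anc hD τ)) m (dot (dirBeta P) g) (dot (dirEta P) g) ∧
        (w.W p)⁻¹ * w.errE hD f p ^ 2
        ≤ 5600 * (|(leg hD τ).1| + |(leg hD τ).2|) ^ 4 * errT w.σβ⁻¹ w.ση⁻¹ (w.V (anc hD τ))
            (w.W (anc hD τ)) m (dot (dirBeta P) g) (dot (dirEta P) g)) ∧
      ∀ e₁ e₂ α γ : ℝ, 0 ≤ e₁ → 0 ≤ e₂ → 0 ≤ α → 0 ≤ γ →
        volume.real (tria hD τ) * (e₁ * w.W (anc hD τ) * dot (dirBeta P) g ^ 2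
          + e₂ * w.W (anc hD τ) * dot (dirEta P) g ^ 2
          + (α * w.V (anc hD τ) + γ * w.W (anc hD τ)) * m ^ 2)
        ≤ 128 * ∫ p in tria hD τ, wdens w e₁ e₂ α γ (fem hD f) p := by
  have hd1 : (leg hD τ).1 ≠ 0 := Grid.legs_fst_ne _ _ hτ
  have hd2 : (leg hD τ).2 ≠ 0 := Grid.legs_snd_ne _ _ hτ
  obtain ⟨c, g, hG⟩ := Grid.exists_aff (gridX hD) (gridY hD) f hτ
  obtain ⟨c', g', hJ⟩ := Grid.exists_aff (gridX hD) (gridY hD) (fun q => w.W q * fem hD f q) hτ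
  have hJ0 := Grid.interp_anchor (gridX hD) (gridY hD) (fun q => w.W q * fem hD f q) hτ
  have hJ1 := Grid.interp_fst (gridX hD) (gridY hD) (fun q => w.W q * fem hD f q) hτ
  have hJ2 := Grid.interp_snd (gridX hD) (gridY hD) (fun q => w.W q * fem hD f q) hτ
  change ∀ p ∈ crtri (anc hD τ) (leg hD τ), fem hD f p = aff c g p at hG
  change ∀ p ∈ crtri (anc hD τ) (leg hD τ), fem hD (fun q => w.W q * fem hD f q) p = aff c' g' p
    at hJ
  change fem hD (fun q => w.W q * fem hD f q) (anc hD τ) = w.W (anc hD τ) * fem hD f (anc hD τ)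
    at hJ0
  change fem hD (fun q => w.W q * fem hD f q) (anc hD τ + ((leg hD τ).1, 0))
    = w.W (anc hD τ + ((leg hD τ).1, 0)) * fem hD f (anc hD τ + ((leg hD τ).1, 0)) at hJ1
  change fem hD (fun q => w.W q * fem hD f q) (anc hD τ + (0, (leg hD τ).2))
    = w.W (anc hD τ + (0, (leg hD τ).2)) * fem hD f (anc hD τ + (0, (leg hD τ).2)) at hJ2
  have hUV := tria_subset_Omega hD hτ
  unfold tria at *
  set a := anc hD τ with ha
  set d := leg hD τ with hd
  have m0 := anchor_mem_crtri a d
  have m1 : a + (d.1, 0) ∈ crtri a d := fst_mem_crtri hd1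
  have m2 : a + (0, d.2) ∈ crtri a d := snd_mem_crtri hd2
  have hfin : volume (rtri a d) ≠ ⊤ := volume_tria_ne_top hD hτ
  have hU := (isOpen_rtri a d).measurableSet
  have hLint : IntegrableOn (fun p => aff c g p ^ 2) (rtri a d) :=
    ((BM.of_continuous (continuous_aff c g)).sq.integrableOn).mono_set hUV
  obtain ⟨m, hm, b0, b1, b2, hsq⟩ := exists_vertex_bound hd1 hd2 c g hfin hLint
  have hGU : EqOn (fem hD f) (aff c g) (rtri a d) :=
    fun p hp => hG p (rtri_subset_crtri a d hp)
  have hEU : EqOn (w.errE hD f) (w.err c g c' g') (rtri a d) := fun p hp => by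
    have hp' := rtri_subset_crtri a d hp
    rw [WeightData.errE, WeightData.err, hG p hp', hJ p hp']
  have hgζ : ∀ p ∈ rtri a d, ∀ ζ, dd ζ (fem hD f) p = dot ζ g := fun p hp ζ => by
    rw [dd_eq_of_eqOn (isOpen_rtri a d) hGU hp (hasFDerivAt_aff c g p), dotL_apply]
  have hEζ : ∀ p ∈ rtri a d, ∀ ζ, dd ζ (w.errE hD f) p = w.gradErr c g g' p ζ := fun p hp ζ =>
    dd_eq_of_eqOn (isOpen_rtri a d) hEU hp (w.hasFDerivAt_err c g c' g' p) ζ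
  have ex : aff c g (a + (d.1, 0)) - aff c g a = g.1 * d.1 := by
    rw [aff_sub]; simp [dot, mul_comm]
  have ey : aff c g (a + (0, d.2)) - aff c g a = g.2 * d.2 := by
    rw [aff_sub]; simp [dot, mul_comm]
  have tri : ∀ x y : ℝ, |x| ≤ m → |y| ≤ m → |x - y| ≤ 2 * m := fun x y hx hy =>
    (abs_sub x y).trans (by linarith)
  refine ⟨m, g, hm, ?_, ?_, ?_, ?_, ?_, ?_, ?_⟩
  · rw [hG a m0]; exact b0
  · rw [hG _ m1, hG _ m0, ex]
  · rw [hG _ m2, hG _ m0, ey]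
  · rw [← abs_mul, ← ex]; exact tri _ _ b1 b0
  · rw [← abs_mul, ← ey]; exact tri _ _ b2 b0
  · intro p hp
    rw [hEζ p hp, hEζ p hp, hEU hp]
    refine WeightData.err_bounds hd1 hd2 hβ hη b0 b1 b2 ?_ ?_ ?_ (rtri_subset_crtri a d hp)
    · rw [WeightData.err, ← hG _ m0, ← hJ _ m0, hJ0, sub_self]
    · rw [WeightData.err, ← hG _ m1, ← hJ _ m1, hJ1, sub_self]
    · rw [WeightData.err, ← hG _ m2, ← hJ _ m2, hJ2, sub_self]
  · intro e₁ e₂ α γ he1 he2 hα hγ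
    -- Freezing `W` and `V` at the corner costs a factor 2; together with the 64 of the vertex bound
    -- this yields 128.
    have hlow : ∀ p ∈ rtri a d,
        (e₁ * w.W a * dot (dirBeta P) g ^ 2 + e₂ * w.W a * dot (dirEta P) g ^ 2) / 2
          + (α * w.V a + γ * w.W a) / 2 * aff c g p ^ 2 ≤ wdens w e₁ e₂ α γ (fem hD f) p := by
      intro p hp
      have hn := WeightData.near_of_mem_crtri (w := w) hd1 hd2 (rtri_subset_crtri a d hp) hβ hη
      have hW := hn.W_ge
      have hV := hn.V_ge
      unfold wdens
      rw [hgζ p hp, hgζ p hp, hGU hp]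
      have i1 := mul_le_mul_of_nonneg_left hW
        (show 0 ≤ e₁ * dot (dirBeta P) g ^ 2 by positivity)
      have i2 := mul_le_mul_of_nonneg_left hW
        (show 0 ≤ e₂ * dot (dirEta P) g ^ 2 by positivity)
      have i3 := mul_le_mul_of_nonneg_left hV (show 0 ≤ α * aff c g p ^ 2 by positivity)
      have i4 := mul_le_mul_of_nonneg_left hW (show 0 ≤ γ * aff c g p ^ 2 by positivity)
      linarith
    have hic : IntegrableOn (fun _ : ℝ × ℝ =>
        (e₁ * w.W a * dot (dirBeta P) g ^ 2 + e₂ * w.W a * dot (dirEta P) g ^ 2) / 2)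
        (rtri a d) := integrableOn_const hfin
    have hil := hLint.const_mul ((α * w.V a + γ * w.W a) / 2)
    have hint := setIntegral_mono_on (μ := volume) (hic.add hil)
      ((bm_wdens w e₁ e₂ α γ (lip_fem hD f)).integrableOn.mono_set hUV) hU hlow
    simp only [Pi.add_apply] at hint
    rw [integral_add hic hil, setIntegral_const, integral_const_mul, smul_eq_mul] at hint
    have hα' : 0 ≤ α * w.V a + γ * w.W a := by
      have := w.V_pos a
      have := w.W_pos a
      positivity
    have := mul_le_mul_of_nonneg_left hsq hα'
    have hvol : 0 ≤ volume.real (rtri a d) := measureReal_nonneg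
    have hW0 := w.W_pos a
    have n1 : 0 ≤ volume.real (rtri a d) * (e₁ * w.W a * dot (dirBeta P) g ^ 2) := by positivity
    have n2 : 0 ≤ volume.real (rtri a d) * (e₂ * w.W a * dot (dirEta P) g ^ 2) := by positivity
    linarith

end PieceData

end

/-! ### Conditions on the weight, mesh widths, and the local estimate in the coarse region -/

section

variable {P : Coeff} {D : Discr}

/-- The conditions on the weight parameters in terms of a small number `κ`. -/
structure WeightData.Cond (w : WeightData P) (D : Discr) (κ : ℝ) : Prop where
  κ0 : 0 ≤ κ
  κ1 : κ ≤ 1 / 32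
  hA : w.σβ⁻¹ ≤ κ * D.N
  hB : w.ση⁻¹ ≤ κ * D.N
  hB4 : w.ση⁻¹ ^ 4 ≤ κ * (D.N : ℝ) ^ 3
  hs : w.ση⁻¹ ^ 2 ≤ κ * D.N ∨ w.ση⁻¹ ^ 2 ≤ κ * D.εs * (D.N : ℝ) ^ 3
  hf : D.εf * w.ση⁻¹ ^ 2 ≤ κ
  hs' : D.εs * w.ση⁻¹ ^ 2 ≤ κ
  hε : D.ε * w.σβ⁻¹ ≤ κ
  hδ : P.Cstar / D.N * w.σβ⁻¹ ≤ κ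
  hLA : Real.log D.N * w.σβ⁻¹ ≤ κ * D.N
  hLB : Real.log D.N * w.ση⁻¹ ≤ κ * D.N
  hL4 : D.ε * Real.log D.N ^ 2 * w.ση⁻¹ ^ 4 ≤ κ * (D.N : ℝ) ^ 2

section Geometry

variable (hD : Admissible P D)

lemma abs_leg_fst {τ : ℕ × ℕ × Bool} (hτ : τ ∈ Grid.pieces D.N) :
    |(leg hD τ).1| = meshX P D (τ.1 + 1) - meshX P D τ.1 := by
  have : meshX P D τ.1 < meshX P D (τ.1 + 1) := (gridX hD).lt τ.1 (Grid.mem_pieces.mp hτ).1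
  unfold leg Grid.legs
  split_ifs
  · exact (abs_of_neg (sub_neg.mpr this)).trans (neg_sub _ _)
  · exact abs_of_pos (sub_pos.mpr this)

lemma abs_leg_snd {τ : ℕ × ℕ × Bool} (hτ : τ ∈ Grid.pieces D.N) :
    |(leg hD τ).2| = meshY P D (τ.2.1 + 1) - meshY P D τ.2.1 := by
  have : meshY P D τ.2.1 < meshY P D (τ.2.1 + 1) := (gridY hD).lt τ.2.1 (Grid.mem_pieces.mp hτ).2
  unfold leg Grid.legs
  split_ifs
  · exact (abs_of_neg (sub_neg.mpr this)).trans (neg_sub _ _)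
  · exact abs_of_pos (sub_pos.mpr this)

-- The widths are 2(1 - λ)/N and 2λ/N. As λ ≤ 1/2, the coarse one is at least 1/N and neither
-- exceeds 2/N.
include hD in
lemma step_bounds {lam : ℝ} (h0 : 0 < lam) (h1 : lam ≤ 1 / 2) (i : ℕ) :
    (meshPoint lam D.N (i + 1) - meshPoint lam D.N i) * D.N ≤ 2 ∧
    (2 * (i + 1) ≤ D.N → 1 ≤ (meshPoint lam D.N (i + 1) - meshPoint lam D.N i) * D.N) ∧
    (D.N ≤ 2 * i → (meshPoint lam D.N (i + 1) - meshPoint lam D.N i) * D.N = 2 * lam) := by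
  have hN := hD.cast_pos
  rcases lt_or_ge_of_even hD.even i with h | h
  · rw [meshPoint_succ_sub_of_lt h, div_mul_cancel₀ _ hN.ne']
    exact ⟨by linarith, fun _ => by linarith, fun h' => by omega⟩
  · rw [meshPoint_succ_sub_of_ge hD.pos h, div_mul_cancel₀ _ hN.ne']
    exact ⟨by linarith, fun h' => by omega, fun _ => rfl⟩

lemma leg_fst_bounds {τ : ℕ × ℕ × Bool} (hτ : τ ∈ Grid.pieces D.N) :
    |(leg hD τ).1| * D.N ≤ 2 ∧ (2 * (τ.1 + 1) ≤ D.N → 1 ≤ |(leg hD τ).1| * D.N) ∧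
    (D.N ≤ 2 * τ.1 → |(leg hD τ).1| * D.N = 2 * lamX P D) := by
  rw [abs_leg_fst hD hτ]
  exact step_bounds hD hD.lamX_pos hD.lamX_le τ.1

lemma leg_snd_bounds {τ : ℕ × ℕ × Bool} (hτ : τ ∈ Grid.pieces D.N) :
    |(leg hD τ).2| * D.N ≤ 2 ∧ (2 * (τ.2.1 + 1) ≤ D.N → 1 ≤ |(leg hD τ).2| * D.N) ∧
    (D.N ≤ 2 * τ.2.1 → |(leg hD τ).2| * D.N = 2 * lamY P D) := by
  rw [abs_leg_snd hD hτ]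
  exact step_bounds hD hD.lamY_pos hD.lamY_le τ.2.1

lemma tria_bounds {τ : ℕ × ℕ × Bool} (hτ : τ ∈ Grid.pieces D.N) {p : ℝ × ℝ} (hp : p ∈ tria hD τ) :
    p.1 ∈ Ioo (meshX P D τ.1) (meshX P D (τ.1 + 1)) ∧
    p.2 ∈ Ioo (meshY P D τ.2.1) (meshY P D (τ.2.1 + 1)) := Grid.piece_subset _ _ hτ hp

lemma tria_subset_OmegaS {τ : ℕ × ℕ × Bool} (hτ : τ ∈ Grid.pieces D.N)
    (h1 : 2 * (τ.1 + 1) ≤ D.N) (h2 : 2 * (τ.2.1 + 1) ≤ D.N) : tria hD τ ⊆ OmegaS P D := by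
  intro p hp
  have hO := tria_subset_Omega hD hτ hp
  have hb := tria_bounds hD hτ hp
  exact ⟨⟨hO.1.1.le, hb.1.2.le.trans (meshPoint_le_of_le hD.pos hD.lamX_le h1)⟩,
    ⟨hO.2.1.le, hb.2.2.le.trans (meshPoint_le_of_le hD.pos hD.lamY_le h2)⟩⟩

lemma notMem_OmegaS {τ : ℕ × ℕ × Bool} (hτ : τ ∈ Grid.pieces D.N)
    (h : D.N ≤ 2 * τ.1 ∨ D.N ≤ 2 * τ.2.1) {p : ℝ × ℝ} (hp : p ∈ tria hD τ) :
    p ∉ OmegaS P D := by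
  have hb := tria_bounds hD hτ hp
  rintro ⟨⟨-, h1⟩, ⟨-, h2⟩⟩
  rcases h with h | h
  · have := le_meshPoint_of_ge hD.pos hD.lamX_pos h
    exact absurd (hb.1.1.trans_le h1) (not_lt.mpr this)
  · have := le_meshPoint_of_ge hD.pos hD.lamY_pos h
    exact absurd (hb.2.1.trans_le h2) (not_lt.mpr this)

lemma measurableSet_OmegaS : MeasurableSet (OmegaS P D) :=
  measurableSet_Icc.prod measurableSet_Icc

open scoped Classical in
lemma BM.ite {s : Set (ℝ × ℝ)} (hs : MeasurableSet s) {f g : ℝ × ℝ → ℝ} (hf : BM f) (hg : BM g) :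
    BM (fun p => if p ∈ s then f p else g p) := by
  obtain ⟨hm, C, hC⟩ := hf
  obtain ⟨hm', C', hC'⟩ := hg
  refine ⟨Measurable.ite hs hm hm', max C C', fun p hp => ?_⟩
  simp only
  split_ifs
  · exact (hC p hp).trans (le_max_left _ _)
  · exact (hC' p hp).trans (le_max_right _ _)

lemma bm_delta : BM (delta P D) := BM.ite measurableSet_OmegaS (BM.const _) (BM.const _)

lemma bm_epsHat : BM (epsHat P D) := BM.ite measurableSet_OmegaS (BM.const _) (BM.const _)

end Geometry

section Local

variable (w : WeightData P) (hD : Admissible P D)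

/-- The density of the squared weighted energy norm. -/
def edens (D : Discr) (w : WeightData P) (G : ℝ × ℝ → ℝ) (p : ℝ × ℝ) : ℝ :=
  wdens w (D.ε + bNorm P ^ 2 * delta P D p) (epsHat P D p) (bNorm P / 2) P.c G p

lemma bm_edens {G : ℝ × ℝ → ℝ} (hG : Lip G) : BM (edens D w G) := by
  have hW := BM.of_continuous w.continuous_W
  have hV := BM.of_continuous w.continuous_V
  have h1 := hG.bm.sq
  have hβ := (BM.dd_of_lip (dirBeta P) hG).sq
  have hη := (BM.dd_of_lip (dirEta P) hG).sq
  exact (((((((BM.const D.ε).add ((BM.const (bNorm P ^ 2)).mul bm_delta)).mul hW).mul hβ).add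
    ((bm_epsHat.mul hW).mul hη)).add
    (((BM.const (bNorm P / 2)).mul hV).mul h1)).add (((BM.const P.c).mul hW).mul h1))

/-- The squared weighted gradient of the interpolation error. -/
def gradE (f : ℝ × ℝ → ℝ) (p : ℝ × ℝ) : ℝ :=
  (w.W p)⁻¹ * dd (dirBeta P) (w.errE hD f) p ^ 2 + (w.W p)⁻¹ * dd (dirEta P) (w.errE hD f) p ^ 2

open scoped Classical in
/-- The density of the interpolation error in the weighted norms. -/
def resid (f : ℝ × ℝ → ℝ) (p : ℝ × ℝ) : ℝ :=
  if p ∈ OmegaS P D then (D.N : ℝ)⁻¹ * gradE w hD f p + D.N * ((w.W p)⁻¹ * w.errE hD f p ^ 2)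
  else (D.εf + D.ε * Real.log D.N ^ 2) * gradE w hD f p

lemma bdryZero_W_mul {f : ℝ × ℝ → ℝ} (hf : (gridX hD).BdryZero (gridY hD) f) :
    (gridX hD).BdryZero (gridY hD) (fun q => w.W q * fem hD f q) := bdryZero_fem_mul hD hf

lemma fem_eq_zero {f : ℝ × ℝ → ℝ} (hf : (gridX hD).BdryZero (gridY hD) f) {p : ℝ × ℝ}
    (hp : p ∉ Omega) : fem hD f p = 0 := Grid.interp_eq_zero _ _ hf hp

lemma lip_W_fem {f : ℝ × ℝ → ℝ} (hf : (gridX hD).BdryZero (gridY hD) f) :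
    Lip (fun p => w.W p * fem hD f p) :=
  Lip.mul_of_eq_zero w.contDiff_W (lip_fem hD f) fun _ hp => fem_eq_zero hD hf hp

lemma lip_errE {f : ℝ × ℝ → ℝ} (hf : (gridX hD).BdryZero (gridY hD) f) : Lip (w.errE hD f) :=
  (lip_W_fem w hD hf).sub (lip_fem hD _)

lemma errE_eq_zero {f : ℝ × ℝ → ℝ} (hf : (gridX hD).BdryZero (gridY hD) f) {p : ℝ × ℝ}
    (hp : p ∉ Omega) : w.errE hD f p = 0 := by
  rw [WeightData.errE, fem_eq_zero hD hf hp, fem_eq_zero hD (bdryZero_W_mul w hD hf) hp]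
  simp

lemma bm_W_inv : BM (fun p => (w.W p)⁻¹) :=
  BM.of_continuous (w.continuous_W.inv₀ fun p => (w.W_pos p).ne')

lemma bm_gradE {f : ℝ × ℝ → ℝ} (hf : (gridX hD).BdryZero (gridY hD) f) : BM (gradE w hD f) :=
  ((bm_W_inv w).mul (BM.dd_of_lip _ (lip_errE w hD hf)).sq).add
    ((bm_W_inv w).mul (BM.dd_of_lip _ (lip_errE w hD hf)).sq)

lemma bm_resid {f : ℝ × ℝ → ℝ} (hf : (gridX hD).BdryZero (gridY hD) f) : BM (resid w hD f) :=
  BM.ite measurableSet_OmegaS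
    (((BM.const _).mul (bm_gradE w hD hf)).add
      ((BM.const _).mul ((bm_W_inv w).mul (lip_errE w hD hf).bm.sq)))
    ((BM.const _).mul (bm_gradE w hD hf))

variable {w}

/-- The legs sum to at most 4/N, and κ ≤ 1/32 makes σ/8 at least 4/N. This is the origin of the
bound 1/32, and it is what keeps `W` and `V` comparable on each triangle. -/
lemma WeightData.Cond.leg_le {κ : ℝ} (hc : w.Cond D κ) {τ : ℕ × ℕ × Bool}
    (hτ : τ ∈ Grid.pieces D.N) :
    |(leg hD τ).1| + |(leg hD τ).2| ≤ w.σβ / 8 ∧ |(leg hD τ).1| + |(leg hD τ).2| ≤ w.ση / 8 := by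
  have hN := hD.cast_pos
  have h1 := (leg_fst_bounds hD hτ).1
  have h2 := (leg_snd_bounds hD hτ).1
  have aux : ∀ σ : ℝ, 0 < σ → σ⁻¹ ≤ κ * D.N → |(leg hD τ).1| + |(leg hD τ).2| ≤ σ / 8 := by
    intro σ hσ hle
    have h3 : κ * D.N ≤ 1 / 32 * D.N := mul_le_mul_of_nonneg_right hc.κ1 hN.le
    have h4 : 1 ≤ D.N / 32 * σ := by
      have := mul_le_mul_of_nonneg_right (hle.trans h3) hσ.le
      rw [inv_mul_cancel₀ hσ.ne'] at this
      linarith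
    refine le_of_mul_le_mul_right ?_ hN
    linarith
  exact ⟨aux _ w.σβ_pos hc.hA, aux _ w.ση_pos hc.hB⟩

/-- Comparison of the energy with normalized energies. -/
def ratioConst (P : Coeff) : ℝ :=
  1 / (bNorm P / 2) + 1 / P.c + 1 / (bNorm P ^ 2 * P.Cstar) + 1

lemma ratioConst_facts (P : Coeff) : 1 ≤ ratioConst P * (bNorm P / 2) ∧ 1 ≤ ratioConst P * P.c ∧
    1 ≤ ratioConst P * (bNorm P ^ 2 * P.Cstar) ∧ 1 ≤ ratioConst P := by
  have hb := bNorm_pos P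
  have hc := P.c_pos
  have hs := P.Cstar_pos
  have p1 : 0 < 1 / (bNorm P / 2) := by positivity
  have p2 : 0 < 1 / P.c := by positivity
  have p3 : 0 < 1 / (bNorm P ^ 2 * P.Cstar) := by positivity
  have key : ∀ x y : ℝ, 0 < x → 1 / x ≤ y → 1 ≤ y * x := fun x y hx h => by
    rwa [div_le_iff₀ hx] at h
  unfold ratioConst
  exact ⟨key _ _ (by positivity) (by linarith), key _ _ hc (by linarith),
    key _ _ (by positivity) (by linarith), by linarith⟩

lemma ratio_le {r κ v W g : ℝ} (h : 1 ≤ r * κ) (hx : 0 ≤ v * W * g) :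
    v * W * g ≤ r * (κ * v * W * g) := by
  calc v * W * g = 1 * (v * W * g) := (one_mul _).symm
    _ ≤ r * κ * (v * W * g) := mul_le_mul_of_nonneg_right h hx
    _ = _ := by ring

lemma setIntegral_le_of_le {U : Set (ℝ × ℝ)} (hU : MeasurableSet U) (hfin : volume U ≠ ⊤)
    {f : ℝ × ℝ → ℝ} (hf : IntegrableOn f U) {C : ℝ} (h : ∀ p ∈ U, f p ≤ C) :
    ∫ p in U, f p ≤ volume.real U * C := by
  have hic : IntegrableOn (fun _ : ℝ × ℝ => C) U := integrableOn_const hfin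
  have := setIntegral_mono_on (μ := volume) hf hic hU h
  rwa [setIntegral_const, smul_eq_mul] at this

lemma abs_dot_beta_sq_le (g : ℝ × ℝ) {t : ℝ} (h1 : |g.1| ≤ t) (h2 : |g.2| ≤ t) :
    dot (dirEta P) g ^ 2 ≤ 4 * t ^ 2 := by
  have h := abs_dot_eta_le P g
  rw [dot_comm'] at h
  have h' : |dot (dirEta P) g| ≤ 2 * t := h.trans (by linarith)
  have := pow_le_pow_left₀ (abs_nonneg _) h' 2
  rw [sq_abs] at this
  linarith

/-- The local interpolation error estimate in the coarse region. -/
lemma integral_resid_le_coarse {κ : ℝ} (hc : w.Cond D κ) {f : ℝ × ℝ → ℝ}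
    (hf : (gridX hD).BdryZero (gridY hD) f) {τ : ℕ × ℕ × Bool} (hτ : τ ∈ Grid.pieces D.N)
    (h1 : 2 * (τ.1 + 1) ≤ D.N) (h2 : 2 * (τ.2.1 + 1) ≤ D.N) :
    ∫ p in tria hD τ, resid w hD f p
      ≤ 4000000000 * ratioConst P * κ * ∫ p in tria hD τ, edens D w (fem hD f) p := by
  have hN := hD.cast_pos
  obtain ⟨hlβ, hlη⟩ := hc.leg_le hD hτ
  obtain ⟨m, g, hm, -, -, -, hg1, hg2, herr, hdens⟩ := exists_piece_data w hD f hτ hlβ hlη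
  have hS := tria_subset_OmegaS hD hτ h1 h2
  obtain ⟨l1, l1', -⟩ := leg_fst_bounds hD hτ
  obtain ⟨l2, l2', -⟩ := leg_snd_bounds hD hτ
  have hU := (isOpen_tria hD τ).measurableSet
  have hfin := volume_tria_ne_top hD hτ
  have hb := bNorm_pos P
  have hCs := P.Cstar_pos
  have hcp := P.c_pos
  have hεs0 : 0 < D.εs := hD.ε_pos.trans_le hD.εs_ge
  have hd := hdens (D.ε + bNorm P ^ 2 * (P.Cstar / D.N)) D.εs (bNorm P / 2) P.c
    (by have := hD.ε_pos; positivity) hεs0.le (by positivity) hcp.le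
  have hdeq : ∫ p in tria hD τ, edens D w (fem hD f) p = ∫ p in tria hD τ,
      wdens w (D.ε + bNorm P ^ 2 * (P.Cstar / D.N)) D.εs (bNorm P / 2) P.c (fem hD f) p := by
    refine setIntegral_congr_fun hU fun p hp => ?_
    simp only [edens, delta, epsHat, if_pos (hS hp)]
  rw [← hdeq] at hd
  set h := |(leg hD τ).1| + |(leg hD τ).2| with hh
  have hh0 : 0 ≤ h := by positivity
  have hhN : h * D.N ≤ 4 := by rw [hh, add_mul]; linarith
  -- The inverse inequality for one component of the gradient, across a leg of length at least 1/N.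
  have inv1 : ∀ {x d : ℝ}, 0 ≤ x → 1 ≤ d * D.N → x * d ≤ 2 * m → x ≤ 2 * m * D.N := by
    intro x d hx hd' hxd
    have q1 := mul_le_mul_of_nonneg_left hd' hx
    have q2 := mul_le_mul_of_nonneg_right hxd hN.le
    linarith
  have hgη := abs_dot_beta_sq_le (P := P) g (inv1 (abs_nonneg _) (l1' h1) hg1)
    (inv1 (abs_nonneg _) (l2' h2) hg2)
  set gβ := dot (dirBeta P) g
  set gη := dot (dirEta P) g
  set V := w.V (anc hD τ) with hV
  set W := w.W (anc hD τ) with hW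
  have hV0 : 0 ≤ V := (w.V_pos _).le
  have hW0 : 0 ≤ W := (w.W_pos _).le
  have hT := errT_le_coarse (A := w.σβ⁻¹) (B := w.ση⁻¹) (m := m) (gβ := gβ) (gη := gη) (e := D.εs)
    (inv_pos.mpr w.σβ_pos).le (inv_pos.mpr w.ση_pos).le hV0 hW0
    (by rw [← div_eq_mul_inv]; exact w.V_le _) hc.κ0 (by linarith [hc.κ1]) hN hc.hA hc.hB hc.hB4
    hc.hs hεs0.le (by linarith)
  set T := errT w.σβ⁻¹ w.ση⁻¹ V W m gβ gη with hTdef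
  have hT0 : 0 ≤ T := by
    have := (inv_pos.mpr w.σβ_pos).le
    have := (inv_pos.mpr w.ση_pos).le
    rw [hTdef, errT]
    positivity
  obtain ⟨r1, r2, r3, r4⟩ := ratioConst_facts P
  have hpt : ∀ p ∈ tria hD τ, resid w hD f p ≤ 30000000 * ratioConst P * κ *
      ((D.ε + bNorm P ^ 2 * (P.Cstar / D.N)) * W * gβ ^ 2 + D.εs * W * gη ^ 2
        + (bNorm P / 2 * V + P.c * W) * m ^ 2) := by
    intro p hp
    obtain ⟨e1, e2⟩ := herr p hp
    rw [resid, if_pos (hS hp)]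
    -- The error carries two more powers of `h` than its gradient, and its coefficient two more
    -- powers of `N`; both parts scale like T/N³.
    have s1 : (D.N : ℝ)⁻¹ * gradE w hD f p ≤ 179200 * (T / (D.N : ℝ) ^ 3) := by
      calc (D.N : ℝ)⁻¹ * gradE w hD f p ≤ (D.N : ℝ)⁻¹ * (11200 * h ^ 2 * T) :=
            mul_le_mul_of_nonneg_left e1 (by positivity)
        _ = 11200 * (h * D.N) ^ 2 * (T / (D.N : ℝ) ^ 3) := by field_simp
        _ ≤ 11200 * 4 ^ 2 * (T / (D.N : ℝ) ^ 3) := by gcongr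
        _ = _ := by norm_num
    have s2 : D.N * ((w.W p)⁻¹ * w.errE hD f p ^ 2) ≤ 1433600 * (T / (D.N : ℝ) ^ 3) := by
      calc D.N * ((w.W p)⁻¹ * w.errE hD f p ^ 2) ≤ D.N * (5600 * h ^ 4 * T) :=
            mul_le_mul_of_nonneg_left e2 hN.le
        _ = 5600 * (h * D.N) ^ 4 * (T / (D.N : ℝ) ^ 3) := by field_simp
        _ ≤ 5600 * 4 ^ 4 * (T / (D.N : ℝ) ^ 3) := by gcongr
        _ = _ := by norm_num
    have s3 : T / (D.N : ℝ) ^ 3 ≤ κ * (18 * V * m ^ 2 + 17 * W * m ^ 2 + 2 / D.N * W * gβ ^ 2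
        + D.εs * W * gη ^ 2) := by
      rw [div_le_iff₀ (by positivity)]
      linarith
    have q1 := ratio_le r1 (show 0 ≤ 1 * V * m ^ 2 by positivity)
    have q2 := ratio_le r2 (show 0 ≤ 1 * W * m ^ 2 by positivity)
    have q3 := ratio_le r3 (show 0 ≤ 1 / D.N * W * gβ ^ 2 by positivity)
    have q4 := ratio_le (r := ratioConst P) (κ := 1) (by linarith) (show 0 ≤ D.εs * W * gη ^ 2 by positivity)
    have q5 : 0 ≤ ratioConst P * (D.ε * W * gβ ^ 2) := by
      have := hD.ε_pos
      have : 0 ≤ ratioConst P := by linarith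
      positivity
    have s4 : 18 * V * m ^ 2 + 17 * W * m ^ 2 + 2 / D.N * W * gβ ^ 2 + D.εs * W * gη ^ 2 ≤
        18 * (ratioConst P * ((D.ε + bNorm P ^ 2 * (P.Cstar / D.N)) * W * gβ ^ 2
          + D.εs * W * gη ^ 2 + (bNorm P / 2 * V + P.c * W) * m ^ 2)) := by
      have p1 : 0 ≤ 1 * V * m ^ 2 := by positivity
      have p2 : 0 ≤ 1 * W * m ^ 2 := by positivity
      have p3 : 0 ≤ 1 / D.N * W * gβ ^ 2 := by positivity
      have p4 : 0 ≤ D.εs * W * gη ^ 2 := by positivity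
      have e3 : 2 / D.N * W * gβ ^ 2 = 2 * (1 / D.N * W * gβ ^ 2) := by ring
      have e4 : bNorm P ^ 2 * (P.Cstar / D.N) = bNorm P ^ 2 * P.Cstar * (1 / D.N) := by ring
      rw [e3, e4]
      linarith
    have s5 := mul_le_mul_of_nonneg_left s4 hc.κ0
    have p0 : 0 ≤ κ * (ratioConst P * ((D.ε + bNorm P ^ 2 * (P.Cstar / D.N)) * W * gβ ^ 2
          + D.εs * W * gη ^ 2 + (bNorm P / 2 * V + P.c * W) * m ^ 2)) := by
      have := hD.ε_pos
      have : 0 ≤ ratioConst P := by linarith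
      have := hc.κ0
      positivity
    linarith
  have hres := setIntegral_le_of_le hU hfin
    ((bm_resid w hD hf).integrableOn.mono_set (tria_subset_Omega hD hτ)) hpt
  have hκr : 0 ≤ 30000000 * ratioConst P * κ :=
    mul_nonneg (by linarith) hc.κ0
  have hfinal := mul_le_mul_of_nonneg_left hd hκr
  have hI : 0 ≤ ratioConst P * κ * ∫ p in tria hD τ, edens D w (fem hD f) p := by
    refine mul_nonneg (mul_nonneg (by linarith) hc.κ0) (setIntegral_nonneg hU fun p hp => ?_)
    have := w.W_pos p
    have := w.V_pos p
    have := hD.ε_pos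
    simp only [edens, delta, epsHat, if_pos (hS hp), wdens]
    positivity
  linarith

end Local

end

/-! ### The local estimate in the layers and the global interpolation error estimate -/

section

variable {P : Coeff} {D : Discr} {w : WeightData P} (hD : Admissible P D)

/-- The constant in the inverse inequality on layer triangles with one coarse leg. -/
def edgeConst (P : Coeff) : ℝ := 8 / (dirBeta P).1 ^ 2 + 8 / (dirBeta P).2 ^ 2

/-- The constant in the bound of the size of the corner triangles. -/
def cornerConst (P : Coeff) : ℝ := 5 / P.β₁ + 5 / P.β₂

/-- The constant in the interpolation error estimate in the layers. -/
def layerConst (P : Coeff) : ℝ := 200 + 48 * edgeConst P + 2 * cornerConst P ^ 2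

lemma edgeConst_nonneg (P : Coeff) : 0 ≤ edgeConst P := by unfold edgeConst; positivity

lemma layerConst_pos (P : Coeff) : 0 < layerConst P := by
  have := edgeConst_nonneg P
  unfold layerConst
  positivity

/-- Each Cartesian component of `g` is a combination of its streamline and crosswind components in
which the former has a nonzero coefficient, since both entries of the convection vector are
positive. A bound of one Cartesian component can thus be solved for the streamline component. -/
lemma sq_beta_le {g : ℝ × ℝ} {t : ℝ} (h : |g.1| ≤ 2 * t ∨ |g.2| ≤ 2 * t) :
    dot (dirBeta P) g ^ 2 ≤ edgeConst P * (dot (dirEta P) g ^ 2 + t ^ 2) := by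
  have hβ := dirBeta_sq P
  have b1 := dirBeta_fst_pos P
  have b2 := dirBeta_snd_pos P
  have l1 := dirBeta_fst_le P
  have l2 := dirBeta_snd_le P
  have key : ∀ s s' x : ℝ, 0 < s → 0 ≤ s' → s' ≤ 1 → |x| ≤ 2 * t → ∀ y z, (s * y = x + s' * z ∨
      s * y = x - s' * z) → y ^ 2 ≤ 8 / s ^ 2 * (z ^ 2 + t ^ 2) := by
    intro s s' x hs hs' hs1 hx y z hy
    have hx2 : x ^ 2 ≤ 4 * t ^ 2 := by
      have := pow_le_pow_left₀ (abs_nonneg _) hx 2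
      rw [sq_abs] at this
      linarith
    have hz2 : (s' * z) ^ 2 ≤ z ^ 2 := by
      rw [mul_pow]
      exact mul_le_of_le_one_left (sq_nonneg _) (pow_le_one₀ hs' hs1)
    have hsy : (s * y) ^ 2 ≤ 8 * (z ^ 2 + t ^ 2) := by
      rcases hy with hy | hy <;> rw [hy] <;>
        nlinarith [sq_nonneg (x - s' * z), sq_nonneg (x + s' * z), sq_nonneg z]
    rw [div_mul_eq_mul_div, le_div_iff₀ (by positivity)]
    linarith
  have hpos : 0 ≤ dot (dirEta P) g ^ 2 + t ^ 2 := by positivity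
  unfold edgeConst
  rw [add_mul]
  have n1 : 0 ≤ 8 / (dirBeta P).1 ^ 2 * (dot (dirEta P) g ^ 2 + t ^ 2) := by positivity
  have n2 : 0 ≤ 8 / (dirBeta P).2 ^ 2 * (dot (dirEta P) g ^ 2 + t ^ 2) := by positivity
  rcases h with h | h
  · have := key _ _ _ b1 b2.le l2 h (dot (dirBeta P) g) (dot (dirEta P) g) (Or.inl (by
      simp only [dot, dirEta_fst, dirEta_snd]
      linear_combination g.1 * hβ))
    linarith
  · have := key _ _ _ b2 b1.le l1 h (dot (dirBeta P) g) (dot (dirEta P) g) (Or.inr (by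
      simp only [dot, dirEta_fst, dirEta_snd]
      linear_combination g.2 * hβ))
    linarith

namespace Admissible

include hD

lemma ε_mul_le : D.ε * D.N ≤ 1 := by
  have := hD.ε_le
  rwa [le_div_iff₀ hD.cast_pos] at this

lemma εf_mul_le : D.εf * D.N ≤ 1 := by
  have := hD.εf_le
  rwa [le_div_iff₀ hD.cast_pos] at this

lemma inv_le_one : 1 / (D.N : ℝ) ≤ 1 := by
  rw [div_le_one hD.cast_pos]; linarith [hD.two_le_cast]

lemma εf_pos : 0 < D.εf := hD.ε_pos.trans_le hD.εf_ge

lemma εs_pos : 0 < D.εs := hD.ε_pos.trans_le hD.εs_ge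

end Admissible

lemma ratioConst_pos (P : Coeff) : 0 < ratioConst P := by
  linarith [(ratioConst_facts P).2.2.2]

/-- The local interpolation error estimate in the layers. -/
lemma integral_resid_le_layer {κ : ℝ} (hc : w.Cond D κ) {f : ℝ × ℝ → ℝ}
    (hf : (gridX hD).BdryZero (gridY hD) f) {τ : ℕ × ℕ × Bool} (hτ : τ ∈ Grid.pieces D.N)
    (hcase : D.N ≤ 2 * τ.1 ∨ D.N ≤ 2 * τ.2.1) :
    ∫ p in tria hD τ, resid w hD f p
      ≤ 1433600 * layerConst P * ratioConst P * κ
        * ∫ p in tria hD τ, edens D w (fem hD f) p := by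
  have hN := hD.cast_pos
  obtain ⟨hlβ, hlη⟩ := hc.leg_le hD hτ
  obtain ⟨m, g, hm, -, -, -, hg1, hg2, herr, hdens⟩ := exists_piece_data w hD f hτ hlβ hlη
  have hS := fun p hp => notMem_OmegaS hD hτ hcase (p := p) hp
  obtain ⟨l1, l1', l1''⟩ := leg_fst_bounds hD hτ
  obtain ⟨l2, l2', l2''⟩ := leg_snd_bounds hD hτ
  have hU := (isOpen_tria hD τ).measurableSet
  have hfin := volume_tria_ne_top hD hτ
  have hb := bNorm_pos P
  have hcp := P.c_pos
  have hε := hD.ε_pos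
  have hεf := hD.εf_pos
  have hd := hdens D.ε D.εf (bNorm P / 2) P.c hε.le hεf.le (by positivity) hcp.le
  have hdeq : ∫ p in tria hD τ, edens D w (fem hD f) p = ∫ p in tria hD τ,
      wdens w D.ε D.εf (bNorm P / 2) P.c (fem hD f) p := by
    refine setIntegral_congr_fun hU fun p hp => ?_
    simp only [edens, delta, epsHat, if_neg (hS p hp), mul_zero, add_zero]
  rw [← hdeq] at hd
  set h := |(leg hD τ).1| + |(leg hD τ).2| with hh
  have hh0 : 0 ≤ h := by positivity
  have hhN : h * D.N ≤ 4 := by rw [hh, add_mul]; linarith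
  have inv1 : ∀ {x d : ℝ}, 0 ≤ x → 1 ≤ d * D.N → x * d ≤ 2 * m → x ≤ 2 * (D.N * m) := by
    intro x d hx hd' hxd
    have q1 := mul_le_mul_of_nonneg_left hd' hx
    have q2 := mul_le_mul_of_nonneg_right hxd hN.le
    linarith
  set gβ := dot (dirBeta P) g with hgβ
  set gη := dot (dirEta P) g with hgη
  set V := w.V (anc hD τ) with hV
  set W := w.W (anc hD τ) with hW
  set L := Real.log D.N with hL
  have hL0 : 1 / 2 ≤ L := hD.log_ge
  have hκ0 := hc.κ0
  have hV0 : 0 ≤ V := (w.V_pos _).le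
  have hW0 : 0 ≤ W := (w.W_pos _).le
  have hA0 := (inv_pos.mpr w.σβ_pos).le
  have hB0 := (inv_pos.mpr w.ση_pos).le
  have hVW : V ≤ W * w.σβ⁻¹ := by rw [← div_eq_mul_inv]; exact w.V_le _
  have hΓ := edgeConst_nonneg P
  set T := errT w.σβ⁻¹ w.ση⁻¹ V W m gβ gη with hTdef
  have hT0 : 0 ≤ T := by rw [hTdef, errT]; positivity
  set S := V * m ^ 2 + W * m ^ 2 + D.ε * W * gβ ^ 2 + D.εf * W * gη ^ 2 with hSdef
  have n1 : 0 ≤ κ * (V * m ^ 2) := by positivity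
  have n2 : 0 ≤ κ * (W * m ^ 2) := by positivity
  have n3 : 0 ≤ κ * (D.ε * W * gβ ^ 2) := by positivity
  have n4 : 0 ≤ κ * (D.εf * W * gη ^ 2) := by positivity
  have hh2 : (h * D.N) ^ 2 ≤ 16 := by nlinarith [mul_nonneg hh0 hN.le]
  have scale : ∀ x y : ℝ, 0 ≤ x → x * T ≤ κ * (D.N : ℝ) ^ 2 * y → 0 ≤ y →
      x * h ^ 2 * T ≤ 16 * (κ * y) := by
    intro x y hx hxy hy
    calc x * h ^ 2 * T = h ^ 2 * (x * T) := by ring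
      _ ≤ h ^ 2 * (κ * (D.N : ℝ) ^ 2 * y) := mul_le_mul_of_nonneg_left hxy (by positivity)
      _ = (h * D.N) ^ 2 * (κ * y) := by ring
      _ ≤ 16 * (κ * y) := mul_le_mul_of_nonneg_right hh2 (by positivity)
  -- The logarithmic part of the residual needs no inverse inequality, hence no distinction between
  -- kinds of layer triangles.
  have hlog := scale (D.ε * L ^ 2) _ (by positivity)
    (errT_le_log (m := m) (gβ := gβ) (gη := gη) hA0 hB0 hV0 hW0 hVW hκ0 (by linarith [hc.κ1]) hN
      hε.le hD.ε_mul_le hL0 hc.hLA hc.hLB hc.hL4 hD.εf_ge) (by positivity)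
  have hfirst : D.εf * h ^ 2 * T ≤ κ * ((32 + 16 * edgeConst P + 2 * cornerConst P ^ 2)
      * (V * m ^ 2) + (16 + 16 * edgeConst P) * (W * m ^ 2)
      + 2 * cornerConst P ^ 2 * (D.ε * W * gβ ^ 2)
      + (32 + 32 * edgeConst P + 2 * cornerConst P ^ 2) * (D.εf * W * gη ^ 2)) := by
    have c1 := mul_nonneg (sq_nonneg (cornerConst P)) n1
    have c3 := mul_nonneg (sq_nonneg (cornerConst P)) n3
    have c4 := mul_nonneg (sq_nonneg (cornerConst P)) n4
    have k1 := mul_nonneg hΓ n1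
    have k2 := mul_nonneg hΓ n2
    have k4 := mul_nonneg hΓ n4
    have edge : (|g.1| ≤ 2 * (D.N * m) ∨ |g.2| ≤ 2 * (D.N * m)) → D.εf * h ^ 2 * T ≤
        16 * (κ * ((2 + edgeConst P) * V * m ^ 2 + (1 + edgeConst P) * W * m ^ 2
          + 2 * (1 + edgeConst P) * (D.εf * W * gη ^ 2))) := by
      intro hor
      refine scale D.εf _ hεf.le (errT_le_edge (m := m) (gβ := gβ) (gη := gη) hA0 hB0 hV0 hW0 hVW
        hκ0 (by linarith [hc.κ1]) hN hc.hA hc.hB hc.hB4 hεf.le hD.εf_mul_le hc.hf hΓ ?_)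
        (by positivity)
      rw [← mul_pow]
      exact sq_beta_le hor
    -- Three positions: a coarse horizontal leg, a coarse vertical leg, or both legs in the fine
    -- part. Evenness of `N` ensures that no cell straddles a transition point.
    rcases lt_or_ge_of_even hD.even τ.1 with hx | hx
    · have := edge (Or.inl (inv1 (abs_nonneg _) (l1' hx) hg1))
      linarith
    · rcases lt_or_ge_of_even hD.even τ.2.1 with hy | hy
      · have := edge (Or.inr (inv1 (abs_nonneg _) (l2' hy) hg2))
        linarith
      · have hhc : h * D.N ≤ cornerConst P * (D.ε * L) := by
          rw [hh, add_mul, l1'' hx, l2'' hy, hD.lamX_eq, hD.lamY_eq, cornerConst]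
          refine le_of_eq ?_
          ring
        have := errT_le_corner (m := m) (gβ := gβ) (gη := gη) hA0 hB0 hV0 hW0 hVW
          hκ0 (by linarith [hc.κ1]) hN hc.hA hc.hB hc.hB4 hεf.le hD.εf_mul_le
          (hD.εf_le.trans hD.inv_le_one) hh0 hhN hhc hε.le (hD.ε_le.trans hD.inv_le_one) hc.hLA
          (by linarith) hc.hLB
        linarith
  have hboth : (D.εf + D.ε * L ^ 2) * h ^ 2 * T ≤ layerConst P * (κ * S) := by
    have k1 := mul_nonneg hΓ n1
    have k2 := mul_nonneg hΓ n2
    have k3 := mul_nonneg hΓ n3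
    have k4 := mul_nonneg hΓ n4
    have c2 := mul_nonneg (sq_nonneg (cornerConst P)) n2
    rw [hSdef, layerConst]
    linarith
  obtain ⟨r1, r2, r3, r4⟩ := ratioConst_facts P
  have hrp := ratioConst_pos P
  have hS_le : S ≤ ratioConst P * (D.ε * W * gβ ^ 2 + D.εf * W * gη ^ 2
      + (bNorm P / 2 * V + P.c * W) * m ^ 2) := by
    have q1 := ratio_le r1 (show 0 ≤ 1 * V * m ^ 2 by positivity)
    have q2 := ratio_le r2 (show 0 ≤ 1 * W * m ^ 2 by positivity)
    have q3 := mul_le_mul_of_nonneg_right r4 (show 0 ≤ D.ε * W * gβ ^ 2 by positivity)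
    have q4 := mul_le_mul_of_nonneg_right r4 (show 0 ≤ D.εf * W * gη ^ 2 by positivity)
    rw [hSdef]
    linarith
  have hpt : ∀ p ∈ tria hD τ, resid w hD f p ≤ 11200 * layerConst P * ratioConst P * κ *
      (D.ε * W * gβ ^ 2 + D.εf * W * gη ^ 2 + (bNorm P / 2 * V + P.c * W) * m ^ 2) := by
    intro p hp
    obtain ⟨e1, -⟩ := herr p hp
    rw [resid, if_neg (hS p hp)]
    have hlc := (layerConst_pos P).le
    calc (D.εf + D.ε * L ^ 2) * gradE w hD f p
        ≤ (D.εf + D.ε * L ^ 2) * (11200 * h ^ 2 * T) :=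
          mul_le_mul_of_nonneg_left e1 (by positivity)
      _ = 11200 * ((D.εf + D.ε * L ^ 2) * h ^ 2 * T) := by ring
      _ ≤ 11200 * (layerConst P * (κ * (ratioConst P * (D.ε * W * gβ ^ 2 + D.εf * W * gη ^ 2
          + (bNorm P / 2 * V + P.c * W) * m ^ 2)))) := by
          refine mul_le_mul_of_nonneg_left (hboth.trans ?_) (by norm_num)
          exact mul_le_mul_of_nonneg_left (mul_le_mul_of_nonneg_left hS_le hκ0) hlc
      _ = _ := by ring
  have hres := setIntegral_le_of_le hU hfin
    ((bm_resid w hD hf).integrableOn.mono_set (tria_subset_Omega hD hτ)) hpt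
  have hκr : 0 ≤ 11200 * layerConst P * ratioConst P * κ := by
    have := layerConst_pos P
    positivity
  have hfinal := mul_le_mul_of_nonneg_left hd hκr
  linarith

/-- The constant in the global interpolation error estimate. -/
def residConst (P : Coeff) : ℝ := 4000000000 * layerConst P * ratioConst P

lemma residConst_pos (P : Coeff) : 0 < residConst P := by
  have := layerConst_pos P
  have := ratioConst_pos P
  unfold residConst
  positivity

include hD in
lemma edens_nonneg (w : WeightData P) {G : ℝ × ℝ → ℝ} (p : ℝ × ℝ) : 0 ≤ edens D w G p := by
  have := w.W_pos p
  have := w.V_pos p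
  have := hD.ε_pos
  have := hD.εs_pos
  have := hD.εf_pos
  have := hD.cast_pos
  have := bNorm_pos P
  have := P.Cstar_pos
  have := P.c_pos
  unfold edens delta epsHat wdens
  split_ifs <;> positivity

/-- The interpolation error of the product of the reciprocal weight and a finite element
function is small in the weighted norms. -/
lemma integral_resid_le {κ : ℝ} (hc : w.Cond D κ) {f : ℝ × ℝ → ℝ}
    (hf : (gridX hD).BdryZero (gridY hD) f) :
    ∫ p in Omega, resid w hD f p ≤ residConst P * κ * ∫ p in Omega, edens D w (fem hD f) p := by
  rw [integral_eq_sum_tria hD (bm_resid w hD hf),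
    integral_eq_sum_tria hD (bm_edens w (lip_fem hD f)), Finset.mul_sum]
  refine Finset.sum_le_sum fun τ hτ => ?_
  have hI : 0 ≤ ∫ p in tria hD τ, edens D w (fem hD f) p :=
    setIntegral_nonneg (isOpen_tria hD τ).measurableSet fun p _ => edens_nonneg hD w p
  have hκI := mul_nonneg (mul_nonneg (ratioConst_pos P).le hc.κ0) hI
  have hl : 200 ≤ layerConst P := by
    have := edgeConst_nonneg P
    have := sq_nonneg (cornerConst P)
    unfold layerConst
    linarith
  have h200 := mul_le_mul_of_nonneg_right hl hκI
  unfold residConst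
  rcases lt_or_ge_of_even hD.even τ.1 with hx | hx
  · rcases lt_or_ge_of_even hD.even τ.2.1 with hy | hy
    · have := integral_resid_le_coarse hD hc hf hτ hx hy
      linarith
    · have := integral_resid_le_layer hD hc hf hτ (Or.inr hy)
      linarith
  · have := integral_resid_le_layer hD hc hf hτ (Or.inl hx)
    linarith

end

/-! ### The weighted Poincaré inequality in the layers -/

section

variable {P : Coeff} {D : Discr} {w : WeightData P} (hD : Admissible P D)

lemma Lip.sq_of_eq_zero {f : ℝ × ℝ → ℝ} (hf : Lip f) (h0 : ∀ p ∉ Omega, f p = 0) :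
    Lip (fun p => f p ^ 2) := by
  obtain ⟨B, hB⟩ := isCompact_closure_Omega.exists_bound_of_continuousOn hf.continuous.continuousOn
  have hne : (1 / 2, 1 / 2) ∈ closure Omega := by
    rw [closure_Omega]; constructor <;> constructor <;> norm_num
  have hB0 : 0 ≤ B := (norm_nonneg _).trans (hB _ hne)
  have hB' : ∀ p, |f p| ≤ B := fun p => by
    by_cases hp : p ∈ Omega
    · exact hB p (subset_closure hp)
    · rw [h0 p hp, abs_zero]; exact hB0
  obtain ⟨K, hK⟩ := hf
  refine ⟨⟨2 * B * K, by positivity⟩, LipschitzWith.of_dist_le_mul fun p q => ?_⟩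
  change |f p ^ 2 - f q ^ 2| ≤ 2 * B * K * dist p q
  rw [sq_sub_sq, abs_mul, mul_assoc]
  exact mul_le_mul ((abs_add_le _ _).trans (by linarith [hB' p, hB' q])) (hK.dist_le_mul p q)
    (abs_nonneg _) (by positivity)

namespace WeightData

lemma dd_W (ζ p : ℝ × ℝ) :
    dd ζ w.W p = w.V p * dot ζ (dirBeta P) + w.Z p * dot ζ (dirEta P) := by
  rw [dd, (w.hasFDerivAt_W p).fderiv]
  simp [dotL_apply]

lemma abs_dd_W_le {ζ : ℝ × ℝ} (h1 : |dot ζ (dirBeta P)| ≤ 1) (h2 : |dot ζ (dirEta P)| ≤ 1)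
    (p : ℝ × ℝ) : |dd ζ w.W p| ≤ w.W p * (w.σβ⁻¹ + w.ση⁻¹) := by
  rw [dd_W]
  refine (abs_add_le _ _).trans ?_
  rw [abs_mul, abs_mul, abs_of_pos (w.V_pos p), mul_add, ← div_eq_mul_inv, ← div_eq_mul_inv]
  exact add_le_add ((mul_le_of_le_one_right (w.V_pos p).le h1).trans (w.V_le p))
    ((mul_le_of_le_one_right (abs_nonneg _) h2).trans (w.abs_Z_le p))

lemma dd_W_inv (ζ p : ℝ × ℝ) : dd ζ (fun q => (w.W q)⁻¹) p = -(dd ζ w.W p / w.W p ^ 2) := by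
  have h := (hasDerivAt_inv (w.W_pos p).ne').comp_hasFDerivAt p (w.hasFDerivAt_W p)
  change fderiv ℝ (Inv.inv ∘ w.W) p ζ = -(fderiv ℝ w.W p ζ / w.W p ^ 2)
  rw [h.fderiv, (w.hasFDerivAt_W p).fderiv]
  simp
  ring

lemma contDiff_W_inv : ContDiff ℝ 1 (fun p => (w.W p)⁻¹) :=
  w.contDiff_W.inv fun p => (w.W_pos p).ne'

end WeightData

section Poincare

/-- The distance to the line where the layer region begins. -/
def ramp (ℓ : ℝ × ℝ →L[ℝ] ℝ) (lam : ℝ) (p : ℝ × ℝ) : ℝ := max 0 (ℓ p - (1 - lam))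

lemma lip_ramp (ℓ : ℝ × ℝ →L[ℝ] ℝ) (lam : ℝ) : Lip (ramp ℓ lam) :=
  (Lip.const 0).max (Lip.sub ⟨_, ℓ.lipschitz⟩ (Lip.const _))

/-- The layer region. -/
def layer (ℓ : ℝ × ℝ →L[ℝ] ℝ) (lam : ℝ) : Set (ℝ × ℝ) := {q | 1 - lam < ℓ q}

open scoped Classical in
lemma dd_ramp {ℓ : ℝ × ℝ →L[ℝ] ℝ} {e : ℝ × ℝ} (he : ℓ e = 1) (lam : ℝ) (p : ℝ × ℝ) :
    dd e (ramp ℓ lam) p = if p ∈ layer ℓ lam then 1 else 0 := by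
  split_ifs with h
  · have hopen : IsOpen (layer ℓ lam) := isOpen_lt continuous_const ℓ.continuous
    have heq : EqOn (ramp ℓ lam) (fun q => ℓ q - (1 - lam)) (layer ℓ lam) := fun q hq =>
      max_eq_right (sub_nonneg.mpr (le_of_lt hq))
    rw [dd_eq_of_eqOn hopen heq h (ℓ.hasFDerivAt.sub_const _), he]
  -- On the closed complement, interface included, the ramp attains its minimum 0, so `fderiv` is 0
  -- there whether or not the ramp is differentiable.
  · have hmin : IsLocalMin (ramp ℓ lam) p := by
      have h0 : ramp ℓ lam p = 0 := max_eq_left (sub_nonpos.mpr (not_lt.mp h))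
      exact Filter.Eventually.of_forall fun q => h0.le.trans (le_max_left _ _)
    rw [dd, hmin.fderiv_eq_zero]
    rfl

open scoped Classical in
/-- A weighted Poincaré inequality in the layer. -/
lemma poincare {E : ℝ × ℝ → ℝ} (hE : Lip E) (h0 : ∀ p ∉ Omega, E p = 0)
    {ℓ : ℝ × ℝ →L[ℝ] ℝ} {e : ℝ × ℝ} (he : ℓ e = 1) (hℓ : ∀ p ∈ Omega, ℓ p ≤ 1) {lam : ℝ}
    (hlam : 0 ≤ lam) (h1 : |dot e (dirBeta P)| ≤ 1) (h2 : |dot e (dirEta P)| ≤ 1)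
    (hσ : lam * (w.σβ⁻¹ + w.ση⁻¹) ≤ 1 / 2) :
    ∫ p in Omega, (if p ∈ layer ℓ lam then (w.W p)⁻¹ * E p ^ 2 else 0)
      ≤ 16 * lam ^ 2 * ∫ p in Omega,
        (if p ∈ layer ℓ lam then (w.W p)⁻¹ * dd e E p ^ 2 else 0) := by
  have hR : MeasurableSet (layer ℓ lam) :=
    (isOpen_lt continuous_const ℓ.continuous).measurableSet
  have hg : Lip (fun p => (w.W p)⁻¹ * E p ^ 2) :=
    Lip.mul_of_eq_zero w.contDiff_W_inv (hE.sq_of_eq_zero h0)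
      fun p hp => by rw [h0 p hp]; ring
  have ibp := integral_dd_mul (lip_ramp ℓ lam) hg (fun p hp => by rw [h0 p hp]; ring) e
  have hl : ∫ p in Omega, (if p ∈ layer ℓ lam then (w.W p)⁻¹ * E p ^ 2 else 0)
      = ∫ p in Omega, dd e (ramp ℓ lam) p * ((w.W p)⁻¹ * E p ^ 2) := by
    refine setIntegral_congr_fun measurableSet_Omega fun p _ => ?_
    rw [dd_ramp he, ite_mul, one_mul, zero_mul]
  have bm1 : BM (fun p => if p ∈ layer ℓ lam then (w.W p)⁻¹ * E p ^ 2 else 0) :=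
    BM.ite hR hg.bm (BM.const 0)
  have bm2 : BM (fun p => if p ∈ layer ℓ lam then (w.W p)⁻¹ * dd e E p ^ 2 else 0) :=
    BM.ite hR ((bm_W_inv w).mul (BM.dd_of_lip e hE).sq) (BM.const 0)
  have hmono : -∫ p in Omega, dd e (fun p => (w.W p)⁻¹ * E p ^ 2) p * ramp ℓ lam p
      ≤ ∫ p in Omega, (3 / 4 * (if p ∈ layer ℓ lam then (w.W p)⁻¹ * E p ^ 2 else 0)
        + 4 * lam ^ 2 * (if p ∈ layer ℓ lam then (w.W p)⁻¹ * dd e E p ^ 2 else 0)) := by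
    rw [← integral_neg]
    refine integral_mono_ae
      (((BM.dd_of_lip e hg).mul (lip_ramp ℓ lam).bm).neg.integrableOn)
      ((((BM.const _).mul bm1).add ((BM.const _).mul bm2)).integrableOn) ?_
    filter_upwards [ae_restrict_mem measurableSet_Omega,
      ae_restrict_of_ae hE.ae_differentiableAt] with p hp hdiff
    by_cases hpR : p ∈ layer ℓ lam
    · simp only [if_pos hpR]
      have hW := w.W_pos p
      have hr0 : 0 ≤ ramp ℓ lam p := le_max_left _ _
      have hr1 : ramp ℓ lam p ≤ lam := max_le hlam (by linarith [hℓ p hp])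
      have hderiv : dd e (fun p => (w.W p)⁻¹ * E p ^ 2) p
          = dd e (fun q => (w.W q)⁻¹) p * E p ^ 2 + (w.W p)⁻¹ * (2 * E p * dd e E p) := by
        have hw : DifferentiableAt ℝ (fun q => (w.W q)⁻¹) p :=
          (w.contDiff_W_inv.differentiable one_ne_zero) p
        have h3 := hw.hasFDerivAt.mul (hdiff.hasFDerivAt.pow 2)
        simp only [dd]
        rw [show fderiv ℝ (fun p => (w.W p)⁻¹ * E p ^ 2) p = _ from h3.fderiv]
        simp
        ring
      rw [hderiv, w.dd_W_inv]
      have hWe := w.abs_dd_W_le h1 h2 p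
      have habs : |dd e w.W p / w.W p ^ 2| ≤ (w.W p)⁻¹ * (w.σβ⁻¹ + w.ση⁻¹) := by
        rw [abs_div, abs_of_pos (show 0 < w.W p ^ 2 by positivity), div_le_iff₀ (by positivity)]
        refine hWe.trans_eq ?_
        field_simp
      set r := ramp ℓ lam p
      set ω := (w.W p)⁻¹ with hω
      have hω0 : 0 < ω := inv_pos.mpr hW
      set y := dd e w.W p / w.W p ^ 2
      -- The derivative of the weight costs 1/2 by the smallness of `lam` relative to the weight
      -- parameters; Young's inequality in `t3` costs another 1/4.
      have t1 : y * r ≤ 1 / 2 * ω := by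
        have : y * r ≤ ω * (w.σβ⁻¹ + w.ση⁻¹) * lam :=
          mul_le_mul ((le_abs_self y).trans habs) hr1 hr0 ((abs_nonneg _).trans habs)
        have h3 := mul_le_mul_of_nonneg_left hσ hω0.le
        linarith
      have t2 := mul_le_mul_of_nonneg_right t1 (sq_nonneg (E p))
      have t3 : -(2 * E p * dd e E p * r) ≤ 1 / 4 * E p ^ 2 + 4 * lam ^ 2 * dd e E p ^ 2 := by
        have hr2 : r ^ 2 ≤ lam ^ 2 := pow_le_pow_left₀ hr0 hr1 2
        have h4 := mul_le_mul_of_nonneg_right hr2 (sq_nonneg (dd e E p))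
        have h5 := sq_nonneg (1 / 2 * E p + 2 * (r * dd e E p))
        linarith
      have t4 := mul_le_mul_of_nonneg_left t3 hω0.le
      linarith
    · have : ramp ℓ lam p = 0 := max_eq_left (sub_nonpos.mpr (not_lt.mp hpR))
      change -(_ * ramp ℓ lam p) ≤ _
      rw [if_neg hpR, if_neg hpR, this]
      simp
  rw [integral_add ((BM.const _).mul bm1).integrableOn ((BM.const _).mul bm2).integrableOn,
    integral_const_mul, integral_const_mul] at hmono
  rw [← hl] at ibp
  rw [← ibp] at hmono
  -- The fraction 3/4 of the left-hand side is absorbed, so the factor 4 of `lam ^ 2` becomes 16.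
  linarith

-- The left factor is the layer width, of order ε ln N. Since ln N / σ ≤ κN for both weight
-- parameters and εN ≤ 1, the weight varies little across the layer.
include hD in
lemma mul_lam_le {κ : ℝ} (hc : w.Cond D κ) (hκ : κ * cornerConst P ≤ 1 / 2) {β : ℝ} (hβ : 0 < β)
    (hβ' : 5 / β ≤ cornerConst P) :
    5 / 2 * (D.ε / β) * Real.log D.N * (w.σβ⁻¹ + w.ση⁻¹) ≤ 1 / 2 := by
  have h1 := hc.hLA
  have h2 := hc.hLB
  have h3 := hD.ε_mul_le
  have h4 := hD.ε_pos
  calc 5 / 2 * (D.ε / β) * Real.log D.N * (w.σβ⁻¹ + w.ση⁻¹)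
      = 5 / β * (1 / 2 * D.ε * (Real.log D.N * w.σβ⁻¹ + Real.log D.N * w.ση⁻¹)) := by
        ring
    _ ≤ 5 / β * (1 / 2 * D.ε * (κ * D.N + κ * D.N)) := by gcongr
    _ = 5 / β * κ * (D.ε * D.N) := by ring
    _ ≤ 5 / β * κ * 1 := by
        have := hc.κ0
        gcongr
    _ ≤ cornerConst P * κ := by
        rw [mul_one]; exact mul_le_mul_of_nonneg_right hβ' hc.κ0
    _ ≤ 1 / 2 := by linarith

open scoped Classical in
/-- The weighted norm of the interpolation error in the layers. -/
lemma integral_errE_layer_le {κ : ℝ} (hc : w.Cond D κ) (hκ : κ * cornerConst P ≤ 1 / 2)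
    {f : ℝ × ℝ → ℝ} (hf : (gridX hD).BdryZero (gridY hD) f) :
    ∫ p in Omega, (if p ∈ OmegaS P D then 0 else (w.W p)⁻¹ * w.errE hD f p ^ 2)
      ≤ 8 * cornerConst P ^ 2 * D.ε * ∫ p in Omega, resid w hD f p := by
  set E := w.errE hD f with hEdef
  have hE : Lip E := lip_errE w hD hf
  have hE0 : ∀ p ∉ Omega, E p = 0 := fun p hp => errE_eq_zero w hD hf hp
  have b1 := P.β₁_pos
  have b2 := P.β₂_pos
  have c1 : 5 / P.β₁ ≤ cornerConst P := le_add_of_nonneg_right (by positivity)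
  have c2 : 5 / P.β₂ ≤ cornerConst P := le_add_of_nonneg_left (by positivity)
  have hdβ1 : |dot (1, 0) (dirBeta P)| ≤ 1 := (abs_dot_beta_le P _).trans (by simp)
  have hdη1 : |dot (1, 0) (dirEta P)| ≤ 1 := (abs_dot_eta_le P _).trans (by simp)
  have hdβ2 : |dot (0, 1) (dirBeta P)| ≤ 1 := (abs_dot_beta_le P _).trans (by simp)
  have hdη2 : |dot (0, 1) (dirEta P)| ≤ 1 := (abs_dot_eta_le P _).trans (by simp)
  have px := poincare (w := w) hE hE0 (ℓ := ContinuousLinearMap.fst ℝ ℝ ℝ) (e := (1, 0)) rfl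
    (fun p hp => hp.1.2.le) hD.lamX_pos.le hdβ1 hdη1
    (by rw [hD.lamX_eq]; exact mul_lam_le hD hc hκ b1 c1)
  have py := poincare (w := w) hE hE0 (ℓ := ContinuousLinearMap.snd ℝ ℝ ℝ) (e := (0, 1)) rfl
    (fun p hp => hp.2.2.le) hD.lamY_pos.le hdβ2 hdη2
    (by rw [hD.lamY_eq]; exact mul_lam_le hD hc hκ b2 c2)
  set SX := layer (ContinuousLinearMap.fst ℝ ℝ ℝ) (lamX P D)
  set SY := layer (ContinuousLinearMap.snd ℝ ℝ ℝ) (lamY P D)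
  have mX : MeasurableSet SX := measurableSet_lt measurable_const measurable_fst
  have mY : MeasurableSet SY := measurableSet_lt measurable_const measurable_snd
  have bmE : BM (fun p => (w.W p)⁻¹ * E p ^ 2) := (bm_W_inv w).mul hE.bm.sq
  have bmX := BM.ite mX bmE (BM.const 0)
  have bmY := BM.ite mY bmE (BM.const 0)
  have bmX' := BM.ite mX ((bm_W_inv w).mul (BM.dd_of_lip (1, 0) hE).sq) (BM.const 0)
  have bmY' := BM.ite mY ((bm_W_inv w).mul (BM.dd_of_lip (0, 1) hE).sq) (BM.const 0)
  -- The complement of Ω_s in the square is covered by two strips, each reaching the outflow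
  -- boundary in its own coordinate direction; the corner is counted twice.
  have hleft : ∫ p in Omega, (if p ∈ OmegaS P D then 0 else (w.W p)⁻¹ * E p ^ 2)
      ≤ ∫ p in Omega, ((if p ∈ SX then (w.W p)⁻¹ * E p ^ 2 else 0)
        + (if p ∈ SY then (w.W p)⁻¹ * E p ^ 2 else 0)) := by
    refine setIntegral_mono_on (BM.ite measurableSet_OmegaS (BM.const 0) bmE).integrableOn
      (bmX.add bmY).integrableOn measurableSet_Omega fun p hp => ?_
    have hnn : 0 ≤ (w.W p)⁻¹ * E p ^ 2 := by have := w.W_pos p; positivity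
    split_ifs with hS hx hy hy hx hy hy <;> try linarith
    exact absurd ⟨⟨hp.1.1.le, not_lt.mp hx⟩, ⟨hp.2.1.le, not_lt.mp hy⟩⟩ hS
  rw [integral_add bmX.integrableOn bmY.integrableOn] at hleft
  have hβ := dirBeta_sq P
  have hxy : ∀ p, dd (1, 0) E p ^ 2 + dd (0, 1) E p ^ 2
      = dd (dirBeta P) E p ^ 2 + dd (dirEta P) E p ^ 2 := by
    intro p
    simp only [dd]
    rw [e1_eq P, e2_eq P, map_sub, map_add, map_smul, map_smul, map_smul, map_smul]
    simp only [smul_eq_mul]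
    linear_combination (fderiv ℝ E p (dirBeta P) ^ 2 + fderiv ℝ E p (dirEta P) ^ 2) * hβ
  -- As `lam` is of order ε ln N, its square is ε times ε ln²N. The second factor is the coefficient
  -- built into `resid`; the first will cancel the 1/ε from Young's inequality.
  have hcomp : ∀ (s : Set (ℝ × ℝ)) (e : ℝ × ℝ) (lam : ℝ), 0 ≤ lam →
      (∀ p ∈ Omega, p ∈ s → p ∉ OmegaS P D) →
      (∀ p, dd e E p ^ 2 ≤ dd (dirBeta P) E p ^ 2 + dd (dirEta P) E p ^ 2) →
      lam ≤ cornerConst P / 2 * (D.ε * Real.log D.N) →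
      BM (fun p => if p ∈ s then (w.W p)⁻¹ * dd e E p ^ 2 else 0) →
      16 * lam ^ 2 * ∫ p in Omega, (if p ∈ s then (w.W p)⁻¹ * dd e E p ^ 2 else 0)
        ≤ 4 * cornerConst P ^ 2 * D.ε * ∫ p in Omega, resid w hD f p := by
    intro s e lam hlam hs he hle hbm
    rw [← integral_const_mul, ← integral_const_mul]
    refine setIntegral_mono_on ((BM.const _).mul hbm).integrableOn
      ((BM.const _).mul (bm_resid w hD hf)).integrableOn measurableSet_Omega fun p hp => ?_
    have hW := inv_pos.mpr (w.W_pos p)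
    have hε := hD.ε_pos
    have hεf := hD.εf_pos
    have hN := hD.cast_pos
    have hG : 0 ≤ gradE w hD f p := by unfold gradE; positivity
    split_ifs with h
    · rw [resid, if_neg (hs p hp h)]
      have g1 : (w.W p)⁻¹ * dd e E p ^ 2 ≤ gradE w hD f p := by
        rw [gradE, ← mul_add]; exact mul_le_mul_of_nonneg_left (he p) hW.le
      calc 16 * lam ^ 2 * ((w.W p)⁻¹ * dd e E p ^ 2)
          ≤ 16 * (cornerConst P / 2 * (D.ε * Real.log D.N)) ^ 2 * gradE w hD f p := by gcongr
        _ = 4 * cornerConst P ^ 2 * D.ε * (D.ε * Real.log D.N ^ 2 * gradE w hD f p) := by ring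
        _ ≤ _ := by
          refine mul_le_mul_of_nonneg_left ?_ (by positivity)
          refine mul_le_mul_of_nonneg_right ?_ hG
          linarith
    · rw [mul_zero]
      have : 0 ≤ resid w hD f p := by
        unfold resid
        split_ifs <;> positivity
      positivity
  have hlog := hD.log_ge
  have hε := hD.ε_pos
  have kx := hcomp SX (1, 0) (lamX P D) hD.lamX_pos.le
    (fun p _ h hS => absurd hS.1.2 (not_le.mpr h))
    (fun p => by rw [← hxy p]; linarith [sq_nonneg (dd (0, 1) E p)])
    (by rw [hD.lamX_eq]
        have := mul_le_mul_of_nonneg_right c1 (show 0 ≤ D.ε * Real.log D.N / 2 by positivity)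
        calc _ = 5 / P.β₁ * (D.ε * Real.log D.N / 2) := by ring
          _ ≤ _ := this
          _ = _ := by ring) bmX'
  have ky := hcomp SY (0, 1) (lamY P D) hD.lamY_pos.le
    (fun p _ h hS => absurd hS.2.2 (not_le.mpr h))
    (fun p => by rw [← hxy p]; linarith [sq_nonneg (dd (1, 0) E p)])
    (by rw [hD.lamY_eq]
        have := mul_le_mul_of_nonneg_right c2 (show 0 ≤ D.ε * Real.log D.N / 2 by positivity)
        calc _ = 5 / P.β₂ * (D.ε * Real.log D.N / 2) := by ring
          _ ≤ _ := this
          _ = _ := by ring) bmY'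
  linarith

end Poincare

end

/-! ### Coercivity of the form and absorption of the interpolation error -/

section

variable {P : Coeff} {D : Discr} {w : WeightData P} (hD : Admissible P D)

/-- The density of the bilinear form. -/
def adens (P : Coeff) (D : Discr) (u v : ℝ × ℝ → ℝ) (p : ℝ × ℝ) : ℝ :=
  D.ε * (dd (dirBeta P) u p * dd (dirBeta P) v p)
    + epsHat P D p * (dd (dirEta P) u p * dd (dirEta P) v p)
    + (bNorm P * dd (dirBeta P) u p + P.c * u p) * v p
    + (bNorm P * dd (dirBeta P) u p + P.c * u p) * (delta P D p * (bNorm P * dd (dirBeta P) v p))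

section Form

variable {u v : ℝ × ℝ → ℝ}

lemma bm_adens (hu : Lip u) (hv : Lip v) : BM (adens P D u v) := by
  have huβ := BM.dd_of_lip (dirBeta P) hu
  have hvβ := BM.dd_of_lip (dirBeta P) hv
  have h3 := ((BM.const (bNorm P)).mul huβ).add ((BM.const P.c).mul hu.bm)
  exact ((((BM.const D.ε).mul (huβ.mul hvβ)).add (bm_epsHat.mul
    ((BM.dd_of_lip (dirEta P) hu).mul (BM.dd_of_lip (dirEta P) hv)))).add (h3.mul hv.bm)).add
    (h3.mul (bm_delta.mul ((BM.const (bNorm P)).mul hvβ)))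

lemma aMSD_eq_integral (hu : Lip u) (hv : Lip v) :
    aMSD P D u v = ∫ p in Omega, adens P D u v p := by
  have huβ := BM.dd_of_lip (dirBeta P) hu
  have hvβ := BM.dd_of_lip (dirBeta P) hv
  have h1 := (BM.const D.ε).mul (huβ.mul hvβ)
  have h2 := (bm_epsHat (P := P) (D := D)).mul
    ((BM.dd_of_lip (dirEta P) hu).mul (BM.dd_of_lip (dirEta P) hv))
  have h3 := ((BM.const (bNorm P)).mul huβ).add ((BM.const P.c).mul hu.bm)
  have h4 := h3.mul ((bm_delta (P := P) (D := D)).mul ((BM.const (bNorm P)).mul hvβ))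
  have h5 := h3.mul hv.bm
  unfold aMSD adens
  rw [integral_add ((h1.add h2).add h5).integrableOn h4.integrableOn,
    integral_add (h1.add h2).integrableOn h5.integrableOn,
    integral_add h1.integrableOn h2.integrableOn]

/-- Integration by parts of a part of the convective term. -/
lemma integral_adens_eq (hu : Lip u) (hv : Lip v) (h0 : ∀ p ∉ Omega, v p = 0) (t : ℝ) :
    ∫ p in Omega, adens P D u v p = ∫ p in Omega, (adens P D u v p
      - t * (dd (dirBeta P) u p * v p + dd (dirBeta P) v p * u p)) := by
  have h1 := (BM.dd_of_lip (dirBeta P) hu).mul hv.bm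
  have h2 := (BM.dd_of_lip (dirBeta P) hv).mul hu.bm
  -- Any multiple of the streamline derivative of `u * v` may be subtracted, as its integral
  -- vanishes. Later t = b/2 gives coercivity, and t = b moves the whole convective derivative onto
  -- `v`.
  rw [integral_sub (bm_adens hu hv).integrableOn ((BM.const t).mul (h1.add h2)).integrableOn,
    integral_const_mul, integral_add h1.integrableOn h2.integrableOn,
    integral_dd_mul hu hv h0 (dirBeta P)]
  ring

lemma integral_adens_sub {u' : ℝ × ℝ → ℝ} (hu : Lip u) (hu' : Lip u') (hv : Lip v) :
    ∫ p in Omega, adens P D (fun q => u q - u' q) v p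
      = (∫ p in Omega, adens P D u v p) - ∫ p in Omega, adens P D u' v p := by
  rw [← integral_sub (bm_adens hu hv).integrableOn (bm_adens hu' hv).integrableOn]
  refine integral_congr_ae ?_
  filter_upwards [ae_restrict_of_ae hu.ae_differentiableAt,
    ae_restrict_of_ae hu'.ae_differentiableAt] with p h1 h2
  have h3 : ∀ ζ, dd ζ (fun q => u q - u' q) p = dd ζ u p - dd ζ u' p := fun ζ => by
    simp only [dd]
    rw [show fderiv ℝ (fun q => u q - u' q) p = _ from (h1.hasFDerivAt.sub h2.hasFDerivAt).fderiv]
    rfl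
  simp only [adens, h3]
  ring

end Form

section Pointwise

/-- Young's inequality with weights. -/
lemma young {W ω : ℝ} (hω : 0 ≤ ω) (h : W * ω = 1) {s : ℝ} (hs : 0 < s) {a : ℝ} (ha : 0 ≤ a)
    (x y : ℝ) : a * (x * y) ≤ s / 2 * (a * W * y ^ 2) + 1 / (2 * s) * (a * (ω * x ^ 2)) := by
  have h1 : 0 ≤ ω * (x - s * W * y) ^ 2 := by positivity
  have h2 : ω * (x - s * W * y) ^ 2 = ω * x ^ 2 - 2 * s * (x * y) + s ^ 2 * (W * y ^ 2) := by
    linear_combination (-2 * s * x * y + s ^ 2 * W * y ^ 2) * h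
  have h3 : x * y ≤ s / 2 * (W * y ^ 2) + 1 / (2 * s) * (ω * x ^ 2) := by
    have e : s / 2 * (W * y ^ 2) + 1 / (2 * s) * (ω * x ^ 2)
        = (s ^ 2 * (W * y ^ 2) + ω * x ^ 2) / (2 * s) := by field_simp
    rw [e, le_div_iff₀ (by positivity)]
    linarith
  linarith [mul_le_mul_of_nonneg_left h3 ha]

lemma young_neg {W ω : ℝ} (hω : 0 ≤ ω) (h : W * ω = 1) {s : ℝ} (hs : 0 < s) {a : ℝ} (ha : 0 ≤ a)
    (x y : ℝ) : -(s / 2 * (a * W * y ^ 2) + 1 / (2 * s) * (a * (ω * x ^ 2))) ≤ a * (x * y) := by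
  have := young hω h hs ha (-x) y
  rw [neg_sq] at this
  linarith

/-- The constant in the upper bound of the bilinear form in the coarse region. -/
def contConst (P : Coeff) : ℝ :=
  6 + 8 * bNorm P ^ 2 * P.Cstar + 8 / P.Cstar + 2 * P.c + 8 * P.c ^ 2 * P.Cstar

-- After the subtraction, convection appears as the error times the streamline derivative of the
-- Green function. On Ω_s that derivative is absorbed by the stabilization, at the cost of N times
-- the squared error. Elsewhere it must be absorbed by the diffusion ε, which produces the last term
-- with 1/ε.
include hD in
open scoped Classical in
lemma adens_errE_le (f : ℝ × ℝ → ℝ) (p : ℝ × ℝ) :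
    adens P D (w.errE hD f) (fem hD f) p - bNorm P * (dd (dirBeta P) (w.errE hD f) p * fem hD f p
      + dd (dirBeta P) (fem hD f) p * w.errE hD f p)
    ≤ 1 / 8 * edens D w (fem hD f) p + contConst P * resid w hD f p
      + (4 * bNorm P ^ 2 + 2 * P.c) / D.ε *
        (if p ∈ OmegaS P D then 0 else (w.W p)⁻¹ * w.errE hD f p ^ 2) := by
  have hb := bNorm_pos P
  have hcp := P.c_pos
  have hCs := P.Cstar_pos
  have hN := hD.cast_pos
  have hN2 := hD.two_le_cast
  have hε := hD.ε_pos
  have hεs := hD.εs_pos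
  have hεf := hD.εf_pos
  have hW := w.W_pos p
  have hV := w.V_pos p
  have hω : 0 < (w.W p)⁻¹ := inv_pos.mpr hW
  have h1 : w.W p * (w.W p)⁻¹ = 1 := mul_inv_cancel₀ hW.ne'
  have hVg : 0 ≤ bNorm P / 2 * w.V p * fem hD f p ^ 2 := by positivity
  unfold adens edens wdens resid gradE epsHat delta
  set x := dd (dirBeta P) (w.errE hD f) p
  set y := dd (dirEta P) (w.errE hD f) p
  set e := w.errE hD f p
  set X := dd (dirBeta P) (fem hD f) p
  set Y := dd (dirEta P) (fem hD f) p
  set g := fem hD f p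
  set W := w.W p
  set ω := W⁻¹
  have nx : 0 ≤ ω * x ^ 2 := by positivity
  have ny : 0 ≤ ω * y ^ 2 := by positivity
  have ne : 0 ≤ ω * e ^ 2 := by positivity
  split_ifs with hS
  · set n := (D.N : ℝ)⁻¹ with hn
    have hn0 : 0 < n := inv_pos.mpr hN
    have hnN : n * D.N = 1 := inv_mul_cancel₀ hN.ne'
    have ε1 : D.ε ≤ n := by rw [hn, ← one_div]; exact hD.ε_le
    have ε2 : D.εs ≤ n := by rw [hn, ← one_div]; exact hD.εs_le
    have hδ : P.Cstar / D.N = P.Cstar * n := div_eq_mul_inv _ _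
    rw [hδ]
    have y1 := young hω.le h1 (show (0 : ℝ) < 1 / 4 by norm_num) hε.le x X
    have y2 := young hω.le h1 (show (0 : ℝ) < 1 / 4 by norm_num) hεs.le y Y
    -- The weights are chosen so that `y3`, `y5` and `y6` each take 1/32 of the stabilization
    -- energy, together 3/32, which is less than the 1/8 allowed. The remaining three inequalities
    -- take 1/8 of their own energy terms.
    have y3 := young hω.le h1 (show (0 : ℝ) < 1 / 16 * bNorm P * (P.Cstar * n) by positivity) hb.le
      (-e) X
    have y4 := young hω.le h1 (show (0 : ℝ) < 1 / 4 by norm_num) hcp.le e g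
    have y5 := young hω.le h1 (show (0 : ℝ) < 1 / 16 by norm_num)
      (show 0 ≤ bNorm P ^ 2 * (P.Cstar * n) by positivity) x X
    have y6 := young hω.le h1 (show (0 : ℝ) < 1 / 16 * bNorm P by positivity)
      (show 0 ≤ bNorm P * (P.Cstar * n) by positivity) (P.c * e) X
    have e3 : 1 / (2 * (1 / 16 * bNorm P * (P.Cstar * n))) * (bNorm P * (ω * (-e) ^ 2))
        = 8 / P.Cstar * (D.N * (ω * e ^ 2)) := by
      have : (D.N : ℝ) = n⁻¹ := by rw [hn, inv_inv]
      rw [this]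
      field_simp
      ring
    have e6 : 1 / (2 * (1 / 16 * bNorm P)) * (bNorm P * (P.Cstar * n) * (ω * (P.c * e) ^ 2))
        = 8 * P.c ^ 2 * P.Cstar * (n * (ω * e ^ 2)) := by
      field_simp
      ring
    rw [e3] at y3
    rw [e6] at y6
    have b1 := mul_le_mul_of_nonneg_right ε1 nx
    have b2 := mul_le_mul_of_nonneg_right ε2 ny
    have hnN' : n ≤ D.N := by
      have : n ≤ 1 := by rw [hn, ← one_div]; exact hD.inv_le_one
      linarith
    have b6 := mul_le_mul_of_nonneg_left (mul_le_mul_of_nonneg_right hnN' ne)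
      (show 0 ≤ 8 * P.c ^ 2 * P.Cstar by positivity)
    have b4 := mul_le_mul_of_nonneg_left (le_mul_of_one_le_left ne (show 1 ≤ (D.N : ℝ) by linarith))
      (show 0 ≤ 2 * P.c by positivity)
    have m1 : 0 ≤ n * (ω * x ^ 2) := by positivity
    have m2 : 0 ≤ n * (ω * y ^ 2) := by positivity
    have m3 : 0 ≤ D.N * (ω * e ^ 2) := by positivity
    have k1 : 0 ≤ 8 * bNorm P ^ 2 * P.Cstar := by positivity
    have k2 : 0 ≤ 8 / P.Cstar := by positivity
    have k3 : 0 ≤ 8 * P.c ^ 2 * P.Cstar := by positivity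
    have K1 : (2 + 8 * bNorm P ^ 2 * P.Cstar) * (n * (ω * x ^ 2)) ≤
        contConst P * (n * (ω * x ^ 2)) := by
      refine mul_le_mul_of_nonneg_right ?_ m1
      unfold contConst; linarith
    have K2 : 2 * (n * (ω * y ^ 2)) ≤ contConst P * (n * (ω * y ^ 2)) := by
      refine mul_le_mul_of_nonneg_right ?_ m2
      unfold contConst; linarith
    have K3 : (8 / P.Cstar + 2 * P.c + 8 * P.c ^ 2 * P.Cstar) * (D.N * (ω * e ^ 2)) ≤
        contConst P * (D.N * (ω * e ^ 2)) := by
      refine mul_le_mul_of_nonneg_right ?_ m3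
      unfold contConst; linarith
    have m4 : 0 ≤ bNorm P ^ 2 * (P.Cstar * n) * W * X ^ 2 := by positivity
    rw [mul_zero]
    linarith
  · have y1 := young hω.le h1 (show (0 : ℝ) < 1 / 8 by norm_num) hε.le x X
    have y2 := young hω.le h1 (show (0 : ℝ) < 1 / 4 by norm_num) hεf.le y Y
    have y3 := young hω.le h1 (show (0 : ℝ) < 1 / 8 by norm_num) hε.le (-(bNorm P / D.ε * e)) X
    have y4 := young hω.le h1 (show (0 : ℝ) < 1 / 4 by norm_num) hcp.le e g
    have e3 : 1 / (2 * (1 / 8)) * (D.ε * (ω * (-(bNorm P / D.ε * e)) ^ 2))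
        = 4 * bNorm P ^ 2 / D.ε * (ω * e ^ 2) := by
      field_simp
      ring
    have e3' : D.ε * (-(bNorm P / D.ε * e) * X) = -(bNorm P * (e * X)) := by
      field_simp
    rw [e3, e3'] at y3
    have hε1 : D.ε ≤ 1 := hD.ε_le.trans hD.inv_le_one
    have b4 : 2 * P.c * (ω * e ^ 2) ≤ 2 * P.c / D.ε * (ω * e ^ 2) := by
      refine mul_le_mul_of_nonneg_right ?_ ne
      rw [le_div_iff₀ hε]
      exact mul_le_of_le_one_right (by positivity) hε1
    have b1 := mul_le_mul_of_nonneg_right hD.εf_ge nx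
    have n0 : 0 ≤ D.ε * Real.log D.N ^ 2 * (ω * x ^ 2 + ω * y ^ 2) := by positivity
    have n1 : 0 ≤ D.εf * (ω * x ^ 2) := by positivity
    have n2 : 0 ≤ D.εf * (ω * y ^ 2) := by positivity
    have K : 6 * ((D.εf + D.ε * Real.log D.N ^ 2) * (ω * x ^ 2 + ω * y ^ 2)) ≤
        contConst P * ((D.εf + D.ε * Real.log D.N ^ 2) * (ω * x ^ 2 + ω * y ^ 2)) := by
      refine mul_le_mul_of_nonneg_right ?_ (by positivity)
      have k1 : 0 ≤ 8 * bNorm P ^ 2 * P.Cstar := by positivity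
      have k2 : 0 ≤ 8 / P.Cstar := by positivity
      have k3 : 0 ≤ 8 * P.c ^ 2 * P.Cstar := by positivity
      unfold contConst; linarith
    rw [add_div, add_mul]
    linarith

include hD in
/-- Pointwise coercivity. -/
lemma edens_le_adens {κ : ℝ} (hc : w.Cond D κ) (hκb : 8 * κ ≤ bNorm P) (hκb' : 32 * bNorm P * κ ≤ 1)
    (hκc : 6 * κ ≤ P.c) {G : ℝ × ℝ → ℝ} {p : ℝ × ℝ} (hG : DifferentiableAt ℝ G p) :
    1 / 2 * edens D w G p ≤ adens P D (fun q => w.W q * G q) G p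
      - bNorm P / 2 * (dd (dirBeta P) (fun q => w.W q * G q) p * G p
        + dd (dirBeta P) G p * (w.W p * G p)) := by
  have hb := bNorm_pos P
  have hcp := P.c_pos
  have hCs := P.Cstar_pos
  have hN := hD.cast_pos
  have hε := hD.ε_pos
  have hW := w.W_pos p
  have hV := w.V_pos p
  have hω : 0 < (w.W p)⁻¹ := inv_pos.mpr hW
  have h1 : w.W p * (w.W p)⁻¹ = 1 := mul_inv_cancel₀ hW.ne'
  have hprod : ∀ ζ, dd ζ (fun q => w.W q * G q) p = dd ζ w.W p * G p + w.W p * dd ζ G p := by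
    intro ζ
    have h3 := (w.hasFDerivAt_W p).mul hG.hasFDerivAt
    simp only [dd]
    rw [show fderiv ℝ (fun q => w.W q * G q) p = _ from h3.fderiv, (w.hasFDerivAt_W p).fderiv]
    simp
    ring
  have hδ0 : 0 ≤ delta P D p := by unfold delta; split_ifs <;> positivity
  have hδσ : delta P D p * w.σβ⁻¹ ≤ κ := by
    unfold delta
    split_ifs
    · exact hc.hδ
    · rw [zero_mul]; exact hc.κ0
  have hδc : P.c * delta P D p ≤ 1 / 2 := by
    unfold delta
    split_ifs
    · exact hD.stab
    · rw [mul_zero]; norm_num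
  have hê0 : 0 ≤ epsHat P D p := by
    unfold epsHat; split_ifs
    · exact hD.εs_pos.le
    · exact hD.εf_pos.le
  have hêσ : epsHat P D p * w.ση⁻¹ ^ 2 ≤ κ := by
    unfold epsHat; split_ifs
    · exact hc.hs'
    · exact hc.hf
  have hεσ := hc.hε
  have hVle : (w.W p)⁻¹ * w.V p ^ 2 ≤ w.σβ⁻¹ * w.V p := by
    have := mul_le_mul_of_nonneg_left (w.V_le p) (mul_nonneg hω.le hV.le)
    calc _ = (w.W p)⁻¹ * w.V p * w.V p := by ring
      _ ≤ _ := this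
      _ = w.W p * (w.W p)⁻¹ * (w.σβ⁻¹ * w.V p) := by rw [div_eq_mul_inv]; ring
      _ = _ := by rw [h1, one_mul]
  have hZle : (w.W p)⁻¹ * w.Z p ^ 2 ≤ w.ση⁻¹ ^ 2 * w.W p := by
    have := pow_le_pow_left₀ (abs_nonneg _) (w.abs_Z_le p) 2
    rw [sq_abs] at this
    calc _ ≤ (w.W p)⁻¹ * (w.W p / w.ση) ^ 2 := mul_le_mul_of_nonneg_left this hω.le
      _ = w.W p * (w.W p)⁻¹ * (w.ση⁻¹ ^ 2 * w.W p) := by rw [div_eq_mul_inv]; ring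
      _ = _ := by rw [h1, one_mul]
  unfold adens edens wdens
  simp only [hprod, w.dd_beta_W, w.dd_eta_W]
  set δ := delta P D p
  set ê := epsHat P D p
  set X := dd (dirBeta P) G p
  set Y := dd (dirEta P) G p
  set g := G p
  set W := w.W p
  set V := w.V p
  set Z := w.Z p
  -- Convection and the subtracted derivative combine to b/2 V g². Of this, `y1` and `y3` spend b/8
  -- each on derivatives falling on the weight, leaving the required b/4. Of the reaction term, `y2`
  -- spends c/6.
  have y1 := young_neg hω.le h1 (show (0 : ℝ) < 1 / 2 by norm_num) hε.le (V * g) X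
  have y2 := young_neg hω.le h1 (show (0 : ℝ) < 1 / 2 by norm_num) hê0 (Z * g) Y
  have y3 := young_neg hω.le h1 (show (0 : ℝ) < 1 / 8 by norm_num)
    (show 0 ≤ bNorm P ^ 2 * δ by positivity) (V * g) X
  -- The split 3/8 and 2/3 is two thirds of the displayed square. With cδ ≤ 1/2 the reaction loses
  -- c/3, which with the c/6 of `y2` is exactly one half; the stabilization loses 3/8 + 1/16 < 1/2.
  have y4 : -(3 / 8 * (bNorm P ^ 2 * δ * W * X ^ 2) + 2 / 3 * (P.c * δ * (P.c * W * g ^ 2)))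
      ≤ bNorm P * P.c * δ * (W * g * X) := by
    have := mul_nonneg (mul_nonneg hδ0 hW.le) (sq_nonneg (3 / 4 * bNorm P * X + P.c * g))
    linarith
  have hVg : 0 ≤ V * g ^ 2 := by positivity
  have hWg : 0 ≤ W * g ^ 2 := by positivity
  have t1 : D.ε * (W⁻¹ * (V * g) ^ 2) ≤ κ * (V * g ^ 2) := by
    calc D.ε * (W⁻¹ * (V * g) ^ 2) = W⁻¹ * V ^ 2 * (D.ε * g ^ 2) := by ring
      _ ≤ w.σβ⁻¹ * V * (D.ε * g ^ 2) := mul_le_mul_of_nonneg_right hVle (by positivity)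
      _ = D.ε * w.σβ⁻¹ * (V * g ^ 2) := by ring
      _ ≤ _ := mul_le_mul_of_nonneg_right hεσ hVg
  have t2 : ê * (W⁻¹ * (Z * g) ^ 2) ≤ κ * (W * g ^ 2) := by
    calc ê * (W⁻¹ * (Z * g) ^ 2) = W⁻¹ * Z ^ 2 * (ê * g ^ 2) := by ring
      _ ≤ w.ση⁻¹ ^ 2 * W * (ê * g ^ 2) := mul_le_mul_of_nonneg_right hZle (by positivity)
      _ = ê * w.ση⁻¹ ^ 2 * (W * g ^ 2) := by ring
      _ ≤ _ := mul_le_mul_of_nonneg_right hêσ hWg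
  have t3 : bNorm P ^ 2 * δ * (W⁻¹ * (V * g) ^ 2) ≤ bNorm P ^ 2 * κ * (V * g ^ 2) := by
    calc bNorm P ^ 2 * δ * (W⁻¹ * (V * g) ^ 2)
        = W⁻¹ * V ^ 2 * (bNorm P ^ 2 * δ * g ^ 2) := by ring
      _ ≤ w.σβ⁻¹ * V * (bNorm P ^ 2 * δ * g ^ 2) :=
        mul_le_mul_of_nonneg_right hVle (by positivity)
      _ = bNorm P ^ 2 * (δ * w.σβ⁻¹) * (V * g ^ 2) := by ring
      _ ≤ _ := mul_le_mul_of_nonneg_right (mul_le_mul_of_nonneg_left hδσ (by positivity)) hVg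
  have t4 := mul_le_mul_of_nonneg_right hδc (show 0 ≤ P.c * W * g ^ 2 by positivity)
  have s1 := mul_le_mul_of_nonneg_right hκb hVg
  have s2 := mul_le_mul_of_nonneg_left hκb' (mul_nonneg hb.le hVg)
  have s3 := mul_le_mul_of_nonneg_right hκc hWg
  have n1 : 0 ≤ D.ε * W * X ^ 2 := by positivity
  have n2 : 0 ≤ ê * W * Y ^ 2 := by positivity
  have n3 : 0 ≤ bNorm P ^ 2 * δ * W * X ^ 2 := by positivity
  linarith

end Pointwise

/-- The constant in the upper bound of the bilinear form. -/
def stabConst (P : Coeff) : ℝ :=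
  contConst P + 8 * cornerConst P ^ 2 * (4 * bNorm P ^ 2 + 2 * P.c)

lemma stabConst_pos (P : Coeff) : 0 < stabConst P := by
  have := P.c_pos
  have := P.Cstar_pos
  have := bNorm_pos P
  unfold stabConst contConst
  positivity

/-- The weighted energy is controlled by the form. -/
lemma integral_edens_le {κ : ℝ} (hc : w.Cond D κ) (hκb : 8 * κ ≤ bNorm P)
    (hκb' : 32 * bNorm P * κ ≤ 1) (hκc : 6 * κ ≤ P.c) (hκ1 : κ * cornerConst P ≤ 1 / 2)
    (hκ2 : stabConst P * residConst P * κ ≤ 1 / 8) {f : ℝ × ℝ → ℝ}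
    (hf : (gridX hD).BdryZero (gridY hD) f) :
    ∫ p in Omega, edens D w (fem hD f) p
      ≤ 4 * aMSD P D (fem hD (fun q => w.W q * fem hD f q)) (fem hD f) := by
  classical
  have hG := lip_fem hD f
  have hG0 : ∀ p ∉ Omega, fem hD f p = 0 := fun p hp => fem_eq_zero hD hf hp
  have hE := lip_errE w hD hf
  have hWG := lip_W_fem w hD hf
  have hI := lip_fem hD (fun q => w.W q * fem hD f q)
  have hε := hD.ε_pos
  have hb := bNorm_pos P
  have hcp := P.c_pos
  have lower : 1 / 2 * ∫ p in Omega, edens D w (fem hD f) p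
      ≤ ∫ p in Omega, adens P D (fun q => w.W q * fem hD f q) (fem hD f) p := by
    rw [integral_adens_eq hWG hG hG0 (bNorm P / 2), ← integral_const_mul]
    refine integral_mono_ae ((BM.const _).mul (bm_edens w hG)).integrableOn
      ((bm_adens hWG hG).sub ((BM.const _).mul (((BM.dd_of_lip _ hWG).mul hG.bm).add
        ((BM.dd_of_lip _ hG).mul hWG.bm)))).integrableOn ?_
    filter_upwards [ae_restrict_of_ae hG.ae_differentiableAt] with p hp
    exact edens_le_adens hD hc hκb hκb' hκc hp
  have split := integral_adens_sub (P := P) (D := D) hWG hI hG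
  have bmL : BM (fun p => if p ∈ OmegaS P D then 0 else (w.W p)⁻¹ * w.errE hD f p ^ 2) :=
    BM.ite measurableSet_OmegaS (BM.const 0) ((bm_W_inv w).mul hE.bm.sq)
  have upper : ∫ p in Omega, adens P D (w.errE hD f) (fem hD f) p
      ≤ 1 / 8 * (∫ p in Omega, edens D w (fem hD f) p)
        + contConst P * (∫ p in Omega, resid w hD f p)
        + (4 * bNorm P ^ 2 + 2 * P.c) / D.ε * ∫ p in Omega,
          (if p ∈ OmegaS P D then 0 else (w.W p)⁻¹ * w.errE hD f p ^ 2) := by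
    -- The full factor b, unlike the b/2 of the lower bound: the streamline derivative of the error
    -- has no sufficient bound against the Green function itself, so all of it is moved.
    rw [integral_adens_eq hE hG hG0 (bNorm P), ← integral_const_mul, ← integral_const_mul,
      ← integral_const_mul]
    have i1 := (BM.const (1 / 8)).mul (bm_edens (D := D) w hG)
    have i2 := (BM.const (contConst P)).mul (bm_resid w hD hf)
    have i3 := (BM.const ((4 * bNorm P ^ 2 + 2 * P.c) / D.ε)).mul bmL
    rw [← integral_add i1.integrableOn i2.integrableOn,
      ← integral_add (i1.add i2).integrableOn i3.integrableOn]
    exact integral_mono ((bm_adens hE hG).sub ((BM.const _).mul (((BM.dd_of_lip _ hE).mul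
      hG.bm).add ((BM.dd_of_lip _ hG).mul hE.bm)))).integrableOn
      ((i1.add i2).add i3).integrableOn fun p => adens_errE_le hD f p
  have layer := mul_le_mul_of_nonneg_left (integral_errE_layer_le hD hc hκ1 hf)
    (show 0 ≤ (4 * bNorm P ^ 2 + 2 * P.c) / D.ε by positivity)
  -- The ε gained from the Poincaré inequality cancels the 1/ε, leaving a constant independent of
  -- the discretization.
  have hlayer : (4 * bNorm P ^ 2 + 2 * P.c) / D.ε
      * (8 * cornerConst P ^ 2 * D.ε * ∫ p in Omega, resid w hD f p)
      = 8 * cornerConst P ^ 2 * (4 * bNorm P ^ 2 + 2 * P.c) * ∫ p in Omega, resid w hD f p := by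
    field_simp
  rw [hlayer] at layer
  have hres := mul_le_mul_of_nonneg_left (integral_resid_le hD hc hf) (stabConst_pos P).le
  have hX : 0 ≤ ∫ p in Omega, edens D w (fem hD f) p :=
    setIntegral_nonneg measurableSet_Omega fun p _ => edens_nonneg hD w p
  have hfin := mul_le_mul_of_nonneg_right hκ2 hX
  rw [aMSD_eq_integral hI hG]
  change ∫ p in Omega, adens P D (w.errE hD f) (fem hD f) p = _ at split
  have hs : stabConst P * ∫ p in Omega, resid w hD f p
      = contConst P * (∫ p in Omega, resid w hD f p)
        + 8 * cornerConst P ^ 2 * (4 * bNorm P ^ 2 + 2 * P.c) * ∫ p in Omega, resid w hD f p := by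
    unfold stabConst; ring
  -- The balance is 1/2 from coercivity, minus 1/8 from Young's inequalities, minus 1/8 from the
  -- residual by the choice of κ; the remaining 1/4 explains the factor 4.
  linarith

end

/-! ### Bounds of nodal values by the weighted energy -/

section

variable {P : Coeff} {D : Discr} {w : WeightData P} (hD : Admissible P D)

/-- The rectangle with half the legs fits into the triangle. Negative legs correspond to upper right
triangles, whose anchor is the upper right corner of the cell. -/
lemma rtri_volume_ge {a d : ℝ × ℝ} (h1 : d.1 < 0) (h2 : d.2 < 0) (hfin : volume (rtri a d) ≠ ⊤) :
    |d.1| * |d.2| / 4 ≤ volume.real (rtri a d) := by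
  have hsub : Ioo (a.1 + d.1 / 2) a.1 ×ˢ Ioo (a.2 + d.2 / 2) a.2 ⊆ rtri a d := by
    rintro p ⟨⟨hx, hx'⟩, ⟨hy, hy'⟩⟩
    have key : ∀ {x a d : ℝ}, d < 0 → a + d / 2 < x → x < a → 0 < (x - a) / d ∧ (x - a) / d < 1 / 2 := by
      intro x a d hd l u
      exact ⟨div_pos_of_neg_of_neg (by linarith) hd, by rw [div_lt_iff_of_neg hd]; linarith⟩
    obtain ⟨k1, k2⟩ := key h1 hx hx'
    obtain ⟨k3, k4⟩ := key h2 hy hy'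
    exact ⟨k1, k3, by linarith⟩
  have h := measureReal_mono hsub hfin
  rw [Measure.volume_eq_prod, measureReal_prod_prod, Real.volume_real_Ioo_of_le (by linarith),
    Real.volume_real_Ioo_of_le (by linarith)] at h
  rw [abs_of_neg h1, abs_of_neg h2, Measure.volume_eq_prod]
  linarith

lemma anc_add_fst (k l : ℕ) : anc hD (k, l, true) + ((leg hD (k, l, true)).1, 0)
    = (meshX P D k, meshY P D (l + 1)) := by
  change (meshX P D (k + 1), meshY P D (l + 1)) + (meshX P D k - meshX P D (k + 1), 0) = _
  simp

lemma anc_add_snd (k l : ℕ) : anc hD (k, l, true) + (0, (leg hD (k, l, true)).2)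
    = (meshX P D (k + 1), meshY P D l) := by
  change (meshX P D (k + 1), meshY P D (l + 1)) + (0, meshY P D l - meshY P D (l + 1)) = _
  simp

include hD in
lemma wdens_le_edens (G : ℝ × ℝ → ℝ) (p : ℝ × ℝ) :
    wdens w D.ε D.ε (bNorm P / 2) 0 G p ≤ edens D w G p := by
  have hW := w.W_pos p
  have hcp := P.c_pos
  have hδ0 : 0 ≤ delta P D p := by
    have := P.Cstar_pos
    unfold delta; split_ifs <;> positivity
  have hê : D.ε ≤ epsHat P D p := by
    unfold epsHat; split_ifs
    · exact hD.εs_ge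
    · exact hD.εf_ge
  unfold edens wdens
  have n1 : 0 ≤ bNorm P ^ 2 * delta P D p * w.W p * dd (dirBeta P) G p ^ 2 := by positivity
  have n2 := mul_le_mul_of_nonneg_right hê
    (show 0 ≤ w.W p * dd (dirEta P) G p ^ 2 by positivity)
  have n3 : 0 ≤ P.c * w.W p * G p ^ 2 := by positivity
  linarith

/-- Local bounds for the nodal values and their differences by the local energy. -/
lemma nodal_bounds {κ : ℝ} (hc : w.Cond D κ) (f : ℝ × ℝ → ℝ) {k l : ℕ} (hk : k < D.N)
    (hl : l < D.N) :
    let hx := meshX P D (k + 1) - meshX P D k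
    let hy := meshY P D (l + 1) - meshY P D l
    let q := (meshX P D (k + 1), meshY P D (l + 1))
    let I := ∫ p in tria hD (k, l, true), edens D w (fem hD f) p
    hx * hy * (bNorm P * w.V q * fem hD f q ^ 2) ≤ 1024 * I ∧
    hy * (D.ε * (fem hD f (meshX P D k, meshY P D (l + 1)) - fem hD f q) ^ 2) ≤ 1024 * hx * I ∧
    hx * (D.ε * (fem hD f (meshX P D (k + 1), meshY P D l) - fem hD f q) ^ 2)
      ≤ 1024 * hy * I := by
  intro hx hy q I
  set τ : ℕ × ℕ × Bool := (k, l, true) with hτdef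
  have hτ : τ ∈ Grid.pieces D.N := Grid.mem_pieces.mpr ⟨hk, hl⟩
  obtain ⟨hlβ, hlη⟩ := hc.leg_le hD hτ
  obtain ⟨m, g, hm, hG0, hgx, hgy, -, -, -, hdens⟩ := exists_piece_data w hD f hτ hlβ hlη
  have hb := bNorm_pos P
  have hε := hD.ε_pos
  have hxpos : 0 < hx := sub_pos.mpr ((gridX hD).lt k hk)
  have hypos : 0 < hy := sub_pos.mpr ((gridY hD).lt l hl)
  have hleg1 : (leg hD τ).1 = -hx := (neg_sub _ _).symm
  have hleg2 : (leg hD τ).2 = -hy := (neg_sub _ _).symm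
  have hvol := rtri_volume_ge (a := anc hD τ) (d := leg hD τ) (by rw [hleg1]; linarith)
    (by rw [hleg2]; linarith) (volume_tria_ne_top hD hτ)
  rw [hleg1, hleg2, abs_neg, abs_neg, abs_of_pos hxpos, abs_of_pos hypos] at hvol
  rw [hτdef, anc_add_fst hD, ← hτdef, hleg1] at hgx
  rw [hτdef, anc_add_snd hD, ← hτdef, hleg2] at hgy
  change g.1 * -hx = fem hD f (meshX P D k, meshY P D (l + 1)) - fem hD f q at hgx
  change g.2 * -hy = fem hD f (meshX P D (k + 1), meshY P D l) - fem hD f q at hgy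
  rw [← hgx, ← hgy]
  have hd := hdens D.ε D.ε (bNorm P / 2) 0 hε.le hε.le (by positivity) le_rfl
  have hmono : ∫ p in tria hD τ, wdens w D.ε D.ε (bNorm P / 2) 0 (fem hD f) p ≤ I := by
    refine integral_mono
      ((bm_wdens w _ _ _ _ (lip_fem hD f)).integrableOn.mono_set (tria_subset_Omega hD hτ))
      ((bm_edens w (lip_fem hD f)).integrableOn.mono_set (tria_subset_Omega hD hτ))
      fun p => wdens_le_edens hD _ p
  have hW := w.half_le_W (anc hD τ)
  have hV := w.V_pos (anc hD τ)
  have hgs : dot (dirBeta P) g ^ 2 + dot (dirEta P) g ^ 2 = g.1 ^ 2 + g.2 ^ 2 := by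
    simp only [dot, dirEta_fst, dirEta_snd]
    linear_combination (g.1 ^ 2 + g.2 ^ 2) * dirBeta_sq P
  have hm2 : fem hD f q ^ 2 ≤ m ^ 2 := by
    have := pow_le_pow_left₀ (abs_nonneg _) hG0 2
    rwa [sq_abs] at this
  have hVm := mul_le_mul_of_nonneg_left hm2 (show 0 ≤ bNorm P / 2 * w.V (anc hD τ) by positivity)
  have hWg := mul_le_mul_of_nonneg_right hW
    (show 0 ≤ D.ε * (g.1 ^ 2 + g.2 ^ 2) by positivity)
  have hkey : D.ε * (g.1 ^ 2 + g.2 ^ 2) / 2 + bNorm P / 2 * w.V q * fem hD f q ^ 2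
      ≤ D.ε * w.W (anc hD τ) * dot (dirBeta P) g ^ 2 + D.ε * w.W (anc hD τ) * dot (dirEta P) g ^ 2
        + (bNorm P / 2 * w.V (anc hD τ) + 0 * w.W (anc hD τ)) * m ^ 2 := by
    have e : D.ε * w.W (anc hD τ) * dot (dirBeta P) g ^ 2
        + D.ε * w.W (anc hD τ) * dot (dirEta P) g ^ 2
        = w.W (anc hD τ) * (D.ε * (g.1 ^ 2 + g.2 ^ 2)) := by
      rw [← hgs]; ring
    rw [e]
    have hq : anc hD τ = q := rfl
    rw [hq] at hVm hWg ⊢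
    linarith
  have hVq : 0 < w.V q := hV
  -- The area bound costs 4, and the lower bound W ≥ 1/2 or the coefficient b/2 costs 2; with 128
  -- this makes 1024.
  have hfin : hx * hy / 4 * (D.ε * (g.1 ^ 2 + g.2 ^ 2) / 2
      + bNorm P / 2 * w.V q * fem hD f q ^ 2) ≤ 128 * I := by
    refine le_trans ?_ (hd.trans (by linarith))
    exact mul_le_mul hvol hkey (by positivity) measureReal_nonneg
  have n1 : 0 ≤ hx * hy * (D.ε * g.1 ^ 2) := by positivity
  have n2 : 0 ≤ hx * hy * (D.ε * g.2 ^ 2) := by positivity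
  have n3 : 0 ≤ hx * hy * (bNorm P * w.V q * fem hD f q ^ 2) := by positivity
  refine ⟨by linarith, ?_, ?_⟩
  · have h1 : hx * hy * (D.ε * g.1 ^ 2) ≤ 1024 * I := by linarith
    have := mul_le_mul_of_nonneg_left h1 hxpos.le
    linarith
  · have h1 : hx * hy * (D.ε * g.2 ^ 2) ≤ 1024 * I := by linarith
    have := mul_le_mul_of_nonneg_left h1 hypos.le
    linarith

include hD in
lemma lt_mesh_of_lt {lam : ℝ} (h0 : 0 < lam) (h1 : lam ≤ 1 / 2) {i : ℕ} (h : D.N < 2 * i) :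
    1 - lam < meshPoint lam D.N i := by
  have he := hD.even
  have h2 : D.N ≤ 2 * (i - 1) := by
    obtain ⟨k, hk⟩ := he; omega
  have h3 := le_meshPoint_of_ge hD.pos h0 h2
  have h4 := (step_bounds hD h0 h1 (i - 1)).2.2 h2
  rw [Nat.sub_add_cancel (by omega)] at h4
  have h5 := hD.cast_pos
  have h6 : 0 < meshPoint lam D.N i - meshPoint lam D.N (i - 1) :=
    pos_of_mul_pos_left (by rw [h4]; linarith) h5.le
  linarith

/-- Summation up to the boundary, where the value is zero, with Cauchy–Schwarz over at most `N`
increments. This is the source of the factor N^{1/2} for nodes in the layers. -/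
lemma telescope {a q : ℕ → ℝ} {K : ℝ} {i N : ℕ} (hi : i ≤ N) (h0 : a N = 0)
    (h : ∀ l ∈ Finset.Ico i N, (a l - a (l + 1)) ^ 2 ≤ K * q l) :
    a i ^ 2 ≤ N * (K * ∑ l ∈ Finset.Ico i N, q l) := by
  have h1 : ∑ l ∈ Finset.Ico i N, (a l - a (l + 1)) = a i := by
    rw [Finset.sum_Ico_eq_sum_range]
    have h2 := Finset.sum_range_sub' (fun n => a (i + n)) (N - i)
    simp only [add_zero, Nat.add_sub_cancel' hi, h0, sub_zero] at h2
    exact h2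
  have h2 := sq_sum_le_card_mul_sum_sq (s := Finset.Ico i N) (f := fun l => a l - a (l + 1))
  rw [h1] at h2
  refine h2.trans ?_
  have h3 : (((Finset.Ico i N).card : ℕ) : ℝ) ≤ N := by
    rw [Nat.card_Ico]; exact_mod_cast Nat.sub_le _ _
  have h4 := Finset.sum_le_sum h
  rw [← Finset.mul_sum] at h4
  exact mul_le_mul h3 h4 (Finset.sum_nonneg fun l _ => sq_nonneg _) (Nat.cast_nonneg _)

-- Distinct open triangles are disjoint and the energy density is nonnegative, so the energies
-- collected along a mesh line are bounded by the total energy.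
include hD in
lemma sum_tria_le {f : ℝ × ℝ → ℝ} {s : Finset ℕ} {φ : ℕ → ℕ × ℕ × Bool}
    (hφ : Function.Injective φ) (hs : ∀ l ∈ s, φ l ∈ Grid.pieces D.N) :
    ∑ l ∈ s, ∫ p in tria hD (φ l), edens D w (fem hD f) p
      ≤ ∫ p in Omega, edens D w (fem hD f) p := by
  classical
  rw [integral_eq_sum_tria hD (bm_edens w (lip_fem hD f)),
    ← Finset.sum_image (f := fun τ => ∫ p in tria hD τ, edens D w (fem hD f) p)
      (hφ.injOn (s := s))]
  refine Finset.sum_le_sum_of_subset_of_nonneg (fun τ hτ => ?_) fun τ _ _ =>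
    setIntegral_nonneg (isOpen_tria hD τ).measurableSet fun p _ => edens_nonneg hD w p
  obtain ⟨l, hl, rfl⟩ := Finset.mem_image.mp hτ
  exact hs l hl

/-- The bound of the value at a node in the coarse region. -/
lemma sq_le_coarse {κ : ℝ} (hc : w.Cond D κ) (f : ℝ × ℝ → ℝ) {i j : ℕ} (hi : 2 * (i + 1) ≤ D.N)
    (hj : 2 * (j + 1) ≤ D.N) (hxs : w.xs = (meshX P D (i + 1), meshY P D (j + 1))) :
    fem hD f w.xs ^ 2 ≤ 2048 / bNorm P * (D.N : ℝ) ^ 2 * w.σβ *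
      ∫ p in Omega, edens D w (fem hD f) p := by
  have hb := bNorm_pos P
  have hN := hD.cast_pos
  have hσ := w.σβ_pos
  have h1 := (nodal_bounds hD hc f (k := i) (l := j) (by omega) (by omega)).1
  rw [← hxs] at h1
  -- At the centre of the weight both exponents vanish. This value brings σ_β into the bound of the
  -- Green function.
  have hV : w.V w.xs = 1 / (2 * w.σβ) := by
    simp [WeightData.V, WeightData.B, WeightData.r, WeightData.s, dot]
    field_simp
    norm_num
  have hx := (step_bounds hD hD.lamX_pos hD.lamX_le i).2.1 hi
  have hy := (step_bounds hD hD.lamY_pos hD.lamY_le j).2.1 hj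
  have hI := sum_tria_le (w := w) (f := f) hD (s := {j}) (φ := fun l => (i, l, true))
    (fun a b h => by simpa using h) (fun l hl => by
      rw [Finset.mem_singleton] at hl
      exact Grid.mem_pieces.mpr ⟨by simp; omega, by simp; omega⟩)
  rw [Finset.sum_singleton] at hI
  change 1 ≤ (meshX P D (i + 1) - meshX P D i) * D.N at hx
  change 1 ≤ (meshY P D (j + 1) - meshY P D j) * D.N at hy
  set hx' := meshX P D (i + 1) - meshX P D i
  set hy' := meshY P D (j + 1) - meshY P D j
  set X := ∫ p in Omega, edens D w (fem hD f) p
  set g := fem hD f w.xs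
  have hxy : 1 ≤ hx' * hy' * (D.N : ℝ) ^ 2 := by
    calc (1 : ℝ) = 1 * 1 := by norm_num
      _ ≤ hx' * D.N * (hy' * D.N) := mul_le_mul hx hy zero_le_one (by linarith)
      _ = _ := by ring
  rw [hV] at h1
  have h2 : hx' * hy' * (bNorm P * (1 / (2 * w.σβ)) * g ^ 2) ≤ 1024 * X := by linarith
  calc g ^ 2 ≤ hx' * hy' * (D.N : ℝ) ^ 2 * g ^ 2 := le_mul_of_one_le_left (sq_nonneg _) hxy
    _ = 2 * w.σβ * (D.N : ℝ) ^ 2 / bNorm P * (hx' * hy' * (bNorm P * (1 / (2 * w.σβ)) * g ^ 2)) := by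
      field_simp
    _ ≤ 2 * w.σβ * (D.N : ℝ) ^ 2 / bNorm P * (1024 * X) :=
      mul_le_mul_of_nonneg_left h2 (by positivity)
    _ = _ := by ring

include hD in
/-- One step of the summation along a mesh line in the layer. -/
lemma step_sq_le {ht hn lam β t I : ℝ} (hβ : 0 < β)
    (hlam : lam = 5 / 2 * (D.ε / β) * Real.log D.N) (hh : ht * D.N = 2 * lam)
    (hhn : 1 ≤ hn * D.N) (h : hn * (D.ε * t ^ 2) ≤ 1024 * ht * I) :
    t ^ 2 ≤ 5120 / β * Real.log D.N * I := by
  have hN := hD.cast_pos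
  have hε := hD.ε_pos
  have h1 : ht = 2 * lam / D.N := by rw [← hh]; field_simp
  -- The tangential width is 5ε ln N/(βN), while the normal one is at least 1/N; the ε in the aspect
  -- ratio matches the diffusion coefficient, and 5120 = 5 · 1024.
  have h2 : D.ε * t ^ 2 ≤ D.ε * (5120 / β * Real.log D.N * I) := by
    calc D.ε * t ^ 2 ≤ hn * D.N * (D.ε * t ^ 2) := le_mul_of_one_le_left (by positivity) hhn
      _ = D.N * (hn * (D.ε * t ^ 2)) := by ring
      _ ≤ D.N * (1024 * ht * I) := mul_le_mul_of_nonneg_left h hN.le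
      _ = D.ε * (5120 / β * Real.log D.N * I) := by
        rw [h1, hlam]; field_simp; ring
  exact le_of_mul_le_mul_left h2 hε

/-- The bound of the value at a node in the outflow layer in the first direction. -/
lemma sq_le_layer_fst {κ : ℝ} (hc : w.Cond D κ) {f : ℝ × ℝ → ℝ}
    (hf : (gridX hD).BdryZero (gridY hD) f) {i j : ℕ} (hi : D.N ≤ 2 * i) (hi' : i ≤ D.N)
    (hj : 2 * (j + 1) ≤ D.N) :
    fem hD f (meshX P D i, meshY P D (j + 1)) ^ 2 ≤ 5120 / P.β₁ * D.N * Real.log D.N *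
      ∫ p in Omega, edens D w (fem hD f) p := by
  have h0 : fem hD f (meshX P D D.N, meshY P D (j + 1)) = 0 :=
    fem_eq_zero hD hf fun h => absurd h.1.2 (by
      rw [show meshX P D D.N = 1 from (gridX hD).one]; exact lt_irrefl _)
  have hmain := telescope (a := fun l => fem hD f (meshX P D l, meshY P D (j + 1)))
    (q := fun l => ∫ p in tria hD (l, j, true), edens D w (fem hD f) p)
    (K := 5120 / P.β₁ * Real.log D.N) hi' h0 fun l hl => by
      rw [Finset.mem_Ico] at hl
      exact step_sq_le hD P.β₁_pos hD.lamX_eq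
        ((step_bounds hD hD.lamX_pos hD.lamX_le l).2.2 (by omega))
        ((step_bounds hD hD.lamY_pos hD.lamY_le j).2.1 hj)
        (nodal_bounds hD hc f (k := l) (l := j) hl.2 (by omega)).2.1
  have hsum := sum_tria_le (w := w) (f := f) hD (s := Finset.Ico i D.N)
    (φ := fun l => (l, j, true)) (fun a b h => by simpa using h) (fun l hl => by
      rw [Finset.mem_Ico] at hl
      exact Grid.mem_pieces.mpr ⟨hl.2, by simp; omega⟩)
  refine hmain.trans ?_
  have := P.β₁_pos
  have := hD.log_ge
  have h3 := mul_le_mul_of_nonneg_left hsum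
    (show 0 ≤ 5120 / P.β₁ * D.N * Real.log D.N by positivity)
  linarith

/-- The bound of the value at a node in the outflow layer in the second direction. -/
lemma sq_le_layer_snd {κ : ℝ} (hc : w.Cond D κ) {f : ℝ × ℝ → ℝ}
    (hf : (gridX hD).BdryZero (gridY hD) f) {i j : ℕ} (hi : 2 * (i + 1) ≤ D.N)
    (hj : D.N ≤ 2 * j) (hj' : j ≤ D.N) :
    fem hD f (meshX P D (i + 1), meshY P D j) ^ 2 ≤ 5120 / P.β₂ * D.N * Real.log D.N *
      ∫ p in Omega, edens D w (fem hD f) p := by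
  have h0 : fem hD f (meshX P D (i + 1), meshY P D D.N) = 0 :=
    fem_eq_zero hD hf fun h => absurd h.2.2 (by
      rw [show meshY P D D.N = 1 from (gridY hD).one]; exact lt_irrefl _)
  have hmain := telescope (a := fun l => fem hD f (meshX P D (i + 1), meshY P D l))
    (q := fun l => ∫ p in tria hD (i, l, true), edens D w (fem hD f) p)
    (K := 5120 / P.β₂ * Real.log D.N) hj' h0 fun l hl => by
      rw [Finset.mem_Ico] at hl
      exact step_sq_le hD P.β₂_pos hD.lamY_eq
        ((step_bounds hD hD.lamY_pos hD.lamY_le l).2.2 (by omega))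
        ((step_bounds hD hD.lamX_pos hD.lamX_le i).2.1 hi)
        (nodal_bounds hD hc f (k := i) (l := l) (by omega) hl.2).2.2
  have hsum := sum_tria_le (w := w) (f := f) hD (s := Finset.Ico j D.N)
    (φ := fun l => (i, l, true)) (fun a b h => by simpa using h) (fun l hl => by
      rw [Finset.mem_Ico] at hl
      exact Grid.mem_pieces.mpr ⟨by simp; omega, hl.2⟩)
  refine hmain.trans ?_
  have := P.β₂_pos
  have := hD.log_ge
  have h3 := mul_le_mul_of_nonneg_left hsum
    (show 0 ≤ 5120 / P.β₂ * D.N * Real.log D.N by positivity)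
  linarith

end

/-! ### Conditions on the weight parameters, identification of the norms, and constants -/

section

variable {P : Coeff} {D : Discr} (hD : Admissible P D)

section Conditions

lemma inv_le_of_mul_le {k a σ : ℝ} (hk : 0 < k) (ha : 0 < a) (h : k * a ≤ σ) :
    σ⁻¹ ≤ k⁻¹ * a⁻¹ := by
  rw [← mul_inv]; exact inv_anti₀ (mul_pos hk ha) h

/-- Since k ≥ 1, the power k⁻ⁿ may be weakened to k⁻¹, so that all conditions share the same small
parameter. -/
lemma inv_pow_le_of_mul_le {k a σ : ℝ} (hk : 1 ≤ k) (ha : 0 < a) (h : k * a ≤ σ) {n : ℕ}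
    (hn : n ≠ 0) : σ⁻¹ ^ n ≤ k⁻¹ * (a ^ n)⁻¹ := by
  have hk0 : 0 < k := by linarith
  have hσ : 0 < σ := (mul_pos hk0 ha).trans_le h
  calc σ⁻¹ ^ n ≤ (k⁻¹ * a⁻¹) ^ n :=
        pow_le_pow_left₀ (inv_pos.mpr hσ).le (inv_le_of_mul_le hk0 ha h) n
    _ = k⁻¹ ^ n * (a ^ n)⁻¹ := by rw [mul_pow, inv_pow a]
    _ ≤ k⁻¹ * (a ^ n)⁻¹ := by
      refine mul_le_mul_of_nonneg_right ?_ (by positivity)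
      exact pow_le_of_le_one (by positivity) (inv_le_one_of_one_le₀ hk) hn

lemma rpow_pow_eq {x : ℝ} (hx : 0 ≤ x) (s : ℝ) (n : ℕ) {m : ℕ} (h : s * n = m) :
    (x ^ s) ^ n = x ^ m := by
  rw [← Real.rpow_natCast, ← Real.rpow_mul hx, h, Real.rpow_natCast]

lemma rpow_neg_pow_eq {x : ℝ} (hx : 0 ≤ x) (s : ℝ) (n : ℕ) {m : ℕ} (h : s * n = m) :
    (x ^ (-s)) ^ n = (x ^ m)⁻¹ := by
  rw [Real.rpow_neg hx, inv_pow, rpow_pow_eq hx s n h]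

include hD in
/-- The conditions on the weight parameters imply those used in the analysis. -/
lemma cond_of_sigmaCond {k : ℝ} (hk : 32 ≤ k) (w : WeightData P)
    (h1 : SigmaCond1 P D k w.σβ w.ση) (h2 : SigmaCond2 D k w.σβ w.ση)
    (h3 : SigmaCond3 D k w.σβ w.ση) : w.Cond D k⁻¹ := by
  have hk0 : 0 < k := by linarith
  have hk1 : 1 ≤ k := by linarith
  have hN := hD.cast_pos
  have hN1 : (1 : ℝ) ≤ D.N := by linarith [hD.two_le_cast]
  have hε := hD.ε_pos
  have hεs := hD.εs_pos
  have hlog : 0 < Real.log D.N := by linarith [hD.log_ge]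
  have hCs := P.Cstar_pos
  obtain ⟨h1a, h1b⟩ := h1
  obtain ⟨h2a, h2b, h2c, h2d⟩ := h2
  obtain ⟨h3a, h3b, h3c⟩ := h3
  rw [mul_assoc] at h3a h3b
  have hê : ∀ e, 0 < e → e ≤ epsHatMax D → e * w.ση⁻¹ ^ 2 ≤ k⁻¹ := by
    intro e he hle
    have hM : 0 < epsHatMax D := he.trans_le hle
    have := inv_pow_le_of_mul_le hk1 (Real.sqrt_pos.mpr hM) h1b two_ne_zero
    rw [Real.sq_sqrt hM.le] at this
    calc e * w.ση⁻¹ ^ 2 ≤ epsHatMax D * (k⁻¹ * (epsHatMax D)⁻¹) :=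
          mul_le_mul hle this (by positivity) hM.le
      _ = k⁻¹ := by field_simp
  have hδM : 0 < deltaMax P D := div_pos hCs hN
  have hβ : ∀ e, 0 ≤ e → e ≤ D.ε + deltaMax P D → e * w.σβ⁻¹ ≤ k⁻¹ := by
    intro e he hle
    have hM : 0 < D.ε + deltaMax P D := by positivity
    have := inv_le_of_mul_le hk0 hM h1a
    have hσ := w.σβ_pos
    calc e * w.σβ⁻¹ ≤ (D.ε + deltaMax P D) * (k⁻¹ * (D.ε + deltaMax P D)⁻¹) :=
          mul_le_mul hle this (by positivity) hM.le
      _ = k⁻¹ := by field_simp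
  have hL : ∀ σ, k * ((D.N : ℝ)⁻¹ * Real.log D.N) ≤ σ → Real.log D.N * σ⁻¹ ≤ k⁻¹ * D.N := by
    intro σ h
    have := mul_le_mul_of_nonneg_left (inv_le_of_mul_le hk0 (by positivity) h) hlog.le
    refine this.trans_eq ?_
    field_simp
  have a34 : (0 : ℝ) < (D.N : ℝ) ^ (-(3 / 4) : ℝ) := Real.rpow_pos_of_pos hN _
  -- The bound of 1/σ_η by κN is implied by the stronger requirement with exponent -3/4, whose
  -- fourth power gives `hB4`.
  have hrp : (D.N : ℝ)⁻¹ ≤ (D.N : ℝ) ^ (-(3 / 4) : ℝ) := by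
    rw [← Real.rpow_neg_one]
    exact Real.rpow_le_rpow_of_exponent_le hN1 (by norm_num)
  refine
    { κ0 := by positivity
      κ1 := by rw [one_div]; exact inv_anti₀ (by norm_num) hk
      hA := ?_
      hB := ?_
      hB4 := ?_
      hs := ?_
      hf := hê _ hD.εf_pos (le_max_right _ _)
      hs' := hê _ hεs (le_max_left _ _)
      hε := hβ _ hε.le (by linarith)
      hδ := hβ _ hδM.le (by linarith [show deltaMax P D = P.Cstar / D.N from rfl])
      hLA := hL _ h3a
      hLB := hL _ h3b
      hL4 := ?_ }
  · have := inv_le_of_mul_le hk0 (inv_pos.mpr hN) h2a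
    rwa [inv_inv] at this
  · have := inv_le_of_mul_le hk0 (inv_pos.mpr hN)
      ((mul_le_mul_of_nonneg_left hrp hk0.le).trans h2b)
    rwa [inv_inv] at this
  · have := inv_pow_le_of_mul_le hk1 a34 h2b (n := 4) (by norm_num)
    rwa [rpow_neg_pow_eq hN.le _ 4 (m := 3) (by norm_num), inv_inv] at this
  · rcases le_total D.εs ((D.N : ℝ) ^ (-2 : ℝ)) with h | h
    · left
      have := inv_pow_le_of_mul_le hk1 (Real.rpow_pos_of_pos hN _) (h2c h) (n := 2) (by norm_num)
      rwa [rpow_neg_pow_eq hN.le _ 2 (m := 1) (by norm_num), inv_inv, pow_one] at this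
    · right
      have h' := h2d h
      rw [mul_assoc] at h'
      have := inv_pow_le_of_mul_le hk1 (mul_pos (Real.rpow_pos_of_pos hεs _)
        (Real.rpow_pos_of_pos hN _)) h' (n := 2) (by norm_num)
      rwa [mul_pow, rpow_neg_pow_eq hN.le _ 2 (m := 3) (by norm_num),
        rpow_neg_pow_eq hεs.le _ 2 (m := 1) (by norm_num), pow_one, mul_inv, inv_inv, inv_inv,
        ← mul_assoc] at this
  · have e : k * D.ε ^ (1 / 4 : ℝ) * (D.N : ℝ) ^ (-(1 / 2) : ℝ) * Real.log D.N ^ (1 / 2 : ℝ)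
        = k * (D.ε ^ (1 / 4 : ℝ) * (D.N : ℝ) ^ (-(1 / 2) : ℝ) * Real.log D.N ^ (1 / 2 : ℝ)) := by
      ring
    rw [e] at h3c
    have := inv_pow_le_of_mul_le hk1 (mul_pos (mul_pos (Real.rpow_pos_of_pos hε _)
      (Real.rpow_pos_of_pos hN _)) (Real.rpow_pos_of_pos hlog _)) h3c (n := 4) (by norm_num)
    rw [mul_pow, mul_pow, rpow_neg_pow_eq hN.le _ 4 (m := 2) (by norm_num),
      rpow_pow_eq hε.le _ 4 (m := 1) (by norm_num),
      rpow_pow_eq hlog.le _ 4 (m := 2) (by norm_num)] at this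
    have := mul_le_mul_of_nonneg_left this (show 0 ≤ D.ε * Real.log D.N ^ 2 by positivity)
    refine this.trans_eq ?_
    field_simp

end Conditions

section Norms

variable {G : ℝ × ℝ → ℝ}

lemma eqOn_fem (hG : G ∈ feSpace P D) : EqOn G (fem hD G) Omega := fun _ hp =>
  eq_fem_of_mem hD hG (subset_closure hp)

lemma dd_eq_fem (hG : G ∈ feSpace P D) (ζ : ℝ × ℝ) {p : ℝ × ℝ} (hp : p ∈ Omega) :
    dd ζ G p = dd ζ (fem hD G) p := by
  rw [dd, dd, ((eqOn_fem hD hG).eventuallyEq_of_mem (isOpen_Omega.mem_nhds hp)).fderiv_eq]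

lemma aMSD_fem (hG : G ∈ feSpace P D) (v : ℝ × ℝ → ℝ) :
    aMSD P D v (fem hD G) = aMSD P D v G := by
  unfold aMSD
  congr 1
  · congr 1
    · congr 1
      all_goals
        refine setIntegral_congr_fun measurableSet_Omega fun p hp => ?_
        simp only [dd_eq_fem hD hG _ hp]
    · refine setIntegral_congr_fun measurableSet_Omega fun p hp => ?_
      simp only [eqOn_fem hD hG hp]
  · refine setIntegral_congr_fun measurableSet_Omega fun p hp => ?_
    simp only [dd_eq_fem hD hG _ hp]

lemma normWeighted_eq (w : WeightData P) (hG : G ∈ feSpace P D) :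
    normWeighted P D w.σβ w.ση w.xs G = Real.sqrt (∫ p in Omega, edens D w (fem hD G) p) := by
  have hL := lip_fem hD G
  have hW := BM.of_continuous w.continuous_W
  have hV := BM.of_continuous w.continuous_V
  have hβ := hW.mul (BM.dd_of_lip (dirBeta P) hL).sq
  have hη := hW.mul (BM.dd_of_lip (dirEta P) hL).sq
  have i1 := (BM.const D.ε).mul hβ
  have i2 := (bm_epsHat (P := P) (D := D)).mul hη
  have i3 := (BM.const (bNorm P / 2)).mul (hV.mul hL.bm.sq)
  have i4 := (BM.const P.c).mul (hW.mul hL.bm.sq)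
  have i5 := ((BM.const (bNorm P ^ 2)).mul (bm_delta (P := P) (D := D))).mul hβ
  unfold normWeighted
  congr 1
  rw [← integral_const_mul, ← integral_const_mul]
  have sq : ∀ p x, (Real.sqrt (w.W p) * x) ^ 2 = w.W p * x ^ 2 := fun p x => by
    rw [mul_pow, Real.sq_sqrt (w.W_pos p).le]
  have sqV : ∀ p x, (Real.sqrt (w.V p) * x) ^ 2 = w.V p * x ^ 2 := fun p x => by
    rw [mul_pow, Real.sq_sqrt (w.V_pos p).le]
  simp only [w.W_eq, w.dd_beta_W, sq, sqV]
  calc _ = (∫ p in Omega, D.ε * (w.W p * dd (dirBeta P) (fem hD G) p ^ 2))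
        + (∫ p in Omega, epsHat P D p * (w.W p * dd (dirEta P) (fem hD G) p ^ 2))
        + (∫ p in Omega, bNorm P / 2 * (w.V p * fem hD G p ^ 2))
        + (∫ p in Omega, P.c * (w.W p * fem hD G p ^ 2))
        + (∫ p in Omega, bNorm P ^ 2 * delta P D p
          * (w.W p * dd (dirBeta P) (fem hD G) p ^ 2)) := by
        congr 1
        · congr 1
          · congr 1
            · congr 1
              all_goals
                refine setIntegral_congr_fun measurableSet_Omega fun p hp => ?_
                simp only [dd_eq_fem hD hG _ hp]
            · refine setIntegral_congr_fun measurableSet_Omega fun p hp => ?_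
              simp only [eqOn_fem hD hG hp]
          · refine setIntegral_congr_fun measurableSet_Omega fun p hp => ?_
            simp only [eqOn_fem hD hG hp]
        · refine setIntegral_congr_fun measurableSet_Omega fun p hp => ?_
          simp only [dd_eq_fem hD hG _ hp]
    _ = _ := by
        rw [← integral_add i1.integrableOn i2.integrableOn,
          ← integral_add (i1.add i2).integrableOn i3.integrableOn,
          ← integral_add ((i1.add i2).add i3).integrableOn i4.integrableOn,
          ← integral_add (((i1.add i2).add i3).add i4).integrableOn i5.integrableOn]
        refine setIntegral_congr_fun measurableSet_Omega fun p _ => ?_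
        simp only [edens, wdens]
        ring

-- From W ≥ 1/2 every unweighted term is at most twice its weighted counterpart, so the factor 8
-- under the root is generous.
include hD in
lemma normMSD_le (w : WeightData P) (hG : G ∈ feSpace P D) :
    normMSD P D G ≤ Real.sqrt 8 * normWeighted P D w.σβ w.ση w.xs G := by
  have hL := lip_fem hD G
  have hβ := BM.dd_of_lip (dirBeta P) hL
  have i1 := (BM.const D.ε).mul hβ.sq
  have i2 := (bm_epsHat (P := P) (D := D)).mul (BM.dd_of_lip (dirEta P) hL).sq
  have i3 := (BM.const P.c).mul hL.bm.sq
  have i4 := (bm_delta (P := P) (D := D)).mul ((BM.const (bNorm P)).mul hβ).sq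
  rw [normWeighted_eq hD w hG, ← Real.sqrt_mul (by norm_num)]
  unfold normMSD
  refine Real.sqrt_le_sqrt ?_
  calc _ = (∫ p in Omega, D.ε * dd (dirBeta P) (fem hD G) p ^ 2)
        + (∫ p in Omega, epsHat P D p * dd (dirEta P) (fem hD G) p ^ 2)
        + (∫ p in Omega, P.c * fem hD G p ^ 2)
        + (∫ p in Omega, delta P D p * (bNorm P * dd (dirBeta P) (fem hD G) p) ^ 2) := by
        congr 1
        · congr 1
          · congr 1
            all_goals
              refine setIntegral_congr_fun measurableSet_Omega fun p hp => ?_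
              simp only [dd_eq_fem hD hG _ hp]
          · refine setIntegral_congr_fun measurableSet_Omega fun p hp => ?_
            simp only [eqOn_fem hD hG hp]
        · refine setIntegral_congr_fun measurableSet_Omega fun p hp => ?_
          simp only [dd_eq_fem hD hG _ hp]
    _ ≤ _ := by
        rw [← integral_add i1.integrableOn i2.integrableOn,
          ← integral_add (i1.add i2).integrableOn i3.integrableOn,
          ← integral_add ((i1.add i2).add i3).integrableOn i4.integrableOn,
          ← integral_const_mul]
        refine setIntegral_mono_on (((i1.add i2).add i3).add i4).integrableOn
          ((BM.const 8).mul (bm_edens w hL)).integrableOn measurableSet_Omega fun p _ => ?_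
        have hW := w.half_le_W p
        have hV := w.V_pos p
        have hb := bNorm_pos P
        have hcp := P.c_pos
        have hCs := P.Cstar_pos
        have hε := hD.ε_pos
        have hδ0 : 0 ≤ delta P D p := by unfold delta; split_ifs <;> positivity
        have hê : 0 ≤ epsHat P D p := by
          unfold epsHat; split_ifs
          · exact hD.εs_pos.le
          · exact hD.εf_pos.le
        unfold edens wdens
        have t : ∀ x, 0 ≤ x → x ≤ 2 * (w.W p * x) := fun x hx => by
          linarith [mul_le_mul_of_nonneg_right hW hx]
        have p1 : 0 ≤ D.ε * dd (dirBeta P) (fem hD G) p ^ 2 := by positivity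
        have p2 : 0 ≤ epsHat P D p * dd (dirEta P) (fem hD G) p ^ 2 := by positivity
        have p3 : 0 ≤ P.c * fem hD G p ^ 2 := by positivity
        have p4 : 0 ≤ delta P D p * (bNorm P * dd (dirBeta P) (fem hD G) p) ^ 2 := by positivity
        have p5 : 0 ≤ bNorm P / 2 * w.V p * fem hD G p ^ 2 := by positivity
        linarith [t _ p1, t _ p2, t _ p3, t _ p4]

end Norms

section Nodes

lemma fem_node (f : ℝ × ℝ → ℝ) {k l : ℕ} (hk : k < D.N) (hl : l < D.N) :
    fem hD f (meshX P D (k + 1), meshY P D (l + 1)) = f (meshX P D (k + 1), meshY P D (l + 1)) :=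
  Grid.interp_anchor (gridX hD) (gridY hD) f (τ := (k, l, true)) (Grid.mem_pieces.mpr ⟨hk, hl⟩)

include hD in
lemma exists_node {xs : ℝ × ℝ} (h : IsInteriorNode P D xs) :
    ∃ k < D.N, ∃ l < D.N, xs = (meshX P D (k + 1), meshY P D (l + 1)) := by
  obtain ⟨hO, i, hi, j, hj, rfl⟩ := h
  have hi0 : i ≠ 0 := by
    rintro rfl
    have := hO.1.1
    rw [show meshX P D 0 = 0 from (gridX hD).zero] at this
    exact lt_irrefl _ this
  have hj0 : j ≠ 0 := by
    rintro rfl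
    have := hO.2.1
    rw [show meshY P D 0 = 0 from (gridY hD).zero] at this
    exact lt_irrefl _ this
  obtain ⟨k, rfl⟩ := Nat.exists_eq_succ_of_ne_zero hi0
  obtain ⟨l, rfl⟩ := Nat.exists_eq_succ_of_ne_zero hj0
  exact ⟨k, hi, l, hj, rfl⟩

include hD in
lemma le_of_mesh_le {lam : ℝ} (h0 : 0 < lam) (h1 : lam ≤ 1 / 2) {i : ℕ}
    (h : meshPoint lam D.N i ≤ 1 - lam) : 2 * i ≤ D.N :=
  not_lt.mp fun h' => absurd (lt_mesh_of_lt hD h0 h1 h') (not_lt.mpr h)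

include hD in
lemma le_of_le_mesh {lam : ℝ} (h0 : 0 < lam) (h1 : lam ≤ 1 / 2) {i : ℕ}
    (h : 1 - lam ≤ meshPoint lam D.N i) : D.N ≤ 2 * i := by
  by_contra h'
  have h2 : 2 * (i + 1) ≤ D.N := by
    obtain ⟨k, hk⟩ := hD.even; omega
  have h3 := meshPoint_le_of_le hD.pos h1 h2
  have h4 := (step_bounds hD h0 h1 i).2.1 h2
  have h5 : 0 < meshPoint lam D.N (i + 1) - meshPoint lam D.N i :=
    pos_of_mul_pos_left (by linarith) hD.cast_pos.le
  linarith

end Nodes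

/-- Combining the two inequalities gives X² ≤ 16 R X, hence X ≤ 16 R after dividing by X, and 128 =
8 · 16. -/
lemma sqrt_le_of_sq_le {X g R : ℝ} (hX : 0 ≤ X) (hR : 0 ≤ R) (h1 : X ≤ 4 * g)
    (h2 : g ^ 2 ≤ R * X) : Real.sqrt 8 * Real.sqrt X ≤ Real.sqrt (128 * R) := by
  rw [← Real.sqrt_mul (by norm_num)]
  refine Real.sqrt_le_sqrt ?_
  rcases hX.eq_or_lt with h | h
  · rw [← h]
    linarith
  · have h3 : X * X ≤ 16 * R * X := by
      have := mul_le_mul h1 h1 hX (hX.trans h1)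
      linarith
    have := le_of_mul_le_mul_right h3 h
    linarith

include hD in
/-- The energy of the discrete Green function is controlled by its value at the node. -/
lemma integral_edens_le_of_green {κ : ℝ} {w : WeightData P} (hc : w.Cond D κ)
    (hκb : 8 * κ ≤ bNorm P) (hκb' : 32 * bNorm P * κ ≤ 1) (hκc : 6 * κ ≤ P.c)
    (hκ1 : κ * cornerConst P ≤ 1 / 2) (hκ2 : stabConst P * residConst P * κ ≤ 1 / 8)
    {k l : ℕ} (hk : k < D.N) (hl : l < D.N) (hxs : w.xs = (meshX P D (k + 1), meshY P D (l + 1)))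
    {G : ℝ × ℝ → ℝ} (hG : IsDiscreteGreen P D w.xs G) :
    ∫ p in Omega, edens D w (fem hD G) p ≤ 4 * fem hD G w.xs := by
  have hf := bdryZero_of_frontier hD hG.1.2.1
  refine (integral_edens_le hD hc hκb hκb' hκc hκ1 hκ2 hf).trans_eq ?_
  rw [aMSD_fem hD hG.1, hG.2 _ (fem_mem_feSpace hD (bdryZero_W_mul w hD hf))]
  have := fem_node hD (fun q => w.W q * fem hD G q) hk hl
  rw [← hxs] at this
  rw [this, w.W_xs, one_mul]

/-- The lower bound of the parameter `k` in the conditions on the weight parameters. -/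
def kMin (P : Coeff) : ℝ :=
  32 + 8 / bNorm P + 32 * bNorm P + 6 / P.c + 2 * cornerConst P + 8 * (stabConst P * residConst P)

lemma kMin_facts {k : ℝ} (h : kMin P ≤ k) : 32 ≤ k ∧ 8 * k⁻¹ ≤ bNorm P ∧
    32 * bNorm P * k⁻¹ ≤ 1 ∧ 6 * k⁻¹ ≤ P.c ∧ k⁻¹ * cornerConst P ≤ 1 / 2 ∧
    stabConst P * residConst P * k⁻¹ ≤ 1 / 8 := by
  have hb := bNorm_pos P
  have hcp := P.c_pos
  have hcc : 0 < cornerConst P := by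
    have := P.β₁_pos
    have := P.β₂_pos
    unfold cornerConst; positivity
  have hs := stabConst_pos P
  have hr := residConst_pos P
  have n1 : 0 < 8 / bNorm P := by positivity
  have n2 : 0 < 6 / P.c := by positivity
  have n3 : 0 < stabConst P * residConst P := by positivity
  unfold kMin at h
  have hk : 0 < k := by linarith
  refine ⟨by linarith, ?_, ?_, ?_, ?_, ?_⟩
  · have : 8 / bNorm P ≤ k := by linarith
    rw [div_le_iff₀ hb] at this
    rw [← div_eq_mul_inv, div_le_iff₀ hk]
    linarith
  · rw [← div_eq_mul_inv, div_le_iff₀ hk]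
    linarith
  · have : 6 / P.c ≤ k := by linarith
    rw [div_le_iff₀ hcp] at this
    rw [← div_eq_mul_inv, div_le_iff₀ hk]
    linarith
  · rw [inv_mul_eq_div, div_le_iff₀ hk]
    linarith
  · rw [← div_eq_mul_inv, div_le_iff₀ hk]
    linarith

/-- The constant in the bound of the energy of the discrete Green function. -/
def greenConst (P : Coeff) : ℝ :=
  Real.sqrt (262144 / bNorm P) + Real.sqrt (655360 / P.β₁) + Real.sqrt (655360 / P.β₂)

lemma greenConst_facts (P : Coeff) : 0 < greenConst P ∧
    Real.sqrt (262144 / bNorm P) ≤ greenConst P ∧ Real.sqrt (655360 / P.β₁) ≤ greenConst P ∧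
    Real.sqrt (655360 / P.β₂) ≤ greenConst P := by
  have := bNorm_pos P
  have := P.β₁_pos
  have := P.β₂_pos
  have h1 : 0 < Real.sqrt (262144 / bNorm P) := by positivity
  have h2 : 0 < Real.sqrt (655360 / P.β₁) := by positivity
  have h3 : 0 < Real.sqrt (655360 / P.β₂) := by positivity
  unfold greenConst
  exact ⟨by linarith, by linarith, by linarith, by linarith⟩

end

end ShishkinSDFEM

end

/-! ### Assembly of the theorem -/

theorem mainTheorem1 (P : ShishkinSDFEM.Coeff) :
    ∃ k₀ : ℝ, 1 < k₀ ∧ ∃ C : ℝ, 0 < C ∧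
      ∀ k : ℝ, k₀ ≤ k →
      ∀ D : ShishkinSDFEM.Discr, ShishkinSDFEM.Admissible P D →
      ∀ σβ ση : ℝ, ShishkinSDFEM.SigmaCond1 P D k σβ ση →
        ShishkinSDFEM.SigmaCond2 D k σβ ση → ShishkinSDFEM.SigmaCond3 D k σβ ση →
      ∀ xs : ℝ × ℝ, ShishkinSDFEM.IsInteriorNode P D xs → xs ∉ ShishkinSDFEM.OmegaXY P D →
      ∀ G : ℝ × ℝ → ℝ, ShishkinSDFEM.IsDiscreteGreen P D xs G →
        ShishkinSDFEM.normMSD P D G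
            ≤ Real.sqrt 8 * ShishkinSDFEM.normWeighted P D σβ ση xs G ∧
        (xs ∈ ShishkinSDFEM.OmegaS P D →
          Real.sqrt 8 * ShishkinSDFEM.normWeighted P D σβ ση xs G
            ≤ C * D.N * σβ ^ (1 / 2 : ℝ)) ∧
        (xs ∈ ShishkinSDFEM.OmegaX P D ∪ ShishkinSDFEM.OmegaY P D →
          Real.sqrt 8 * ShishkinSDFEM.normWeighted P D σβ ση xs G
            ≤ C * (D.N : ℝ) ^ (1 / 2 : ℝ) * Real.log D.N ^ (1 / 2 : ℝ)) := by
  refine ⟨ShishkinSDFEM.kMin P, by linarith [(ShishkinSDFEM.kMin_facts (le_refl (ShishkinSDFEM.kMin P))).1],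
    ShishkinSDFEM.greenConst P,
    (ShishkinSDFEM.greenConst_facts P).1, ?_⟩
  intro k hk D hD σβ ση h1 h2 h3 xs hxs hxy G hG
  obtain ⟨k32, kb, kb', kc, k1, k2⟩ := ShishkinSDFEM.kMin_facts hk
  obtain ⟨-, g1, g2, g3⟩ := ShishkinSDFEM.greenConst_facts P
  have hN := hD.cast_pos
  have hlog : 0 < Real.log D.N := by linarith [hD.log_ge]
  have hb := ShishkinSDFEM.bNorm_pos P
  have hβ₁ := P.β₁_pos
  have hβ₂ := P.β₂_pos
  have hk0 : 0 < k := by linarith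
  -- Positivity of the weight parameters is a consequence of their lower bounds.
  have hσβ : 0 < σβ := (mul_pos hk0 (inv_pos.mpr hN)).trans_le h2.1
  have hση : 0 < ση := (mul_pos hk0 (Real.rpow_pos_of_pos hN _)).trans_le h2.2.1
  set w : ShishkinSDFEM.WeightData P := ⟨σβ, ση, xs, hσβ, hση⟩ with hw
  have hc : w.Cond D k⁻¹ := ShishkinSDFEM.cond_of_sigmaCond hD k32 w h1 h2 h3
  obtain ⟨i, hi, j, hj, hij⟩ := ShishkinSDFEM.exists_node hD hxs
  have hf := ShishkinSDFEM.bdryZero_of_frontier hD hG.1.2.1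
  have hle : _ ≤ 4 * ShishkinSDFEM.fem hD G xs :=
    ShishkinSDFEM.integral_edens_le_of_green hD hc kb kb' kc k1 k2 hi hj hij hG
  have hX : 0 ≤ ∫ p in ShishkinSDFEM.Omega,
      ShishkinSDFEM.edens D w (ShishkinSDFEM.fem hD G) p :=
    setIntegral_nonneg ShishkinSDFEM.measurableSet_Omega
      fun p _ => ShishkinSDFEM.edens_nonneg hD w p
  have hnorm : ShishkinSDFEM.normWeighted P D σβ ση xs G = _ :=
    ShishkinSDFEM.normWeighted_eq hD w hG.1
  have lx0 := hD.lamX_pos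
  have lx1 := hD.lamX_le
  have ly0 := hD.lamY_pos
  have ly1 := hD.lamY_le
  refine ⟨ShishkinSDFEM.normMSD_le hD w hG.1, ?_, ?_⟩
  · intro hS
    rw [hij] at hS
    have hsq := ShishkinSDFEM.sq_le_coarse hD hc G
      (ShishkinSDFEM.le_of_mesh_le hD lx0 lx1 hS.1.2)
      (ShishkinSDFEM.le_of_mesh_le hD ly0 ly1 hS.2.2) hij
    rw [hnorm]
    refine (ShishkinSDFEM.sqrt_le_of_sq_le hX
      (R := 2048 / ShishkinSDFEM.bNorm P * (D.N : ℝ) ^ 2 * σβ) (by positivity) hle hsq).trans ?_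
    have e : 128 * (2048 / ShishkinSDFEM.bNorm P * (D.N : ℝ) ^ 2 * σβ)
        = 262144 / ShishkinSDFEM.bNorm P * (D.N : ℝ) ^ 2 * σβ := by ring
    rw [e, Real.sqrt_mul (by positivity), Real.sqrt_mul (by positivity), Real.sqrt_sq hN.le,
      Real.sqrt_eq_rpow σβ]
    gcongr
  -- The two layers differ only in the constant β₁ or β₂ of the transition point; 655360 = 128 ·
  -- 5120.
  · have fin : ∀ β : ℝ, 0 < β → Real.sqrt (655360 / β) ≤ ShishkinSDFEM.greenConst P →
        ShishkinSDFEM.fem hD G xs ^ 2 ≤ 5120 / β * D.N * Real.log D.N *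
          (∫ p in ShishkinSDFEM.Omega, ShishkinSDFEM.edens D w (ShishkinSDFEM.fem hD G) p) →
        Real.sqrt 8 * ShishkinSDFEM.normWeighted P D σβ ση xs G
          ≤ ShishkinSDFEM.greenConst P * (D.N : ℝ) ^ (1 / 2 : ℝ)
            * Real.log D.N ^ (1 / 2 : ℝ) := by
      intro β hβ hg hsq
      rw [hnorm]
      refine (ShishkinSDFEM.sqrt_le_of_sq_le hX (R := 5120 / β * D.N * Real.log D.N)
        (by positivity) hle hsq).trans ?_
      have e : 128 * (5120 / β * D.N * Real.log D.N) = 655360 / β * D.N * Real.log D.N := by ring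
      rw [e, Real.sqrt_mul (by positivity), Real.sqrt_mul (by positivity),
        Real.sqrt_eq_rpow (D.N : ℝ), Real.sqrt_eq_rpow (Real.log D.N)]
      gcongr
    rintro (hx | hy)
    · rw [hij] at hx
      refine fin _ hβ₁ g2 ?_
      rw [hij]
      exact ShishkinSDFEM.sq_le_layer_fst hD hc hf
        (ShishkinSDFEM.le_of_le_mesh hD lx0 lx1 hx.1.1) hi
        (ShishkinSDFEM.le_of_mesh_le hD ly0 ly1 hx.2.2)
    · rw [hij] at hy
      refine fin _ hβ₂ g3 ?_
      rw [hij]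
      exact ShishkinSDFEM.sq_le_layer_snd hD hc hf
        (ShishkinSDFEM.le_of_mesh_le hD lx0 lx1 hy.1.2)
        (ShishkinSDFEM.le_of_le_mesh hD ly0 ly1 hy.2.1) hj
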